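/- Let $\mathcal M=\mathbb T=\mathbb R/2\pi\mathbb Z$ or $\mathcal M=\mathbb R$, with dual group $\widehat{\mathcal M}=\mathbb Z$ (counting measure) or $\mathbb R$ (Lebesgue measure), and $\widehat f(\xi)=\frac1{\sqrt{2\pi}}\int_{\mathcal M} f(x)e^{-ix\xi}\,dx$. Put $\widehat{\mathcal M}_*=\mathbb Z\setminus\{0\}$ if $\mathcal M=\mathbb T$ and $\widehat{\mathcal M}_*=\mathbb R$ if $\mathcal M=\mathbb R$. All functions are in $L^2(\mathcal M)$ and, if $\mathcal M=\mathbb T$, have mean zero. $\mathbf P_{>N}$ is the projection onto frequencies $|\xi|>N$. **Resonance functions.** $\Xi_{\rm KdV}(\xi,\xi_1,\xi_2)=-\xi^3+\xi_1^3+\xi_2^3$ and $\Xi_\delta(\xi,\xi_1,\xi_2)=-\xi\mathcal L_\delta(\xi)+\xi_1\mathcal L_\delta(\xi_1)+\xi_2\mathcal L_\delta(\xi_2)$, where $\mathcal L_\delta(\xi)=3\delta^{-1}\big(\xi\coth(\delta\xi)-\delta^{-1}\big)$, $\mathcal L_\delta(0)=0$. Set $\varphi_\delta(t,\cdot)=e^{it\Xi_\delta(\cdot)}-e^{it\Xi_{\rm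 KdV}(\cdot)}$. **Ordered trees.** For $j\ge1$, $\mathfrak T(j)$ is the set of ordered planar binary trees of $j$ generations: such a tree $\mathcal T_j$ is grown from a single root node in $j$ steps, the $k$th of which turns one terminal node $r^{(k)}$ (with $r^{(1)}=r$ the root) into a non-terminal node with a left and a right child, and the order of the steps is remembered, so $|\mathfrak T(j)|=j!$. $\mathcal T_j^\infty$ is the set of its $j+1$ terminal nodes. An index function $\pmb\xi\in\mathfrak N(\mathcal T_j)$ assigns to every node $a$ a frequency $\xi_a\in\widehat{\mathcal M}_*$ with $\xi_a=\xi_{a_1}+\xi_{a_2}$ for every non-terminal node $a$ with children $a_1,a_2$. Write $(\xi^{(k)},\xi^{(k)}_1,\xi^{(k)}_2)$ for the frequencies of $r^{(k)}$ and its left and right children, $\mu_k=\Xi_{\rm KdV}(\xi^{(k)},\xi^{(k)}_1,\xi^{(k)}_2)$ and $\widetilde\mu_k=\mu_1+\dots+\mu_k$. Given $K\ge1$, let $$A_1=\{|\mu_1|\le(3K)^4\},\qquad A_k=\{|\widetilde\mu_k|\le(k+2)^4|\widetilde\mu_{k-1}|\}\quad(k\ge2).$$ Let $\int_{\xi_r=\xi}$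 denote integration over all $\pmb\xi\in\mathfrak N(\mathcal T_j)$ with $\xi_r=\xi$ ($j$ free frequencies). For $j\ge1$ define $$\mathcal N_0^{(j)}(t)(\mathbf u)(\xi)=(-1)^{j-1}\sum_{\mathcal T_j\in\mathfrak T(j)}\int_{\xi_r=\xi}\mathbf 1_{\bigcap_{k=1}^jA_k^c}\frac{e^{it\widetilde\mu_j}\prod_{k=1}^j\xi^{(k)}}{\prod_{k=1}^j\widetilde\mu_k}\prod_{a\in\mathcal T_j^\infty}\widehat{\mathbf u}(\xi_a),$$ $$\mathcal N_1^{(j)}(t)(\mathbf u)(\xi)=(-1)^{j-1}\sum_{\mathcal T_j\in\mathfrak T(j)}\int_{\xi_r=\xi}\mathbf 1_{A_j\cap\bigcap_{k=1}^{j-1}A_k^c}\frac{i\,e^{it\widetilde\mu_j}\prod_{k=1}^j\xi^{(k)}}{\prod_{k=1}^{j-1}\widetilde\mu_k}\prod_{a\in\mathcal T_j^\infty}\widehat{\mathbf u}(\xi_a),$$ let $\mathcal N_2^{(j)}$ be defined like $\mathcal N_1^{(j)}$ with $\mathbf 1_{\bigcap_{k=1}^{j}A_k^c}$ as the indicator function,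 and let $$\mathcal E_\delta^{(j)}(t)(\mathbf u)(\xi)=(-1)^{j-1}\sum_{\mathcal T_j\in\mathfrak T(j)}\int_{\xi_r=\xi}\mathbf 1_{\bigcap_{k=1}^{j-1}A_k^c}\,\varphi_\delta\big(t,\xi^{(j)},\xi^{(j)}_1,\xi^{(j)}_2\big)\frac{i\,e^{it\widetilde\mu_{j-1}}\prod_{k=1}^j\xi^{(k)}}{\prod_{k=1}^{j-1}\widetilde\mu_k}\prod_{a\in\mathcal T_j^\infty}\widehat{\mathbf u}(\xi_a),$$ $$\widetilde{\mathcal N}_2^{(j)}(t)(\mathbf u)(\xi)=\big(\mathbf 1_{|\xi|\ge\frac12}\,\xi^{-1}+\mathbf 1_{|\xi|<\frac12}\big)\,\mathcal N_2^{(j)}(t)(\mathbf u)(\xi).$$ **Proposition.** Let $0<\theta<\frac13$ if $\mathcal M=\mathbb T$ and $\frac1{14}<\theta<\frac12$ if $\mathcal M=\mathbb R$. For every $K\ge1$, $j\ge1$ and $\mathbf u$, all the integrals above converge absolutely for almost every $\xi$ (for all $t\in\mathbb R$ and $\delta>0$), and they define measurable functions of $\xi$. Moreover: (i) There is a constant $C>0$,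 depending only on $\mathcal M$ and $\theta$, such that for all $j\ge1$, $K\ge1$ and all $\mathbf u_1,\mathbf u_2$, $$\sup_{t\in\mathbb R}\big\|\mathcal N_0^{(j)}(t)(\mathbf u_1)-\mathcal N_0^{(j)}(t)(\mathbf u_2)\big\|_{L^2_\xi}\le CK^{-4j\theta}\big(\|\widehat{\mathbf u}_1\|_{L^2_\xi}+\|\widehat{\mathbf u}_2\|_{L^2_\xi}\big)^j\|\widehat{\mathbf u}_1-\widehat{\mathbf u}_2\|_{L^2_\xi},$$ $$\sup_{t\in\mathbb R}\big\|\mathcal N_1^{(j)}(t)(\mathbf u_1)-\mathcal N_1^{(j)}(t)(\mathbf u_2)\big\|_{L^2_\xi}\le CK^{6-4j\theta}\big(\|\widehat{\mathbf u}_1\|_{L^2_\xi}+\|\widehat{\mathbf u}_2\|_{L^2_\xi}\big)^j\|\widehat{\mathbf u}_1-\widehat{\mathbf u}_2\|_{L^2_\xi}.$$ (ii) For every $K\ge1$, $\lim_{j\to\infty}\sup_{t\in\mathbb R}\|\widetilde{\mathcal N}_2^{(j)}(t)(\mathbf u)\|_{L^\infty_\xi}=0$, uniformly for $\mathbf u$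 in bounded subsets of $L^2(\mathcal M)$. (iii) Let $R>0$. There is $\tau_*=\tau_*(R)>0$ such that the following holds. Let functions $\varepsilon'\mapsto N_3(\varepsilon')\in\mathbb N$ and $\varepsilon'\mapsto\delta_3(\varepsilon')\in(0,1]$ of $\varepsilon'>0$ be given. Then for all $N\in\mathbb N$, $T>0$ and $\varepsilon>0$ there is $\delta_4\in(0,1]$, depending only on $\varepsilon,T,N,R$ and on the functions $N_3,\delta_3$, such that for every $K\ge1$ with $K^{4\theta}>R$ and every family $\{\mathbf u_\delta\}_{0<\delta\le1}$ with $$\sup_{0<\delta\le1}\|\mathbf u_\delta\|_{L^2}\le R\qquad\text{and}\qquad\sup_{0<\delta\le\delta_3(\varepsilon')}\|\mathbf P_{>N'}\mathbf u_\delta\|_{L^2}<\varepsilon'\quad\text{for all }\varepsilon'>0\text{ and all integers }N'\ge N_3(\varepsilon'),$$ one has $$\tau\sum_{j=1}^\infty\sup_{|t|\le T}\big\|\mathbf 1_{|\xi|\le N}\,\mathcal E_\delta^{(j)}(t)(\mathbf u_\delta)\big\|_{L^2_\xi}<\varepsilon\qquad\text{for all }0<\tau<\tau_*\text{ and }0<\delta<\delta_4.$$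 (In (iii), $\tau_*$ and $\delta_4$ may also depend on $\mathcal M$ and $\theta$.) -/

import Mathlib

open MeasureTheory Filter Topology
open scoped ENNReal NNReal

noncomputable section

namespace NormalForm

/-! ### The two geometries, Fourier transform, frequency projections -/

instance factTwoPiPos : Fact (0 < 2 * Real.pi) := ⟨Real.two_pi_pos⟩

/-- The spatial domain: the circle `ℝ / 2πℤ` or the real line. -/
inductive Geometry
  | circle
  | line

namespace Geometry

/-- The underlying space `𝓜`. -/
def Space : Geometry → Type
  | circle => AddCircle (2 * Real.pi)
  | line => ℝ

/-- Lebesgue measure on `𝓜` (total mass `2π` on the circle). -/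
instance instMeasureSpaceSpace : (M : Geometry) → MeasureSpace M.Space
  | circle => inferInstanceAs (MeasureSpace (AddCircle (2 * Real.pi)))
  | line => inferInstanceAs (MeasureSpace ℝ)

/-- The Pontryagin dual of `𝓜`. -/
def Freq : Geometry → Type
  | circle => ℤ
  | line => ℝ

instance instAddCommGroupFreq : (M : Geometry) → AddCommGroup M.Freq
  | circle => inferInstanceAs (AddCommGroup ℤ)
  | line => inferInstanceAs (AddCommGroup ℝ)

/-- Counting measure on `ℤ`, Lebesgue measure on `ℝ`. -/
instance instMeasureSpaceFreq : (M : Geometry) → MeasureSpace M.Freq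
  | circle => @MeasureSpace.mk ℤ inferInstance Measure.count
  | line => inferInstanceAs (MeasureSpace ℝ)

/-- A frequency as a real number. -/
def toReal : (M : Geometry) → M.Freq → ℝ
  | circle => fun n : ℤ => (n : ℝ)
  | line => fun x : ℝ => x

/-- The admissible frequencies: `ℤ \ {0}` on the circle and `ℝ` on the line. -/
def freqStar : (M : Geometry) → Set M.Freq
  | circle => {n : ℤ | n ≠ 0}
  | line => (Set.univ : Set ℝ)

/-- The space `L²(𝓜)` of complex-valued functions. -/
abbrev L2 (M : Geometry) : Type := Lp ℂ 2 (volume : Measure M.Space)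

end Geometry

/-- `(2π)^{-1/2} ∫ f(x) e^{-inx} dx` on the circle. -/
def hatCircle (u : Lp ℂ 2 (volume : Measure (AddCircle (2 * Real.pi)))) (n : ℤ) : ℂ :=
  ((Real.sqrt (2 * Real.pi))⁻¹ : ℂ) *
    ∫ x : AddCircle (2 * Real.pi), fourier (-n) x * u x

/-- The `L²` Fourier transform on the line, normalised as `(2π)^{-1/2} ∫ f(x) e^{-ixξ} dx`.
(Mathlib's transform is `∫ f(x) e^{-2πixξ} dx`, extended to `L²`.) -/
def hatLine (u : Lp ℂ 2 (volume : Measure ℝ)) (ξ : ℝ) : ℂ :=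
  ((Real.sqrt (2 * Real.pi))⁻¹ : ℂ) * (Lp.fourierTransformₗᵢ ℝ ℂ u) (ξ / (2 * Real.pi))

/-- The Fourier transform of a function in `L²(𝓜)`. -/
def hat : (M : Geometry) → M.L2 → M.Freq → ℂ
  | .circle => hatCircle
  | .line => hatLine

/-- Mean-zero condition: imposed on the circle only. -/
def MeanZero : (M : Geometry) → M.L2 → Prop
  | .circle => fun u => ∫ x : Geometry.circle.Space, u x = 0
  | .line => fun _ => True

/-- `P_{>N} u` on the circle: subtract the partial sum of the Fourier series over `|n| ≤ N`. -/
def highPassCircle (N : ℕ) (u : Lp ℂ 2 (volume : Measure (AddCircle (2 * Real.pi)))) :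
    Lp ℂ 2 (volume : Measure (AddCircle (2 * Real.pi))) :=
  u - ContinuousMap.toLp (E := ℂ) 2 volume ℂ
    (∑ n ∈ Finset.Icc (-(N : ℤ)) (N : ℤ),
      (((Real.sqrt (2 * Real.pi))⁻¹ : ℂ) * hatCircle u n) • fourier n)

/-- `P_{>N} u` on the line: the Fourier multiplier with symbol `1_{|ξ| > N}`. -/
def highPassLine (N : ℕ) (u : Lp ℂ 2 (volume : Measure ℝ)) : Lp ℂ 2 (volume : Measure ℝ) :=
  (Lp.fourierTransformₗᵢ ℝ ℂ).symm
    (MemLp.toLp (Set.indicator {η : ℝ | (N : ℝ) < |2 * Real.pi * η|} (Lp.fourierTransformₗᵢ ℝ ℂ u))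
      ((Lp.memLp _).indicator
        (measurableSet_lt measurable_const ((measurable_const.mul measurable_id).abs))))

/-- The projection `P_{>N}` onto the frequencies `|ξ| > N`. -/
def highPass : (M : Geometry) → ℕ → M.L2 → M.L2
  | .circle => highPassCircle
  | .line => highPassLine

/-! ### Resonance functions -/

/-- The KdV resonance function. -/
def resKdV (ξ ξ₁ ξ₂ : ℝ) : ℝ := -ξ ^ 3 + ξ₁ ^ 3 + ξ₂ ^ 3

/-- The multiplier `L_δ(ξ) = 3 δ⁻¹ (ξ coth(δξ) - δ⁻¹)` of the scaled ILW equation, with its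
limiting value `0` at `ξ = 0`. -/
def symbolILW (δ ξ : ℝ) : ℝ :=
  if ξ = 0 then 0 else 3 / δ * (ξ * (Real.cosh (δ * ξ) / Real.sinh (δ * ξ)) - 1 / δ)

/-- The resonance function of the scaled ILW equation. -/
def resILW (δ ξ ξ₁ ξ₂ : ℝ) : ℝ :=
  -(ξ * symbolILW δ ξ) + ξ₁ * symbolILW δ ξ₁ + ξ₂ * symbolILW δ ξ₂

/-- `φ_δ`, the difference of the oscillatory factors. -/
def phaseDiff (δ t ξ ξ₁ ξ₂ : ℝ) : ℂ :=
  Complex.exp (Complex.I * ((t * resILW δ ξ ξ₁ ξ₂ : ℝ) : ℂ)) -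
    Complex.exp (Complex.I * ((t * resKdV ξ ξ₁ ξ₂ : ℝ) : ℂ))

/-! ### Ordered binary trees -/

/-- A node of a planar binary tree, encoded by the path from the root, latest step first:
the root is `[]`, the left and right children of `a` are `false :: a` and `true :: a`. -/
abbrev Node : Type := List Bool

/-- An ordered binary tree of the `j`th generation, i.e. a tree together with its chronicle:
`branch k` is the `(k+1)`st node that is turned into a non-terminal node.  The first one is the
root; each later one is a terminal node of the tree grown so far, i.e. a child of an earlier
`branch i` which is not itself a `branch i`. -/
structure OrderedTree (j : ℕ) where
  branch : Fin j → Node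
  injective : Function.Injective branch
  root : ∀ k : Fin j, (k : ℕ) = 0 → branch k = []
  grow : ∀ k : Fin j, (k : ℕ) ≠ 0 → ∃ i < k, ∃ b : Bool, branch k = b :: branch i

namespace OrderedTree

variable {j : ℕ}

theorem length_branch_le (T : OrderedTree j) (k : Fin j) : (T.branch k).length ≤ k := by
  obtain ⟨k, hk⟩ := k
  induction k using Nat.strong_induction_on with
  | _ k ih =>
    by_cases h0 : k = 0
    · simp [T.root ⟨k, hk⟩ h0]
    · obtain ⟨⟨i, hi⟩, hik, b, hb⟩ := T.grow ⟨k, hk⟩ h0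
      have hik' : i < k := hik
      have := ih i hik' hi
      simp only [hb, List.length_cons] at *
      omega

instance instFiniteOrderedTree : Finite (OrderedTree j) := by
  have hfin : {a : Node | a.length ≤ j}.Finite := List.finite_length_le Bool j
  have : Finite {a : Node // a.length ≤ j} := hfin.to_subtype
  refine Finite.of_injective
    (fun (T : OrderedTree j) (k : Fin j) =>
      (⟨T.branch k, (T.length_branch_le k).trans k.2.le⟩ : {a : Node // a.length ≤ j})) ?_
  intro T S h
  have hb : T.branch = S.branch := by
    funext k
    exact congrArg Subtype.val (congrFun h k)
  cases T
  cases S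
  simpa using hb

instance instFintypeOrderedTree : Fintype (OrderedTree j) := Fintype.ofFinite _

/-- The root node `r^{(k)}` of the `k`th generation, `k = 1, …, j` (junk for other `k`). -/
def r (T : OrderedTree j) (k : ℕ) : Node :=
  if h : k - 1 < j then T.branch ⟨k - 1, h⟩ else []

/-- The non-terminal nodes. -/
def internal (T : OrderedTree j) : Finset Node := Finset.univ.image T.branch

/-- The terminal nodes: children of non-terminal nodes that are not themselves non-terminal. -/
def leaves (T : OrderedTree j) : Finset Node :=
  (T.internal.image (List.cons false) ∪ T.internal.image (List.cons true)) \ T.internal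

/-- All nodes. -/
def nodes (T : OrderedTree j) : Finset Node := T.internal ∪ T.leaves

/-- The index function with root frequency `ξ` whose value at the left child of `r^{(k+1)}` is
`η k`; the value at the right child is then `ξ_a - ξ_{a₁}`.  As `η` ranges over all of
`Fin j → 𝓜^`, this parametrises all `𝛏` with `ξ_a = ξ_{a₁} + ξ_{a₂}` and `ξ_r = ξ`, and it differs
from the parametrisation by all but one of the terminal frequencies by a unimodular integer
change of variables. -/
def freq {M : Geometry} (T : OrderedTree j) (ξ : M.Freq) (η : Fin j → M.Freq) : Node → M.Freq
  | [] => ξ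
  | b :: a =>
    open Classical in
    if h : ∃ k, T.branch k = a then
      (if b then freq T ξ η a - η h.choose else η h.choose)
    else 0

/-- Compatibility of the index function: `ξ_a = ξ_{a₁} + ξ_{a₂}` at non-terminal nodes. -/
theorem freq_eq_add {M : Geometry} (T : OrderedTree j) (ξ : M.Freq) (η : Fin j → M.Freq)
    (k : Fin j) :
    T.freq ξ η (T.branch k) =
      T.freq ξ η (false :: T.branch k) + T.freq ξ η (true :: T.branch k) := by
  have h : ∃ i, T.branch i = T.branch k := ⟨k, rfl⟩
  simp [freq]

section Frequencies

variable {M : Geometry} (T : OrderedTree j) (ξ : M.Freq) (η : Fin j → M.Freq)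

/-- `ξ^{(k)}` -/
def gen (k : ℕ) : ℝ := M.toReal (T.freq ξ η (T.r k))

/-- `ξ^{(k)}_1` -/
def gen₁ (k : ℕ) : ℝ := M.toReal (T.freq ξ η (false :: T.r k))

/-- `ξ^{(k)}_2` -/
def gen₂ (k : ℕ) : ℝ := M.toReal (T.freq ξ η (true :: T.r k))

/-- `μ_k` -/
def mu (k : ℕ) : ℝ := resKdV (T.gen ξ η k) (T.gen₁ ξ η k) (T.gen₂ ξ η k)

/-- `μ̃_m = μ_1 + ⋯ + μ_m` -/
def muTilde (m : ℕ) : ℝ := ∑ k ∈ Finset.Icc 1 m, T.mu ξ η k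

/-- Every node carries an admissible frequency. -/
def IsIndex : Prop := ∀ a ∈ T.nodes, T.freq ξ η a ∈ M.freqStar

/-- Membership in the nearly resonant set `A_k` of the `k`th generation, `k ≥ 1`. -/
def NearRes (K : ℝ) (k : ℕ) : Prop :=
  if k = 1 then |T.muTilde ξ η 1| ≤ (3 * K) ^ 4
  else |T.muTilde ξ η k| ≤ ((k : ℝ) + 2) ^ 4 * |T.muTilde ξ η (k - 1)|

/-- Membership in `A_1ᶜ ∩ ⋯ ∩ A_mᶜ`. -/
def NonRes (K : ℝ) (m : ℕ) : Prop := ∀ k ∈ Finset.Icc 1 m, ¬ T.NearRes ξ η K k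

/-- `e^{i t μ̃_m}` -/
def phase (t : ℝ) (m : ℕ) : ℂ := Complex.exp (Complex.I * ((t * T.muTilde ξ η m : ℝ) : ℂ))

/-- `∏_{k=1}^j ξ^{(k)} / ∏_{k=1}^m μ̃_k` -/
def weight (m : ℕ) : ℂ :=
  (((∏ k ∈ Finset.Icc 1 j, T.gen ξ η k) / ∏ k ∈ Finset.Icc 1 m, T.muTilde ξ η k : ℝ) : ℂ)

/-- The product of `û(ξ_a)` over the terminal nodes `a`. -/
def leafProd (u : M.L2) : ℂ := ∏ a ∈ T.leaves, hat M u (T.freq ξ η a)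

end Frequencies

end OrderedTree

/-! ### The multilinear operators (`j ≥ 1`) -/

section Operators

variable {M : Geometry} {j : ℕ}

/-- Integrand of `N_0^{(j)}` for one tree. -/
def integrandN0 (K t : ℝ) (u : M.L2) (T : OrderedTree j) (ξ : M.Freq) : (Fin j → M.Freq) → ℂ :=
  Set.indicator {η | T.IsIndex ξ η ∧ T.NonRes ξ η K j}
    (fun η => T.phase ξ η t j * T.weight ξ η j * T.leafProd ξ η u)

/-- Integrand of `N_1^{(j)}` for one tree. -/
def integrandN1 (K t : ℝ) (u : M.L2) (T : OrderedTree j) (ξ : M.Freq) : (Fin j → M.Freq) → ℂ :=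
  Set.indicator {η | T.IsIndex ξ η ∧ T.NearRes ξ η K j ∧ T.NonRes ξ η K (j - 1)}
    (fun η => Complex.I * T.phase ξ η t j * T.weight ξ η (j - 1) * T.leafProd ξ η u)

/-- Integrand of `N_2^{(j)}` for one tree. -/
def integrandN2 (K t : ℝ) (u : M.L2) (T : OrderedTree j) (ξ : M.Freq) : (Fin j → M.Freq) → ℂ :=
  Set.indicator {η | T.IsIndex ξ η ∧ T.NonRes ξ η K j}
    (fun η => Complex.I * T.phase ξ η t j * T.weight ξ η (j - 1) * T.leafProd ξ η u)

/-- Integrand of `E_δ^{(j)}` for one tree. -/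
def integrandE (K δ t : ℝ) (u : M.L2) (T : OrderedTree j) (ξ : M.Freq) :
    (Fin j → M.Freq) → ℂ :=
  Set.indicator {η | T.IsIndex ξ η ∧ T.NonRes ξ η K (j - 1)}
    (fun η => phaseDiff δ t (T.gen ξ η j) (T.gen₁ ξ η j) (T.gen₂ ξ η j) *
      (Complex.I * T.phase ξ η t (j - 1)) * T.weight ξ η (j - 1) * T.leafProd ξ η u)

end Operators

section Operators

variable {M : Geometry}

/-- `N_0^{(j)}(t)(u)(ξ)` -/
def opN0 (K : ℝ) (j : ℕ) (t : ℝ) (u : M.L2) (ξ : M.Freq) : ℂ :=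
  (-1) ^ (j - 1) * ∑ T : OrderedTree j, ∫ η, integrandN0 K t u T ξ η

/-- `N_1^{(j)}(t)(u)(ξ)` -/
def opN1 (K : ℝ) (j : ℕ) (t : ℝ) (u : M.L2) (ξ : M.Freq) : ℂ :=
  (-1) ^ (j - 1) * ∑ T : OrderedTree j, ∫ η, integrandN1 K t u T ξ η

/-- `N_2^{(j)}(t)(u)(ξ)` -/
def opN2 (K : ℝ) (j : ℕ) (t : ℝ) (u : M.L2) (ξ : M.Freq) : ℂ :=
  (-1) ^ (j - 1) * ∑ T : OrderedTree j, ∫ η, integrandN2 K t u T ξ η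

/-- `E_δ^{(j)}(t)(u)(ξ)` -/
def opE (K δ : ℝ) (j : ℕ) (t : ℝ) (u : M.L2) (ξ : M.Freq) : ℂ :=
  (-1) ^ (j - 1) * ∑ T : OrderedTree j, ∫ η, integrandE K δ t u T ξ η

/-- `Ñ_2^{(j)}(t)(u)(ξ) = (1_{|ξ| ≥ 1/2} ξ⁻¹ + 1_{|ξ| < 1/2}) N_2^{(j)}(t)(u)(ξ)` -/
def opN2Tilde (K : ℝ) (j : ℕ) (t : ℝ) (u : M.L2) (ξ : M.Freq) : ℂ :=
  (if 1 / 2 ≤ |M.toReal ξ| then ((M.toReal ξ : ℂ))⁻¹ else 1) * opN2 K j t u ξ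

/-- The norm of `L^p_ξ` on the frequency side. -/
def freqNorm (p : ℝ≥0∞) (f : M.Freq → ℂ) : ℝ≥0∞ := eLpNorm f p volume

/-- Multiplication by `1_{|ξ| ≤ N}`. -/
def lowFreq (N : ℕ) (f : M.Freq → ℂ) : M.Freq → ℂ :=
  Set.indicator {ξ | |M.toReal ξ| ≤ (N : ℝ)} f

end Operators

end NormalForm

end

open MeasureTheory Filter Topology
open scoped ENNReal NNReal

noncomputable section

namespace NormalForm

variable {M : Geometry}
open NormalForm.Geometry

/-! ### The frequency groups ℤ and ℝ treated together -/

namespace Geometry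

/-! The KdV resonance factors: for ξ = x + y it equals −3(x+y)xy, so |μ_k| is three times the
product of the moduli of the three frequencies of generation k. On the sets A_kᶜ the partial sums
grow so fast that |μ̃_k| and |μ_k| agree up to a factor 2 (`NonRes.mu_bounds`) and |μ̃_k| exceeds
K⁴((k+2)!)⁴/16 (`NonRes.lt_muTilde`). The weights, which couple the generations through μ̃_k, are
therefore dominated by a product of kernels 1/|ξ₁ξ₂| restricted to |ξξ₁ξ₂| ≥ m_k, one for each
generation (`NonRes.ratio_le`).

Such a product can be integrated from the last generation backwards: the last free variable occurs
only at the two newest leaves, and integrating it out replaces their two functions by a single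
function at the parent (`lintegral_peel`, `treeForm_succ`). What remains are bilinear estimates,
obtained from Cauchy–Schwarz and ∫ kernel² ≤ 80/m uniformly in the output frequency
(`lintegral_kernel_sq_le`). Over j generations this gives K^(−2j) times inverse factorials. The
factorials beat the number of trees, which is at most j!, and K^(−2j) ≤ K^(−4jθ) because θ < 1/2.
This settles N₀.

In N₁ the last generation has no denominator but is nearly resonant: its product of frequencies is
at most a polynomial in j times that of the preceding generation. These two generations are
estimated jointly in L² (`sqNorm_nearForm_le`), separately for the last root being a child of the
preceding one (`sqNorm_nestForm_le`) and for disjoint sets of children (`sq_pairForm_le`). For j ≥ 2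
the gain of two generations is given up, which the factor K⁶ pays for.

In N₂ and E the last generation has a derivative and no compensation, so an L² bound is replaced by
a pointwise one. The last root then carries a function of size max(1,|x|), and this growth is
reproduced by every nonresonant generation above it at the price of 1/√m in place of 1/m
(`sq_treeForm_le_of_growth`). The weight in Ñ₂ removes the growth at the root, and on |ξ| ≤ N it is
harmless. The pointwise bound also yields absolute convergence at every ξ.

For E either all leaves lie below a frequency N', where L_δ(ξ) = ξ² + O(δ²ξ⁴) makes the phase
difference small (`norm_phaseDiff_le`), or one leaf lies in the tail, which the equicontinuity
hypothesis makes small. All constants are dominated by the summable sequence `decay`. -/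

instance instMeasurableAdd₂Freq : (M : Geometry) → MeasurableAdd₂ M.Freq
  | circle => inferInstanceAs (MeasurableAdd₂ ℤ)
  | line => inferInstanceAs (MeasurableAdd₂ ℝ)

instance instMeasurableSub₂Freq : (M : Geometry) → MeasurableSub₂ M.Freq
  | circle => inferInstanceAs (MeasurableSub₂ ℤ)
  | line => inferInstanceAs (MeasurableSub₂ ℝ)

instance instMeasurableNegFreq : (M : Geometry) → MeasurableNeg M.Freq
  | circle => inferInstanceAs (MeasurableNeg ℤ)
  | line => inferInstanceAs (MeasurableNeg ℝ)

instance instSigmaFiniteFreq : (M : Geometry) → SigmaFinite (volume : Measure M.Freq)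
  | circle => inferInstanceAs (SigmaFinite (Measure.count : Measure ℤ))
  | line => inferInstanceAs (SigmaFinite (volume : Measure ℝ))

instance instIsAddLeftInvariantFreq :
    (M : Geometry) → (volume : Measure M.Freq).IsAddLeftInvariant
  | circle => inferInstanceAs (Measure.IsAddLeftInvariant (Measure.count : Measure ℤ))
  | line => inferInstanceAs (Measure.IsAddLeftInvariant (volume : Measure ℝ))

instance instIsNegInvariantFreq :
    (M : Geometry) → (volume : Measure M.Freq).IsNegInvariant
  | circle => inferInstanceAs (Measure.IsNegInvariant (Measure.count : Measure ℤ))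
  | line => inferInstanceAs (Measure.IsNegInvariant (volume : Measure ℝ))

theorem toReal_add (x y : M.Freq) : M.toReal (x + y) = M.toReal x + M.toReal y := by
  cases M
  · exact Int.cast_add (R := ℝ) x y
  · rfl

theorem measurable_toReal : Measurable M.toReal := by
  cases M
  · exact measurable_from_top (α := ℤ)
  · exact measurable_id (α := ℝ)

theorem measurableSet_freqStar : MeasurableSet M.freqStar := by
  cases M
  · exact MeasurableSpace.measurableSet_top (s := {n : ℤ | n ≠ 0})
  · exact MeasurableSet.univ (α := ℝ)

/-- The absolute value of a frequency. -/
def mag (M : Geometry) (x : M.Freq) : ℝ := |M.toReal x|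

theorem mag_nonneg (x : M.Freq) : 0 ≤ M.mag x := abs_nonneg _

theorem measurable_mag : Measurable M.mag := by
  have : M.mag = fun x => |M.toReal x| := rfl
  rw [this]
  exact measurable_toReal.abs

theorem mag_add_le (x y : M.Freq) : M.mag (x + y) ≤ M.mag x + M.mag y := by
  rw [mag, toReal_add]; exact abs_add_le _ _

theorem mag_left_le (x y : M.Freq) : M.mag x ≤ M.mag (x + y) + M.mag y := by
  unfold mag; rw [toReal_add]
  have := abs_sub (M.toReal x + M.toReal y) (M.toReal y)
  simpa using this

theorem mag_right_le (x y : M.Freq) : M.mag y ≤ M.mag (x + y) + M.mag x := by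
  rw [add_comm x y]; exact mag_left_le y x

/-- The single fact about the size of frequency sets on which all the radial integrals rest. The
origin must be left out: on ℤ it has mass one, which would spoil the bound for small X, while the
sets without it are empty for X < 1. -/
theorem volume_mag_le (X : ℝ) :
    volume {x : M.Freq | 0 < M.mag x ∧ M.mag x ≤ X} ≤ ENNReal.ofReal (2 * X) := by
  cases M
  · rcases lt_or_ge X 0 with hX | hX
    · have : {x : circle.Freq | 0 < circle.mag x ∧ circle.mag x ≤ X} = ∅ := by
        ext x; simp; intro h; linarith
      simp [this]
    · have h1 : {x : circle.Freq | 0 < circle.mag x ∧ circle.mag x ≤ X}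
          ⊆ (((Finset.Icc (-⌊X⌋) ⌊X⌋).erase 0 : Finset ℤ) : Set ℤ) := by
        rintro (x : ℤ) ⟨h0, h1⟩
        have h0' : 0 < |(x : ℝ)| := h0
        have h1' : |(x : ℝ)| ≤ X := h1
        rw [abs_le] at h1'
        simp only [Finset.coe_erase, Finset.coe_Icc]
        refine ⟨⟨?_, Int.le_floor.2 h1'.2⟩, ?_⟩
        · have : -x ≤ ⌊X⌋ := Int.le_floor.2 (by push_cast; linarith)
          omega
        · rintro rfl; simp at h0'
      have hf : 0 ≤ ⌊X⌋ := Int.floor_nonneg.2 hX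
      refine (measure_mono h1).trans ?_
      change Measure.count (((Finset.Icc (-⌊X⌋) ⌊X⌋).erase 0 : Finset ℤ) : Set ℤ) ≤ _
      rw [Measure.count_apply_finset, Finset.card_erase_of_mem (by simp [hf]), Int.card_Icc]
      have : ((⌊X⌋ + 1 - -⌊X⌋).toNat - 1 : ℕ) = (2 * ⌊X⌋).toNat := by omega
      rw [this]
      have h2 : (((2 * ⌊X⌋).toNat : ℕ) : ℝ≥0∞) = ENNReal.ofReal (((2 * ⌊X⌋).toNat : ℕ) : ℝ) := by
        simp
      rw [h2]
      apply ENNReal.ofReal_le_ofReal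
      have h3 : (((2 * ⌊X⌋).toNat : ℕ) : ℝ) = ((2 * ⌊X⌋ : ℤ) : ℝ) := by
        have : (((2 * ⌊X⌋).toNat : ℕ) : ℤ) = 2 * ⌊X⌋ := Int.toNat_of_nonneg (by omega)
        exact_mod_cast congrArg (Int.cast : ℤ → ℝ) this
      rw [h3]; push_cast
      linarith [Int.floor_le X]
  · have h1 : {x : line.Freq | 0 < line.mag x ∧ line.mag x ≤ X} ⊆ (Set.Icc (-X) X : Set ℝ) := by
      rintro (x : ℝ) ⟨_, h⟩
      exact abs_le.1 h
    refine (measure_mono h1).trans ?_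
    change (volume : Measure ℝ) (Set.Icc (-X) X) ≤ _
    rw [Real.volume_Icc]
    apply ENNReal.ofReal_le_ofReal
    linarith

theorem ae_mag_pos : ∀ᵐ x : M.Freq, x ∈ M.freqStar → 0 < M.mag x := by
  cases M
  · refine ae_of_all _ ?_
    intro (x : ℤ) (hx : x ≠ 0)
    change 0 < |(x : ℝ)|
    simpa using hx
  · have : ∀ᵐ x : ℝ, x ≠ 0 := by simp [ae_iff]
    have h2 : ∀ᵐ x : line.Freq, 0 < line.mag x := by
      filter_upwards [this] with x hx
      exact abs_pos.2 hx
    filter_upwards [h2] with x hx _ using hx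

theorem volume_low_le (N : ℕ) :
    volume {x : M.Freq | M.mag x ≤ N} ≤ ENNReal.ofReal (2 * N + 1) := by
  cases M
  · have h1 : {x : circle.Freq | circle.mag x ≤ N}
          ⊆ ((Finset.Icc (-(N:ℤ)) N : Finset ℤ) : Set ℤ) := by
      intro (x : ℤ) (h1 : |(x : ℝ)| ≤ N)
      have : |x| ≤ (N : ℤ) := by exact_mod_cast h1
      exact (Finset.mem_coe (s := Finset.Icc (-(N:ℤ)) N)).2 (Finset.mem_Icc.2 (abs_le.1 this))
    refine (measure_mono h1).trans ?_
    change Measure.count ((Finset.Icc (-(N:ℤ)) N : Finset ℤ) : Set ℤ) ≤ _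
    rw [Measure.count_apply_finset, Int.card_Icc]
    have h2 : ((N + 1 - -(N:ℤ)).toNat : ℕ) = 2 * N + 1 := by omega
    rw [h2, ← ENNReal.ofReal_natCast]
    push_cast; exact le_rfl
  · have h1 : {x : line.Freq | line.mag x ≤ N} ⊆ (Set.Icc (-(N:ℝ)) N : Set ℝ) := by
      intro (x : ℝ) h
      exact abs_le.1 h
    refine (measure_mono h1).trans ?_
    change (volume : Measure ℝ) (Set.Icc (-(N:ℝ)) N) ≤ _
    rw [Real.volume_Icc]
    apply ENNReal.ofReal_le_ofReal
    linarith

end Geometry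

open NormalForm.Geometry

/-! ### Radial integrals over frequencies -/

/-- Layer-cake formula for f = 1/|x| cut off at |x| ≥ X. The level set of height t lies in X ≤ |x| ≤
1/t, so it is empty for t > 1/X and otherwise has measure at most 2/t; there remains ∫₀^{1/X}
2t^(p−2) dt. No distinction between sum and integral is needed. -/
theorem lintegral_rpow_tail {p : ℝ} (hp : 1 < p) {X : ℝ} (hX : 0 < X) :
    ∫⁻ x : M.Freq, (if X ≤ M.mag x then ENNReal.ofReal ((M.mag x)⁻¹ ^ p) else 0) ≤
      ENNReal.ofReal (2 * p / (p - 1) * X⁻¹ ^ (p - 1)) := by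
  classical
  set f : M.Freq → ℝ := fun x => if X ≤ M.mag x then (M.mag x)⁻¹ else 0 with hf
  have hf0 : ∀ x, 0 ≤ f x := by
    intro x; simp only [hf]; split_ifs
    · exact inv_nonneg.2 (mag_nonneg x)
    · exact le_rfl
  have hms : MeasurableSet {x : M.Freq | X ≤ M.mag x} := measurableSet_le measurable_const measurable_mag
  have hfm : Measurable f := Measurable.ite hms measurable_mag.inv measurable_const
  have h1 : ∀ x : M.Freq, (if X ≤ M.mag x then ENNReal.ofReal ((M.mag x)⁻¹ ^ p) else 0)
      = ENNReal.ofReal (f x ^ p) := by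
    intro x; simp only [hf]; split_ifs
    · rfl
    · rw [Real.zero_rpow (by linarith)]; simp
  simp_rw [h1]
  rw [lintegral_rpow_eq_lintegral_meas_le_mul _ (ae_of_all _ hf0) hfm.aemeasurable (by linarith)]
  have h2 : ∀ t ∈ Set.Ioi (0:ℝ), volume {a | t ≤ f a} * ENNReal.ofReal (t ^ (p - 1)) ≤
      (Set.Ioc 0 X⁻¹).indicator (fun t => ENNReal.ofReal (2 * t ^ (p - 2))) t := by
    intro t ht
    have ht : 0 < t := ht
    have hsub : ∀ a, t ≤ f a → X ≤ M.mag a ∧ M.mag a ≤ t⁻¹ := by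
      intro a ha
      simp only [hf] at ha
      split_ifs at ha with h
      · exact ⟨h, by rw [le_inv_comm₀ (by linarith) ht]; exact ha⟩
      · linarith
    by_cases htX : t ≤ X⁻¹
    · rw [Set.indicator_of_mem (show t ∈ Set.Ioc 0 X⁻¹ from ⟨ht, htX⟩)]
      have : volume {a | t ≤ f a} ≤ ENNReal.ofReal (2 * t⁻¹) := by
        refine (measure_mono ?_).trans (volume_mag_le (M := M) t⁻¹)
        intro a ha
        have := hsub a ha
        exact ⟨by linarith, this.2⟩
      refine (mul_le_mul_left this _).trans ?_
      rw [← ENNReal.ofReal_mul (by positivity)]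
      apply ENNReal.ofReal_le_ofReal
      apply le_of_eq
      rw [show p - 1 = (p - 2) + 1 by ring, Real.rpow_add_one ht.ne']
      field_simp
    · have : {a | t ≤ f a} = ∅ := by
        ext a; simp only [Set.mem_ofPred_eq, Set.mem_empty_iff_false, iff_false]
        intro ha
        have := hsub a ha
        have h3 : X ≤ t⁻¹ := this.1.trans this.2
        exact htX (by rw [le_inv_comm₀ ht hX]; exact h3)
      simp [this]
  have h3 : ∫⁻ t in Set.Ioi (0:ℝ), volume {a | t ≤ f a} * ENNReal.ofReal (t ^ (p - 1)) ≤
      ENNReal.ofReal (2 * X⁻¹ ^ (p - 1) / (p - 1)) := by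
    refine (setLIntegral_mono' measurableSet_Ioi h2).trans ?_
    rw [lintegral_indicator measurableSet_Ioc]
    refine (lintegral_mono' (Measure.restrict_mono_measure Measure.restrict_le_self _) le_rfl).trans ?_
    have hX' : 0 ≤ X⁻¹ := (inv_pos.2 hX).le
    have hint : IntervalIntegrable (fun t : ℝ => 2 * t ^ (p - 2)) volume 0 X⁻¹ :=
      (intervalIntegral.intervalIntegrable_rpow' (by linarith)).const_mul 2
    rw [← ofReal_integral_eq_lintegral_ofReal]
    · rw [← intervalIntegral.integral_of_le hX', intervalIntegral.integral_const_mul,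
        integral_rpow (Or.inl (by linarith))]
      apply ENNReal.ofReal_le_ofReal
      rw [show p - 2 + 1 = p - 1 by ring, Real.zero_rpow (by linarith)]
      apply le_of_eq; ring
    · exact (intervalIntegrable_iff_integrableOn_Ioc_of_le hX').1 hint
    · refine (ae_restrict_iff' measurableSet_Ioc).2 (ae_of_all _ ?_)
      intro t ht
      have := ht.1
      positivity
  refine (mul_le_mul_right h3 _).trans ?_
  rw [← ENNReal.ofReal_mul (by linarith)]
  apply ENNReal.ofReal_le_ofReal
  apply le_of_eq; ring

/-- Layer cake again: levels t ≤ X^(−1/2) see the whole ball, of measure at most 2X, and higher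
levels only |x| ≤ t^(−2). Both contributions are 2√X; the constant is not sharp. -/
theorem lintegral_inv_sqrt_ball (X : ℝ) (hX : 0 ≤ X) :
    ∫⁻ x : M.Freq, (if 0 < M.mag x ∧ M.mag x ≤ X then ENNReal.ofReal (Real.sqrt (M.mag x))⁻¹ else 0) ≤
      ENNReal.ofReal (8 * Real.sqrt X) := by
  classical
  rcases hX.eq_or_lt with rfl | hX
  · have : ∀ x : M.Freq, ¬ (0 < M.mag x ∧ M.mag x ≤ 0) := fun x h => by linarith [h.1, h.2]
    simp [this]
  have hs : 0 < Real.sqrt X := Real.sqrt_pos.2 hX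
  set f : M.Freq → ℝ := fun x => if 0 < M.mag x ∧ M.mag x ≤ X then (Real.sqrt (M.mag x))⁻¹ else 0 with hf
  have hf0 : ∀ x, 0 ≤ f x := by
    intro x; simp only [hf]; split_ifs <;> positivity
  have hms : MeasurableSet {x : M.Freq | 0 < M.mag x ∧ M.mag x ≤ X} :=
    (measurableSet_lt measurable_const measurable_mag).inter
      (measurableSet_le measurable_mag measurable_const)
  have hfm : Measurable f := Measurable.ite hms (measurable_mag.sqrt.inv) measurable_const
  have h1 : ∀ x : M.Freq, (if 0 < M.mag x ∧ M.mag x ≤ X then ENNReal.ofReal (Real.sqrt (M.mag x))⁻¹ else 0)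
      = ENNReal.ofReal (f x ^ (1:ℝ)) := by
    intro x; simp only [hf, Real.rpow_one]; split_ifs <;> simp
  simp_rw [h1]
  rw [lintegral_rpow_eq_lintegral_meas_le_mul _ (ae_of_all _ hf0) hfm.aemeasurable (by norm_num)]
  simp only [sub_self, Real.rpow_zero, ENNReal.ofReal_one, mul_one, one_mul]
  have hsub : ∀ t, 0 < t → ∀ a, t ≤ f a → 0 < M.mag a ∧ M.mag a ≤ X ∧ M.mag a ≤ (t ^ 2)⁻¹ := by
    intro t ht a ha
    simp only [hf] at ha
    split_ifs at ha with h
    · refine ⟨h.1, h.2, ?_⟩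
      have h3 : Real.sqrt (M.mag a) ≤ t⁻¹ := by
        rw [le_inv_comm₀ (Real.sqrt_pos.2 h.1) ht]; exact ha
      have := Real.sq_sqrt h.1.le
      rw [← this, ← inv_pow]
      exact pow_le_pow_left₀ (Real.sqrt_nonneg _) h3 2
    · linarith
  have h2 : ∀ t ∈ Set.Ioi (0:ℝ), volume {a | t ≤ f a} ≤
      (Set.Ioc 0 (Real.sqrt X)⁻¹).indicator (fun t => ENNReal.ofReal (2 * X)) t +
      (Set.Ioi (Real.sqrt X)⁻¹).indicator (fun t => ENNReal.ofReal (2 * t ^ (-2:ℝ))) t := by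
    intro t ht
    have ht : 0 < t := ht
    by_cases htX : t ≤ (Real.sqrt X)⁻¹
    · rw [Set.indicator_of_mem (show t ∈ Set.Ioc 0 (Real.sqrt X)⁻¹ from ⟨ht, htX⟩)]
      refine le_trans ?_ le_self_add
      refine (measure_mono ?_).trans (volume_mag_le (M := M) X)
      intro a ha
      have := hsub t ht a ha
      exact ⟨this.1, this.2.1⟩
    · rw [Set.indicator_of_mem (show t ∈ Set.Ioi (Real.sqrt X)⁻¹ from not_le.1 htX)]
      refine le_trans ?_ le_add_self
      rw [Real.rpow_neg ht.le, Real.rpow_two]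
      refine (measure_mono ?_).trans (volume_mag_le (M := M) _)
      intro a ha
      have := hsub t ht a ha
      exact ⟨this.1, this.2.2⟩
  refine (setLIntegral_mono' measurableSet_Ioi h2).trans ?_
  refine (lintegral_mono' Measure.restrict_le_self le_rfl).trans ?_
  rw [lintegral_add_left (measurable_const.indicator measurableSet_Ioc),
    lintegral_indicator measurableSet_Ioc, lintegral_indicator measurableSet_Ioi,
    lintegral_const, Measure.restrict_apply_univ, Real.volume_Ioc, sub_zero,
    ← ENNReal.ofReal_mul (by linarith)]
  have hint := integrableOn_Ioi_rpow_of_lt (a := -2) (by norm_num) (inv_pos.2 hs)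
  rw [← ofReal_integral_eq_lintegral_ofReal (hint.const_mul 2), integral_const_mul,
    integral_Ioi_rpow_of_lt (by norm_num) (inv_pos.2 hs), ← ENNReal.ofReal_add]
  · apply ENNReal.ofReal_le_ofReal
    have h5 : ((Real.sqrt X)⁻¹ : ℝ) ^ (-2 + 1 : ℝ) = Real.sqrt X := by
      norm_num [Real.rpow_neg_one]
    rw [h5]
    have h6 : X * (Real.sqrt X)⁻¹ = Real.sqrt X := by
      rw [← div_eq_mul_inv, Real.div_sqrt]
    rw [mul_assoc, h6]; norm_num; linarith
  · positivity
  · have : ((Real.sqrt X)⁻¹ : ℝ) ^ (-2 + 1 : ℝ) = Real.sqrt X := by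
      norm_num [Real.rpow_neg_one]
    rw [this]
    have := hs.le
    norm_num
  · refine (ae_restrict_iff' measurableSet_Ioi).2 (ae_of_all _ ?_)
    intro t ht
    have : 0 < t := (inv_pos.2 hs).trans ht
    positivity

theorem lintegral_inv_sq_tail {X : ℝ} (hX : 0 < X) :
    ∫⁻ x : M.Freq, (if X ≤ M.mag x then ENNReal.ofReal (M.mag x ^ 2)⁻¹ else 0) ≤
      ENNReal.ofReal (4 / X) := by
  have h := lintegral_rpow_tail (M := M) (p := 2) (by norm_num) hX
  norm_num at h
  simpa [div_eq_mul_inv] using h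

theorem lintegral_inv_three_halves_tail {X : ℝ} (hX : 0 < X) :
    ∫⁻ x : M.Freq,
        (if X ≤ M.mag x then ENNReal.ofReal (M.mag x * Real.sqrt (M.mag x))⁻¹ else 0) ≤
      ENNReal.ofReal (6 / Real.sqrt X) := by
  have h := lintegral_rpow_tail (M := M) (p := 3 / 2) (by norm_num) hX
  refine le_trans (lintegral_mono fun x => ?_) (h.trans (ENNReal.ofReal_le_ofReal ?_))
  · split_ifs with hx
    · apply ENNReal.ofReal_le_ofReal
      have : 0 < M.mag x := hX.trans_le hx
      rw [show (3 / 2 : ℝ) = 1 + 1 / 2 by norm_num, Real.rpow_add (by positivity), Real.rpow_one,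
        ← Real.sqrt_eq_rpow, Real.sqrt_inv, mul_inv]
    · exact le_rfl
  · norm_num
    rw [← Real.sqrt_eq_rpow, Real.sqrt_inv, div_eq_mul_inv]

/-- An integrand controlled on the region where the first summand of `z = c + (z - c)` is the
smaller one, and by the reflected bound on the complementary region. -/
theorem lintegral_le_two_mul_of_reflect {f g : M.Freq → ℝ≥0∞} (hg : Measurable g) (z : M.Freq)
    (h₁ : ∀ c, M.mag c ≤ M.mag (z - c) → f c ≤ g c)
    (h₂ : ∀ c, M.mag (z - c) ≤ M.mag c → f c ≤ g (z - c)) :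
    ∫⁻ c, f c ≤ 2 * ∫⁻ c, g c := by
  have h : ∀ c, f c ≤ g c + g (z - c) := by
    intro c
    rcases le_total (M.mag c) (M.mag (z - c)) with h | h
    · exact (h₁ c h).trans le_self_add
    · exact (h₂ c h).trans le_add_self
  refine (lintegral_mono h).trans ?_
  rw [lintegral_add_left hg, lintegral_sub_left_eq_self, two_mul]

/-! ### Square integrals of the nonresonant kernel -/

/-- The kernel `1_{|(x + y) x y| ≥ m} / |x y|` of a nonresonant generation. -/
def kernel (m : ℝ) (x y : M.Freq) : ℝ≥0∞ :=
  if m ≤ M.mag (x + y) * (M.mag x * M.mag y) then ENNReal.ofReal (M.mag x * M.mag y)⁻¹ else 0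

theorem kernel_comm (m : ℝ) (x y : M.Freq) : kernel m x y = kernel m y x := by
  simp only [kernel, add_comm x y, mul_comm (M.mag x)]

theorem measurable_kernel (m : ℝ) : Measurable fun p : M.Freq × M.Freq => kernel m p.1 p.2 := by
  have h1 : Measurable fun p : M.Freq × M.Freq => M.mag p.1 := measurable_mag.comp measurable_fst
  have h2 : Measurable fun p : M.Freq × M.Freq => M.mag p.2 := measurable_mag.comp measurable_snd
  have h3 : Measurable fun p : M.Freq × M.Freq => M.mag (p.1 + p.2) :=
    measurable_mag.comp (measurable_fst.add measurable_snd)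
  exact Measurable.ite (measurableSet_le measurable_const (h3.mul (h1.mul h2)))
    (h1.mul h2).inv.ennreal_ofReal measurable_const

theorem measurable_tail (X : ℝ) (φ : ℝ → ℝ) (hφ : Measurable φ) :
    Measurable fun c : M.Freq => if X ≤ M.mag c then ENNReal.ofReal (φ (M.mag c)) else 0 :=
  Measurable.ite (measurableSet_le measurable_const measurable_mag)
    (hφ.comp measurable_mag).ennreal_ofReal measurable_const

theorem mag_sub_bounds (z c : M.Freq) :
    M.mag (z - c) ≤ M.mag z + M.mag c ∧ M.mag z ≤ M.mag c + M.mag (z - c) ∧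
      M.mag c ≤ M.mag z + M.mag (z - c) := by
  have h : c + (z - c) = z := by abel
  have h1 := mag_add_le c (z - c)
  have h2 := mag_left_le c (z - c)
  have h3 := mag_right_le c (z - c)
  rw [h] at h1 h2 h3
  exact ⟨h3, h1, h2⟩

/-- Here s, c, d are the moduli of z, c, z − c, with c the smaller child. If d ≤ 2s, then m ≤ 2s²c,
and d ≥ s/2 turns the kernel into a multiple of 1/(sc). If d ≥ 2s, the children are comparable, c ≥
max(s, d/2), so m ≤ 2sc² and one of the two factors c, d can be replaced by the lower bound for c.
-/
theorem inv_sq_le_of_nonres {m s c d : ℝ} (hm : 0 < m) (hs : 0 < s) (hc : 0 ≤ c)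
    (hd : d ≤ s + c) (hsd : s ≤ c + d) (hcd : c ≤ d) (h : m ≤ s * (c * d)) :
    (m / (2 * s ^ 2) ≤ c ∧ ((c * d) ^ 2)⁻¹ ≤ 4 / s ^ 2 * (c ^ 2)⁻¹) ∨
      (max s (Real.sqrt (m / (2 * s))) ≤ c ∧
        ((c * d) ^ 2)⁻¹ ≤ ((max s (Real.sqrt (m / (2 * s)))) ^ 2)⁻¹ * (c ^ 2)⁻¹) := by
  have hc0 : 0 < c := by
    rcases hc.eq_or_lt with rfl | h0
    · simp at h; linarith
    · exact h0
  have hd0 : 0 < d := hc0.trans_le hcd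
  rcases le_total d (2 * s) with hds | hds
  · left
    constructor
    · rw [div_le_iff₀ (by positivity)]
      nlinarith [mul_le_mul_of_nonneg_left hds (mul_pos hs hc0).le]
    · rw [mul_pow, mul_inv, mul_comm]
      apply mul_le_mul_of_nonneg_right _ (by positivity)
      rw [inv_le_comm₀ (by positivity) (by positivity), inv_div]
      nlinarith
  · right
    have hsc : s ≤ c := by linarith
    have h2 : Real.sqrt (m / (2 * s)) ≤ c := by
      apply Real.sqrt_le_iff.2 ⟨hc, ?_⟩
      rw [div_le_iff₀ (by positivity)]
      have : d ≤ 2 * c := by linarith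
      nlinarith [mul_le_mul_of_nonneg_left this (mul_pos hs hc0).le]
    have h3 := max_le hsc h2
    refine ⟨h3, ?_⟩
    have h0 : 0 < max s (Real.sqrt (m / (2 * s))) := lt_max_of_lt_left hs
    rw [mul_pow, mul_inv, mul_comm]
    apply mul_le_mul_of_nonneg_right _ (by positivity)
    apply inv_anti₀ (by positivity)
    exact pow_le_pow_left₀ h0.le (h3.trans hcd) 2

/-- The basic Cauchy–Schwarz constant: in both regimes of `inv_sq_le_of_nonres` the tail integral of
c^(−2) cancels the dependence on z, so the bound is uniform in the output frequency. -/
theorem lintegral_kernel_sq_le {m : ℝ} (hm : 0 < m) (z : M.Freq) :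
    ∫⁻ c, kernel m c (z - c) ^ 2 ≤ ENNReal.ofReal (80 / m) := by
  classical
  have hz : ∀ c : M.Freq, c + (z - c) = z := fun c => by abel
  set s := M.mag z with hs
  rcases (mag_nonneg z).eq_or_lt with h0 | h0
  · have : ∀ c, kernel m c (z - c) ^ 2 = 0 := by
      intro c
      have h1 : ¬ m ≤ M.mag z * (M.mag c * M.mag (z - c)) := by
        rw [← h0]; simpa using hm
      simp [kernel, hz, h1]
    simp [this]
  replace h0 : 0 < s := h0
  have hs0 : s ≠ 0 := h0.ne'
  set Y := max s (Real.sqrt (m / (2 * s))) with hY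
  have hY0 : 0 < Y := lt_max_of_lt_left h0
  set X := m / (2 * s ^ 2) with hX
  have hX0 : 0 < X := by positivity
  set t : M.Freq → ℝ≥0∞ := fun c => if X ≤ M.mag c then ENNReal.ofReal (M.mag c ^ 2)⁻¹ else 0
  set t' : M.Freq → ℝ≥0∞ := fun c => if Y ≤ M.mag c then ENNReal.ofReal (M.mag c ^ 2)⁻¹ else 0
  have htm : Measurable t := measurable_tail X (fun r => (r ^ 2)⁻¹) (by fun_prop)
  have htm' : Measurable t' := measurable_tail Y (fun r => (r ^ 2)⁻¹) (by fun_prop)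
  set g : M.Freq → ℝ≥0∞ := fun c =>
    ENNReal.ofReal (4 / s ^ 2) * t c + ENNReal.ofReal (Y ^ 2)⁻¹ * t' c with hg
  have hgm : Measurable g := (htm.const_mul _).add (htm'.const_mul _)
  have key : ∀ c, M.mag c ≤ M.mag (z - c) → kernel m c (z - c) ^ 2 ≤ g c := by
    intro c hc
    obtain ⟨h1, h2, -⟩ := mag_sub_bounds z c
    unfold kernel
    rw [hz]
    split_ifs with h
    · rw [← ENNReal.ofReal_pow (by have := mag_nonneg c; have := mag_nonneg (z - c); positivity),
        inv_pow]
      rcases inv_sq_le_of_nonres hm h0 (mag_nonneg c) h1 h2 hc h with h | h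
      · refine le_trans ?_ le_self_add
        simp only [t]
        rw [if_pos (show X ≤ M.mag c from h.1)]
        rw [← ENNReal.ofReal_mul (by positivity)]
        exact ENNReal.ofReal_le_ofReal h.2
      · refine le_trans ?_ le_add_self
        simp only [t']
        rw [if_pos (show Y ≤ M.mag c from h.1)]
        rw [← ENNReal.ofReal_mul (by positivity)]
        exact ENNReal.ofReal_le_ofReal h.2
    · simp
  refine (lintegral_le_two_mul_of_reflect hgm z key ?_).trans ?_
  · intro c hc
    rw [kernel_comm]
    have := key (z - c) (by rwa [sub_sub_cancel])
    rwa [sub_sub_cancel] at this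
  · rw [hg, lintegral_add_left (htm.const_mul _), lintegral_const_mul _ htm,
      lintegral_const_mul _ htm']
    have h3 : ENNReal.ofReal (4 / s ^ 2) * ∫⁻ c, t c ≤ ENNReal.ofReal (32 / m) := by
      refine (mul_le_mul_right (lintegral_inv_sq_tail hX0) _).trans ?_
      rw [← ENNReal.ofReal_mul (by positivity)]
      apply ENNReal.ofReal_le_ofReal
      apply le_of_eq
      rw [hX]; field_simp; norm_num
    -- The second regime costs 4/Y³. Using Y² ≥ m/(2s) for two factors and Y ≥ s for the third gives
    -- Y³ ≥ m/2, again free of s.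
    have h4 : ENNReal.ofReal (Y ^ 2)⁻¹ * ∫⁻ c, t' c ≤ ENNReal.ofReal (8 / m) := by
      refine (mul_le_mul_right (lintegral_inv_sq_tail hY0) _).trans ?_
      rw [← ENNReal.ofReal_mul (by positivity)]
      apply ENNReal.ofReal_le_ofReal
      have h5 : s ≤ Y := le_max_left _ _
      have h6 : m / (2 * s) ≤ Y ^ 2 := by
        rw [← Real.sq_sqrt (show 0 ≤ m / (2 * s) by positivity)]
        exact pow_le_pow_left₀ (Real.sqrt_nonneg _) (le_max_right _ _) 2
      have h7 : m / 2 ≤ Y ^ 2 * Y := by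
        calc m / 2 = m / (2 * s) * s := by field_simp
          _ ≤ Y ^ 2 * Y := mul_le_mul h6 h5 h0.le (by positivity)
      rw [← div_eq_inv_mul, div_div, div_le_div_iff₀ (by positivity) hm]
      linarith
    calc 2 * (ENNReal.ofReal (4 / s ^ 2) * (∫⁻ c, t c) + ENNReal.ofReal (Y ^ 2)⁻¹ * ∫⁻ c, t' c)
        ≤ 2 * (ENNReal.ofReal (32 / m) + ENNReal.ofReal (8 / m)) :=
          mul_le_mul_right (add_le_add h3 h4) _
      _ = ENNReal.ofReal (80 / m) := by
        rw [← ENNReal.ofReal_add (by positivity) (by positivity),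
          show (2 : ℝ≥0∞) = ENNReal.ofReal 2 by simp, ← ENNReal.ofReal_mul (by norm_num)]
        congr 1; ring

/-- `max(1, |x|)` -/
def bracket (x : M.Freq) : ℝ := max 1 (M.mag x)

theorem one_le_bracket (x : M.Freq) : 1 ≤ bracket x := le_max_left _ _

theorem measurable_bracket : Measurable (bracket : M.Freq → ℝ) :=
  measurable_const.max measurable_mag

/-- For inputs that grow linearly. Where |c| ≤ 1 the weight is 1; where |c| ≥ 1 it cancels the
factor |c| of the kernel and leaves |z−c|^(−2), while nonresonance still bounds |z−c| below by
m/(2|z|²) or √(m/(2|z|)). The output grows no faster than the input; the price is a decay of 1/√m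
only. -/
theorem lintegral_bracket_kernel_sq_le {m : ℝ} (hm : 1 ≤ m) (z : M.Freq) :
    ∫⁻ c, (ENNReal.ofReal (bracket c) * kernel m c (z - c)) ^ 2 ≤
      ENNReal.ofReal (bracket z ^ 2 * (100 / Real.sqrt m)) := by
  classical
  have hz : ∀ c : M.Freq, c + (z - c) = z := fun c => by abel
  have hm0 : 0 < m := by linarith
  have hsm : 1 ≤ Real.sqrt m := Real.one_le_sqrt.2 hm
  have hsm2 : Real.sqrt m ^ 2 = m := Real.sq_sqrt hm0.le
  set s := M.mag z with hs
  rcases (mag_nonneg z).eq_or_lt with h0 | h0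
  · have : ∀ c, (ENNReal.ofReal (bracket c) * kernel m c (z - c)) ^ 2 = 0 := by
      intro c
      have h1 : ¬ m ≤ M.mag z * (M.mag c * M.mag (z - c)) := by
        rw [← h0]; simpa using hm0
      simp [kernel, hz, h1]
    simp [this]
  replace h0 : 0 < s := h0
  have hs0 : s ≠ 0 := h0.ne'
  set X := m / (2 * s ^ 2) with hX
  have hX0 : 0 < X := by positivity
  set Y := Real.sqrt m / Real.sqrt (2 * s) with hY
  have hY0 : 0 < Y := by positivity
  set t : M.Freq → ℝ≥0∞ := fun c => if X ≤ M.mag c then ENNReal.ofReal (M.mag c ^ 2)⁻¹ else 0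
  set t' : M.Freq → ℝ≥0∞ := fun c => if Y ≤ M.mag c then ENNReal.ofReal (M.mag c ^ 2)⁻¹ else 0
  have htm : Measurable t := measurable_tail X (fun r => (r ^ 2)⁻¹) (by fun_prop)
  have htm' : Measurable t' := measurable_tail Y (fun r => (r ^ 2)⁻¹) (by fun_prop)
  have key : ∀ c, (ENNReal.ofReal (bracket c) * kernel m c (z - c)) ^ 2 ≤
      kernel m c (z - c) ^ 2 + (t (z - c) + t' (z - c)) := by
    intro c
    obtain ⟨h1, h2, h2'⟩ := mag_sub_bounds z c
    have hc := mag_nonneg c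
    have hd := mag_nonneg (z - c)
    unfold kernel
    rw [hz]
    split_ifs with h
    · rcases le_total (M.mag c) 1 with h3 | h3
      · simp [bracket, h3]
      · refine le_trans ?_ le_add_self
        rw [bracket, max_eq_right h3, ← ENNReal.ofReal_mul hc, ← ENNReal.ofReal_pow (by positivity)]
        have hd0 : 0 < M.mag (z - c) := by
          rcases hd.eq_or_lt with h4 | h4
          · rw [← h4] at h; simp at h; linarith
          · exact h4
        have e1 : (M.mag c * (M.mag c * M.mag (z - c))⁻¹) ^ 2 = (M.mag (z - c) ^ 2)⁻¹ := by
          have : M.mag c ≠ 0 := by linarith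
          field_simp
        rw [e1]
        rcases le_total (M.mag (z - c)) s with h5 | h5
        · have : X ≤ M.mag (z - c) := by
            rw [hX, div_le_iff₀ (by positivity)]
            have : M.mag c ≤ 2 * s := by linarith
            calc m ≤ s * (M.mag c * M.mag (z - c)) := h
              _ ≤ s * (2 * s * M.mag (z - c)) := by gcongr
              _ = _ := by ring
          simp [t, this]
        · have : Y ≤ M.mag (z - c) := by
            rw [hY, div_le_iff₀ (by positivity)]
            apply Real.sqrt_le_iff.2 ⟨by positivity, ?_⟩
            rw [mul_pow, Real.sq_sqrt (by positivity)]
            have : M.mag c ≤ 2 * M.mag (z - c) := by linarith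
            calc m ≤ s * (M.mag c * M.mag (z - c)) := h
              _ ≤ s * (2 * M.mag (z - c) * M.mag (z - c)) := by gcongr
              _ = _ := by ring
          simp [t', this]
    · simp
  have hb : 1 ≤ bracket z := one_le_bracket z
  have hsb : s ≤ bracket z := le_max_right _ _
  refine (lintegral_mono key).trans ?_
  rw [lintegral_add_right, lintegral_sub_left_eq_self (fun c => t c + t' c) z,
    lintegral_add_left htm]
  · refine (add_le_add (lintegral_kernel_sq_le hm0 z)
      (add_le_add (lintegral_inv_sq_tail hX0) (lintegral_inv_sq_tail hY0))).trans ?_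
    rw [← ENNReal.ofReal_add (by positivity) (by positivity),
      ← ENNReal.ofReal_add (by positivity) (by positivity)]
    apply ENNReal.ofReal_le_ofReal
    have hb2 : 1 ≤ bracket z ^ 2 := one_le_pow₀ hb
    have e1 : 80 / m ≤ bracket z ^ 2 * (80 / Real.sqrt m) := by
      have : 80 / m ≤ 80 / Real.sqrt m :=
        div_le_div_of_nonneg_left (by norm_num) (by positivity) (by nlinarith)
      have h9 : 0 ≤ 80 / Real.sqrt m := by positivity
      nlinarith
    have e2 : 4 / X ≤ bracket z ^ 2 * (8 / Real.sqrt m) := by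
      have : 4 / X = s ^ 2 * (8 / m) := by rw [hX]; field_simp; ring
      rw [this]
      apply mul_le_mul (pow_le_pow_left₀ h0.le hsb 2) _ (by positivity) (by positivity)
      exact div_le_div_of_nonneg_left (by norm_num) (by positivity) (by nlinarith)
    have e3 : 4 / Y ≤ bracket z ^ 2 * (8 / Real.sqrt m) := by
      have : 4 / Y = Real.sqrt (2 * s) * (4 / Real.sqrt m) := by rw [hY]; field_simp
      rw [this]
      have h6 : Real.sqrt (2 * s) ≤ 2 * bracket z ^ 2 := by
        apply Real.sqrt_le_iff.2 ⟨by positivity, ?_⟩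
        nlinarith
      have h9 : 0 ≤ 4 / Real.sqrt m := by positivity
      calc _ ≤ 2 * bracket z ^ 2 * (4 / Real.sqrt m) := mul_le_mul_of_nonneg_right h6 h9
        _ = _ := by ring
    have e4 : bracket z ^ 2 * (100 / Real.sqrt m) = bracket z ^ 2 * (80 / Real.sqrt m) +
      (bracket z ^ 2 * (8 / Real.sqrt m) + bracket z ^ 2 * (8 / Real.sqrt m)) +
      bracket z ^ 2 * (4 / Real.sqrt m) := by ring
    rw [e4]
    have : 0 ≤ bracket z ^ 2 * (4 / Real.sqrt m) := by positivity
    linarith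
  · exact ((htm.add htm').comp (measurable_const.sub measurable_id))

/-! ### Cauchy–Schwarz and bilinear estimates -/

theorem sq_lintegral_mul_le {α : Type*} [MeasurableSpace α] (μ : Measure α) {f g : α → ℝ≥0∞}
    (hf : AEMeasurable f μ) (hg : AEMeasurable g μ) :
    (∫⁻ a, f a * g a ∂μ) ^ 2 ≤ (∫⁻ a, f a ^ 2 ∂μ) * ∫⁻ a, g a ^ 2 ∂μ := by
  have h := ENNReal.lintegral_mul_le_Lp_mul_Lq μ Real.HolderConjugate.two_two hf hg
  simp only [Pi.mul_apply, ENNReal.rpow_two] at h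
  calc (∫⁻ a, f a * g a ∂μ) ^ 2
      ≤ ((∫⁻ a, f a ^ 2 ∂μ) ^ (1 / 2 : ℝ) * (∫⁻ a, g a ^ 2 ∂μ) ^ (1 / 2 : ℝ)) ^ 2 := by gcongr
    _ = _ := by
      rw [mul_pow, ← ENNReal.rpow_two, ← ENNReal.rpow_two, ← ENNReal.rpow_mul, ← ENNReal.rpow_mul]
      norm_num

theorem sq_lintegral_lintegral_mul_le {α β : Type*} [MeasurableSpace α] [MeasurableSpace β]
    (μ : Measure α) (ν : Measure β) [SFinite ν] {f g : α → β → ℝ≥0∞}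
    (hf : Measurable (Function.uncurry f)) (hg : Measurable (Function.uncurry g)) :
    (∫⁻ a, ∫⁻ b, f a b * g a b ∂ν ∂μ) ^ 2 ≤
      (∫⁻ a, ∫⁻ b, f a b ^ 2 ∂ν ∂μ) * ∫⁻ a, ∫⁻ b, g a b ^ 2 ∂ν ∂μ := by
  have h := sq_lintegral_mul_le (μ.prod ν) hf.aemeasurable hg.aemeasurable
  rw [lintegral_prod (fun p => Function.uncurry f p * Function.uncurry g p) (hf.mul hg).aemeasurable, lintegral_prod _ (hf.pow_const 2).aemeasurable,
    lintegral_prod _ (hg.pow_const 2).aemeasurable] at h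
  exact h

/-- The square of the `L²` norm on the frequency side. -/
def sqNorm (f : M.Freq → ℝ≥0∞) : ℝ≥0∞ := ∫⁻ x, f x ^ 2

theorem lintegral_convolution_sq {f g : M.Freq → ℝ≥0∞} (hf : Measurable f) (hg : Measurable g) :
    ∫⁻ z, ∫⁻ c, (f c * g (z - c)) ^ 2 = sqNorm f * sqNorm g := by
  have hm : Measurable (Function.uncurry fun z c : M.Freq => (f c * g (z - c)) ^ 2) := by
    unfold Function.uncurry; fun_prop
  rw [lintegral_lintegral_swap hm.aemeasurable]
  have : ∀ c, ∫⁻ z, (f c * g (z - c)) ^ 2 = f c ^ 2 * sqNorm g := by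
    intro c
    simp_rw [mul_pow]
    rw [lintegral_const_mul _ (by fun_prop), lintegral_sub_right_eq_self (fun z => g z ^ 2)]
    rfl
  simp_rw [this]
  rw [lintegral_mul_const _ (hf.pow_const 2)]
  rfl

theorem measurable_kernel_comp {α : Type*} [MeasurableSpace α] (m : ℝ) {x y : α → M.Freq}
    (hx : Measurable x) (hy : Measurable y) : Measurable fun a => kernel m (x a) (y a) :=
  (measurable_kernel m).comp (hx.prodMk hy)

/-- The bilinear operator with kernel `kernel m`. -/
def bil (m : ℝ) (f g : M.Freq → ℝ≥0∞) (z : M.Freq) : ℝ≥0∞ :=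
  ∫⁻ c, kernel m c (z - c) * (f c * g (z - c))

theorem measurable_bil (m : ℝ) {f g : M.Freq → ℝ≥0∞} (hf : Measurable f) (hg : Measurable g) :
    Measurable (bil m f g) := by
  refine Measurable.lintegral_prod_right'
    (f := fun p : M.Freq × M.Freq => kernel m p.2 (p.1 - p.2) * (f p.2 * g (p.1 - p.2))) ?_
  exact (measurable_kernel_comp m (by fun_prop) (by fun_prop)).mul (by fun_prop)

theorem bil_comm (m : ℝ) (f g : M.Freq → ℝ≥0∞) : bil m f g = bil m g f := by
  funext z
  unfold bil
  rw [← lintegral_sub_left_eq_self _ z]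
  refine lintegral_congr fun c => ?_
  rw [sub_sub_cancel, kernel_comm, mul_comm (f _)]

theorem sqNorm_bil_le {m : ℝ} (hm : 0 < m) {f g : M.Freq → ℝ≥0∞} (hf : Measurable f)
    (hg : Measurable g) :
    sqNorm (bil m f g) ≤ ENNReal.ofReal (80 / m) * (sqNorm f * sqNorm g) := by
  rw [← lintegral_convolution_sq hf hg, ← lintegral_const_mul]
  · refine lintegral_mono fun z => ?_
    refine (sq_lintegral_mul_le volume
      (measurable_kernel_comp m (by fun_prop) (by fun_prop)).aemeasurable
      (by fun_prop)).trans ?_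
    gcongr
    exact lintegral_kernel_sq_le hm z
  · exact Measurable.lintegral_prod_right'
      (f := fun p : M.Freq × M.Freq => (f p.2 * g (p.1 - p.2)) ^ 2) (by fun_prop)

/-- Linear growth of one input is inherited by the output when the other input is in L²:
Cauchy–Schwarz puts the growth together with the kernel and leaves g alone. -/
theorem sq_bil_le_of_le_bracket {m : ℝ} (hm : 1 ≤ m) {f g : M.Freq → ℝ≥0∞} {A : ℝ≥0∞}
    (hg : Measurable g) (hfA : ∀ c, f c ≤ A * ENNReal.ofReal (bracket c)) (z : M.Freq) :
    bil m f g z ^ 2 ≤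
      ENNReal.ofReal (bracket z ^ 2) * (ENNReal.ofReal (100 / Real.sqrt m) * (A ^ 2 * sqNorm g)) := by
  have hb : Measurable fun c : M.Freq => ENNReal.ofReal (bracket c) :=
    measurable_bracket.ennreal_ofReal
  have h1 : bil m f g z ≤
      ∫⁻ c, (ENNReal.ofReal (bracket c) * kernel m c (z - c)) * (A * g (z - c)) := by
    refine lintegral_mono fun c => ?_
    calc kernel m c (z - c) * (f c * g (z - c))
        ≤ kernel m c (z - c) * (A * ENNReal.ofReal (bracket c) * g (z - c)) := by
          gcongr; exact hfA c
      _ = _ := by ring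
  calc bil m f g z ^ 2 ≤ _ := pow_le_pow_left' h1 2
    _ ≤ _ := sq_lintegral_mul_le volume
      (hb.mul (measurable_kernel_comp m (by fun_prop) (by fun_prop))).aemeasurable (by fun_prop)
    _ ≤ ENNReal.ofReal (bracket z ^ 2 * (100 / Real.sqrt m)) * (A ^ 2 * sqNorm g) := by
      gcongr
      · exact lintegral_bracket_kernel_sq_le hm z
      · simp_rw [mul_pow]
        rw [lintegral_const_mul _ (by fun_prop),
          lintegral_sub_left_eq_self (fun c => g c ^ 2) z]
        rfl
    _ = _ := by rw [ENNReal.ofReal_mul (by positivity), mul_assoc]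

theorem lintegral_mul_reflect_sq_le {f g : M.Freq → ℝ≥0∞} (hf : Measurable f) (hg : Measurable g)
    (z : M.Freq) : (∫⁻ c, f c * g (z - c)) ^ 2 ≤ sqNorm f * sqNorm g := by
  refine (sq_lintegral_mul_le volume hf.aemeasurable (by fun_prop)).trans ?_
  rw [lintegral_sub_left_eq_self (fun c => g c ^ 2) z]
  rfl

/-! ### Nearly resonant generations -/

/-- `|(x + y) x y|` -/
def trip (x y : M.Freq) : ℝ := M.mag (x + y) * (M.mag x * M.mag y)

theorem trip_nonneg (x y : M.Freq) : 0 ≤ trip x y :=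
  mul_nonneg (mag_nonneg _) (mul_nonneg (mag_nonneg _) (mag_nonneg _))

theorem trip_comm (x y : M.Freq) : trip x y = trip y x := by
  simp only [trip, add_comm x y, mul_comm (M.mag x)]

theorem measurable_trip_comp {α : Type*} [MeasurableSpace α] {x y : α → M.Freq}
    (hx : Measurable x) (hy : Measurable y) : Measurable fun a => trip (x a) (y a) :=
  (measurable_mag.comp (hx.add hy)).mul ((measurable_mag.comp hx).mul (measurable_mag.comp hy))

open Classical in
/-- The kernel `|x + y| 1_{|(x + y) x y| ≤ L}` of a nearly resonant generation. -/
def resKernel (L : ℝ) (x y : M.Freq) : ℝ≥0∞ :=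
  if 0 < M.mag x ∧ 0 < M.mag y ∧ trip x y ≤ L then ENNReal.ofReal (M.mag (x + y)) else 0

theorem resKernel_comm (L : ℝ) (x y : M.Freq) : resKernel L x y = resKernel L y x := by
  unfold resKernel
  rw [trip_comm, add_comm x y]
  congr 1
  rw [← and_assoc, and_comm (a := 0 < M.mag x), and_assoc]

theorem measurableSet_res {α : Type*} [MeasurableSpace α] {L : α → ℝ} {x y : α → M.Freq}
    (hL : Measurable L) (hx : Measurable x) (hy : Measurable y) :
    MeasurableSet {a | 0 < M.mag (x a) ∧ 0 < M.mag (y a) ∧ trip (x a) (y a) ≤ L a} :=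
  (measurableSet_lt measurable_const (measurable_mag.comp hx)).inter
    ((measurableSet_lt measurable_const (measurable_mag.comp hy)).inter
      (measurableSet_le (measurable_trip_comp hx hy) hL))

theorem measurable_resKernel_comp {α : Type*} [MeasurableSpace α] {L : α → ℝ} {x y : α → M.Freq}
    (hL : Measurable L) (hx : Measurable x) (hy : Measurable y) :
    Measurable fun a => resKernel (L a) (x a) (y a) :=
  Measurable.ite (measurableSet_res hL hx hy) (measurable_mag.comp (hx.add hy)).ennreal_ofReal
    measurable_const

theorem le_of_trip_le {L s c d : ℝ} (hs : 0 < s) (hc : 0 ≤ c) (hsd : s ≤ c + d) (hcd : c ≤ d)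
    (h : s * (c * d) ≤ L) : c ≤ 2 * L / s ^ 2 := by
  rw [le_div_iff₀ (by positivity)]
  have : s ≤ 2 * d := by linarith
  nlinarith [mul_le_mul_of_nonneg_left this (mul_nonneg hs.le hc)]

/-- The larger child is at least |z|/2, so near resonance confines the smaller one to |c| ≤ 2L/|z|².
The derivative weight |z|² times the measure of this ball is independent of z. -/
theorem lintegral_resKernel_sq_le (L : ℝ) (z : M.Freq) :
    ∫⁻ c, resKernel L c (z - c) ^ 2 ≤ ENNReal.ofReal (8 * L) := by
  classical
  have hz : ∀ c : M.Freq, c + (z - c) = z := fun c => by abel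
  obtain ⟨s, hs⟩ : ∃ s, s = M.mag z := ⟨_, rfl⟩
  have hs0 : 0 ≤ s := hs ▸ mag_nonneg z
  rcases hs0.eq_or_lt with h0 | h0
  · have : ∀ c, resKernel L c (z - c) ^ 2 = 0 := by
      intro c
      unfold resKernel
      rw [hz, ← hs, ← h0]
      simp
    simp [this]
  set S : Set M.Freq := {c | 0 < M.mag c ∧ M.mag c ≤ 2 * L / s ^ 2}
  have hS : MeasurableSet S := (measurableSet_lt measurable_const measurable_mag).inter
    (measurableSet_le measurable_mag measurable_const)
  have hgm : Measurable (S.indicator fun _ : M.Freq => ENNReal.ofReal (s ^ 2)) :=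
    measurable_const.indicator hS
  have key : ∀ c, M.mag c ≤ M.mag (z - c) → resKernel L c (z - c) ^ 2 ≤
      S.indicator (fun _ => ENNReal.ofReal (s ^ 2)) c := by
    intro c hc
    obtain ⟨h1, h2, -⟩ := mag_sub_bounds z c
    unfold resKernel trip
    rw [hz, ← hs]
    rw [← hs] at h1 h2
    split_ifs with h
    · have : c ∈ S := ⟨h.1, le_of_trip_le h0 h.1.le h2 hc h.2.2⟩
      rw [Set.indicator_of_mem this, ENNReal.ofReal_pow h0.le]
    · simp
  refine (lintegral_le_two_mul_of_reflect hgm z key ?_).trans ?_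
  · intro c hc
    rw [resKernel_comm]
    have := key (z - c) (by rwa [sub_sub_cancel])
    rwa [sub_sub_cancel] at this
  · rw [lintegral_indicator_const hS]
    refine (mul_le_mul_right (mul_le_mul_right (volume_mag_le _) _) _).trans ?_
    rw [show (2 : ℝ≥0∞) = ENNReal.ofReal 2 by simp, ← ENNReal.ofReal_mul (by positivity),
      ← ENNReal.ofReal_mul (by positivity)]
    apply ENNReal.ofReal_le_ofReal
    apply le_of_eq; field_simp; ring

/-- The bilinear operator with kernel `resKernel L`. -/
def resBil (L : ℝ) (f g : M.Freq → ℝ≥0∞) (z : M.Freq) : ℝ≥0∞ :=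
  ∫⁻ c, resKernel L c (z - c) * (f c * g (z - c))

theorem sqNorm_resBil_le (L : ℝ) {f g : M.Freq → ℝ≥0∞} (hf : Measurable f)
    (hg : Measurable g) :
    sqNorm (resBil L f g) ≤ ENNReal.ofReal (8 * L) * (sqNorm f * sqNorm g) := by
  rw [← lintegral_convolution_sq hf hg, ← lintegral_const_mul]
  · refine lintegral_mono fun z => ?_
    refine (sq_lintegral_mul_le volume
      (measurable_resKernel_comp (by fun_prop) (by fun_prop) (by fun_prop)).aemeasurable
      (by fun_prop)).trans ?_
    gcongr
    exact lintegral_resKernel_sq_le L z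
  · exact Measurable.lintegral_prod_right'
      (f := fun p : M.Freq × M.Freq => (f p.2 * g (p.1 - p.2)) ^ 2) (by fun_prop)

open Classical in
/-- `(|(x + y) x y| / L)^{1/2} 1_{|(x + y) x y| ≤ L}` -/
def lowWeight (L : ℝ) (x y : M.Freq) : ℝ≥0∞ :=
  if 0 < M.mag x ∧ 0 < M.mag y ∧ trip x y ≤ L then ENNReal.ofReal (Real.sqrt (trip x y / L)) else 0

theorem measurable_lowWeight_comp {α : Type*} [MeasurableSpace α] {L : α → ℝ} {x y : α → M.Freq}
    (hL : Measurable L) (hx : Measurable x) (hy : Measurable y) :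
    Measurable fun a => lowWeight (L a) (x a) (y a) :=
  Measurable.ite (measurableSet_res hL hx hy)
    ((measurable_trip_comp hx hy).div hL).sqrt.ennreal_ofReal measurable_const

/-- `|x + y|² (L / |(x + y) x y|)^{1/2} 1_{|(x + y) x y| ≤ L}` -/
def highWeight (L : ℝ) (x y : M.Freq) : ℝ≥0∞ :=
  resKernel L x y ^ 2 * ENNReal.ofReal (Real.sqrt (trip x y / L))⁻¹

theorem highWeight_comm (L : ℝ) (x y : M.Freq) : highWeight L x y = highWeight L y x := by
  unfold highWeight; rw [resKernel_comm, trip_comm]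

/-- The extra factor (L/|zcd|)^(1/2) behaves like |c|^(−1/2) in the smaller child c, which is
integrable at the origin. Hence the bound has the same order L as without it. -/
theorem lintegral_highWeight_le {L : ℝ} (hL : 0 ≤ L) (z : M.Freq) :
    ∫⁻ c, highWeight L c (z - c) ≤ ENNReal.ofReal (32 * L) := by
  classical
  have hz : ∀ c : M.Freq, c + (z - c) = z := fun c => by abel
  obtain ⟨s, hs⟩ : ∃ s, s = M.mag z := ⟨_, rfl⟩
  have hs0 : 0 ≤ s := hs ▸ mag_nonneg z
  rcases hs0.eq_or_lt with h0 | h0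
  · have : ∀ c, highWeight L c (z - c) = 0 := by
      intro c
      unfold highWeight resKernel
      rw [hz, ← hs, ← h0]
      simp
    simp [this]
  rcases hL.eq_or_lt with hL0 | hL0
  · have : ∀ c, highWeight L c (z - c) = 0 := by
      intro c
      unfold highWeight
      rw [← hL0]
      simp
    simp [this]
  set t : M.Freq → ℝ≥0∞ := fun c => if 0 < M.mag c ∧ M.mag c ≤ 2 * L / s ^ 2 then
    ENNReal.ofReal (Real.sqrt (M.mag c))⁻¹ else 0 with ht
  have htm : Measurable t := Measurable.ite
    ((measurableSet_lt measurable_const measurable_mag).inter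
      (measurableSet_le measurable_mag measurable_const))
    measurable_mag.sqrt.inv.ennreal_ofReal measurable_const
  have key : ∀ c, M.mag c ≤ M.mag (z - c) → highWeight L c (z - c) ≤
      ENNReal.ofReal (s * Real.sqrt (2 * L)) * t c := by
    intro c hc
    obtain ⟨h1, h2, -⟩ := mag_sub_bounds z c
    unfold highWeight resKernel trip
    rw [hz, ← hs]
    rw [← hs] at h1 h2
    split_ifs with h
    · have h4 : 0 < M.mag c ∧ M.mag c ≤ 2 * L / s ^ 2 :=
        ⟨h.1, le_of_trip_le h0 h.1.le h2 hc h.2.2⟩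
      rw [ht]; simp only [if_pos h4]
      have hc0 := h.1
      rw [← ENNReal.ofReal_pow h0.le, ← ENNReal.ofReal_mul (by positivity),
        ← ENNReal.ofReal_mul (by positivity)]
      apply ENNReal.ofReal_le_ofReal
      have h5 : s ^ 2 * M.mag c / (2 * L) ≤ s * (M.mag c * M.mag (z - c)) / L := by
        rw [div_le_div_iff₀ (by positivity) (by positivity)]
        have : s ≤ 2 * M.mag (z - c) := by linarith
        have := mul_le_mul_of_nonneg_left this (show 0 ≤ s * M.mag c * L by positivity)
        nlinarith
      have h6 : Real.sqrt (s ^ 2 * M.mag c / (2 * L)) =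
          s * Real.sqrt (M.mag c) / Real.sqrt (2 * L) := by
        rw [Real.sqrt_div (by positivity), Real.sqrt_mul (by positivity), Real.sqrt_sq h0.le]
      have h7 : 0 < s * Real.sqrt (M.mag c) / Real.sqrt (2 * L) := by positivity
      have h8 := Real.sqrt_le_sqrt h5
      rw [h6] at h8
      calc s ^ 2 * (Real.sqrt (s * (M.mag c * M.mag (z - c)) / L))⁻¹
          ≤ s ^ 2 * (s * Real.sqrt (M.mag c) / Real.sqrt (2 * L))⁻¹ := by gcongr
        _ = _ := by field_simp
    · simp
  refine (lintegral_le_two_mul_of_reflect (htm.const_mul _) z key ?_).trans ?_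
  · intro c hc
    rw [highWeight_comm]
    have := key (z - c) (by rwa [sub_sub_cancel])
    rwa [sub_sub_cancel] at this
  · rw [lintegral_const_mul _ htm]
    refine (mul_le_mul_right (mul_le_mul_right (lintegral_inv_sqrt_ball _ (by positivity)) _) _).trans ?_
    rw [show (2 : ℝ≥0∞) = ENNReal.ofReal 2 by simp, ← ENNReal.ofReal_mul (by positivity),
      ← ENNReal.ofReal_mul (by positivity)]
    apply ENNReal.ofReal_le_ofReal
    rw [Real.sqrt_div (by positivity), Real.sqrt_sq h0.le]
    have := Real.mul_self_sqrt (show 0 ≤ 2 * L by positivity)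
    apply le_of_eq
    field_simp
    nlinarith

/-- Cauchy–Schwarz with the kernel multiplied and divided by (|zcd|/L)^(1/4). By
`lintegral_highWeight_le` the division is free, and the power (|zcd|/L)^(1/2) that survives is what
later prevents a logarithm when L is itself a variable of integration. -/
theorem sq_resBil_le {L : ℝ} (hL : 0 ≤ L) {f g : M.Freq → ℝ≥0∞} (hf : Measurable f)
    (hg : Measurable g) (z : M.Freq) :
    resBil L f g z ^ 2 ≤ ENNReal.ofReal (32 * L) *
      ∫⁻ c, lowWeight L c (z - c) * (f c * g (z - c)) ^ 2 := by
  classical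
  have hsplit : ∀ c, resKernel L c (z - c) =
      (resKernel L c (z - c) * ENNReal.ofReal (Real.sqrt (Real.sqrt (trip c (z - c) / L)))⁻¹) *
        (if 0 < M.mag c ∧ 0 < M.mag (z - c) ∧ trip c (z - c) ≤ L then
          ENNReal.ofReal (Real.sqrt (Real.sqrt (trip c (z - c) / L))) else 0) := by
    intro c
    by_cases h : 0 < M.mag c ∧ 0 < M.mag (z - c) ∧ trip c (z - c) ≤ L
    · rw [if_pos h]
      rcases (mag_nonneg (c + (z - c))).eq_or_lt with h0 | h0
      · unfold resKernel; rw [← h0]; simp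
      · have ht : 0 < trip c (z - c) := mul_pos h0 (mul_pos h.1 h.2.1)
        have : 0 < Real.sqrt (Real.sqrt (trip c (z - c) / L)) :=
          Real.sqrt_pos.2 (Real.sqrt_pos.2 (div_pos ht (ht.trans_le h.2.2)))
        rw [mul_assoc, ← ENNReal.ofReal_mul (by positivity), inv_mul_cancel₀ this.ne']
        simp
    · simp [resKernel, h]
  have hm1 : Measurable fun c => resKernel L c (z - c) :=
    measurable_resKernel_comp (by fun_prop) (by fun_prop) (by fun_prop)
  have hm2 : Measurable fun c => Real.sqrt (Real.sqrt (trip c (z - c) / L)) :=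
    ((measurable_trip_comp (by fun_prop) (by fun_prop)).div_const L).sqrt.sqrt
  have hm3 : MeasurableSet {c | 0 < M.mag c ∧ 0 < M.mag (z - c) ∧ trip c (z - c) ≤ L} :=
    measurableSet_res (by fun_prop) (by fun_prop) (by fun_prop)
  have h1 : resBil L f g z = ∫⁻ c,
      (resKernel L c (z - c) * ENNReal.ofReal (Real.sqrt (Real.sqrt (trip c (z - c) / L)))⁻¹) *
        ((if 0 < M.mag c ∧ 0 < M.mag (z - c) ∧ trip c (z - c) ≤ L then
          ENNReal.ofReal (Real.sqrt (Real.sqrt (trip c (z - c) / L))) else 0) *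
            (f c * g (z - c))) := by
    unfold resBil
    refine lintegral_congr fun c => ?_
    conv_lhs => rw [hsplit c]
    rw [mul_assoc]
  rw [h1]
  refine (sq_lintegral_mul_le volume (hm1.mul hm2.inv.ennreal_ofReal).aemeasurable
    ((Measurable.ite hm3 hm2.ennreal_ofReal measurable_const).mul
      (by fun_prop)).aemeasurable).trans ?_
  refine mul_le_mul' ?_ (le_of_eq ?_)
  · refine le_trans (le_of_eq ?_) (lintegral_highWeight_le hL z)
    refine lintegral_congr fun c => ?_
    change (resKernel L c (z - c) *
      ENNReal.ofReal (Real.sqrt (Real.sqrt (trip c (z - c) / L)))⁻¹) ^ 2 = _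
    rw [mul_pow, highWeight, ← ENNReal.ofReal_pow (by positivity), inv_pow,
      Real.sq_sqrt (Real.sqrt_nonneg _)]
  · refine lintegral_congr fun c => ?_
    change ((if 0 < M.mag c ∧ 0 < M.mag (z - c) ∧ trip c (z - c) ≤ L then
          ENNReal.ofReal (Real.sqrt (Real.sqrt (trip c (z - c) / L))) else 0) *
            (f c * g (z - c))) ^ 2 = _
    rw [mul_pow, lowWeight]
    congr 1
    split_ifs
    · rw [← ENNReal.ofReal_pow (by positivity), Real.sq_sqrt (Real.sqrt_nonneg _)]
    · simp

/-! ### A nonresonant generation followed by a nearly resonant one -/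

/-- The kernel obtained from `kernel m` and the near-resonance condition of the next
generation after integrating out the nonresonant variable. -/
def pairWeight (m J X : ℝ) (x y : M.Freq) : ℝ≥0∞ :=
  kernel m x y ^ 2 * ENNReal.ofReal (32 * (J * trip x y)) *
    (if X ≤ J * trip x y then ENNReal.ofReal (Real.sqrt (X / (J * trip x y))) else 0)

theorem pairWeight_comm (m J X : ℝ) (x y : M.Freq) :
    pairWeight m J X x y = pairWeight m J X y x := by
  unfold pairWeight; rw [kernel_comm, trip_comm]

/-- The product of the first two factors is 32J·s/(cd), which for d ≤ 2s is of order J/c: its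
integral over X/(2Js²) ≤ c ≤ s would be logarithmic in X. The square root supplies another c^(−1/2)
and makes the tail converge. For d ≥ 2s the decay c^(−2) suffices and the square root is merely
bounded by 1. -/
theorem pair_bound {J X s c d : ℝ} (hJ : 0 < J) (hX : 0 < X) (hs : 0 < s) (hc : 0 < c)
    (hsd : s ≤ c + d) (hds : d ≤ s + c) (hcd : c ≤ d) (h : X ≤ J * (s * (c * d))) :
    (X / J / (2 * s ^ 2) ≤ c ∧
      ((c * d) ^ 2)⁻¹ * (32 * (J * (s * (c * d)))) * Real.sqrt (X / (J * (s * (c * d)))) ≤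
        64 * J * (Real.sqrt (2 * (X / J)) / s) * (c * Real.sqrt c)⁻¹) ∨
    (s ≤ c ∧
      ((c * d) ^ 2)⁻¹ * (32 * (J * (s * (c * d)))) * Real.sqrt (X / (J * (s * (c * d)))) ≤
        32 * J * s * (c ^ 2)⁻¹) := by
  have hd : 0 < d := hc.trans_le hcd
  have e0 : ((c * d) ^ 2)⁻¹ * (32 * (J * (s * (c * d)))) = 32 * J * (s / (c * d)) := by
    field_simp
  rw [e0]
  have h' : X / J ≤ s * (c * d) := by rw [div_le_iff₀ hJ]; linarith
  have e1 : X / (J * (s * (c * d))) = X / J / (s * (c * d)) := by field_simp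
  rw [e1]
  set m := X / J with hm
  have hm0 : 0 < m := by positivity
  rcases le_total d (2 * s) with hd2 | hd2
  · left
    constructor
    · rw [div_le_iff₀ (by positivity)]
      nlinarith [mul_le_mul_of_nonneg_left hd2 (mul_pos hs hc).le]
    · have h1 : s / (c * d) ≤ 2 / c := by
        rw [div_le_div_iff₀ (by positivity) hc]
        nlinarith
      have h2 : m / (s * (c * d)) ≤ 2 * m / (s ^ 2 * c) := by
        rw [div_le_div_iff₀ (by positivity) (by positivity)]
        have : s ≤ 2 * d := by linarith
        nlinarith [mul_le_mul_of_nonneg_left this (show 0 ≤ m * s * c by positivity)]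
      have h3 := Real.sqrt_le_sqrt h2
      rw [Real.sqrt_div (show 0 ≤ 2 * m by positivity), Real.sqrt_mul (show 0 ≤ s ^ 2 by positivity) c,
        Real.sqrt_sq hs.le] at h3
      calc 32 * J * (s / (c * d)) * Real.sqrt (m / (s * (c * d)))
          ≤ 32 * J * (2 / c) * (Real.sqrt (2 * m) / (s * Real.sqrt c)) := by gcongr
        _ = _ := by field_simp; ring
  · right
    have hsc : s ≤ c := by linarith
    refine ⟨hsc, ?_⟩
    have h1 : Real.sqrt (m / (s * (c * d))) ≤ 1 := by
      rw [Real.sqrt_le_one]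
      exact div_le_one_of_le₀ h' (by positivity)
    have h2 : s / (c * d) ≤ s * (c ^ 2)⁻¹ := by
      rw [← div_eq_mul_inv]
      apply div_le_div_of_nonneg_left hs.le (by positivity)
      nlinarith
    calc 32 * J * (s / (c * d)) * Real.sqrt (m / (s * (c * d)))
        ≤ 32 * J * (s * (c ^ 2)⁻¹) * 1 := by gcongr
      _ = _ := by ring

/-- The point is uniformity in X and z: the tail integral above X/(2Js²) contributes X^(−1/2)·s,
which exactly cancels the prefactor X^(1/2)/s from `pair_bound`. -/
theorem lintegral_pairWeight_le {J X : ℝ} (hJ : 0 < J) (hX : 0 < X) (m : ℝ) (z : M.Freq) :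
    ∫⁻ e, pairWeight m J X e (z - e) ≤ ENNReal.ofReal (2000 * J) := by
  have hz : ∀ c : M.Freq, c + (z - c) = z := fun c => by abel
  obtain ⟨s, hs⟩ : ∃ s, s = M.mag z := ⟨_, rfl⟩
  have hs0 : 0 ≤ s := hs ▸ mag_nonneg z
  rcases hs0.eq_or_lt with h0 | h0
  · have : ∀ e, pairWeight m J X e (z - e) = 0 := by
      intro e
      unfold pairWeight trip
      rw [hz, ← hs, ← h0]
      simp
    simp [this]
  set Y := X / J / (2 * s ^ 2) with hY
  have hY0 : 0 < Y := by positivity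
  set t : M.Freq → ℝ≥0∞ := fun c => if Y ≤ M.mag c then
    ENNReal.ofReal (M.mag c * Real.sqrt (M.mag c))⁻¹ else 0 with ht
  set t' : M.Freq → ℝ≥0∞ := fun c => if s ≤ M.mag c then ENNReal.ofReal (M.mag c ^ 2)⁻¹ else 0
    with ht'
  have htm : Measurable t := measurable_tail Y (fun r => (r * Real.sqrt r)⁻¹) (by fun_prop)
  have htm' : Measurable t' := measurable_tail s (fun r => (r ^ 2)⁻¹) (by fun_prop)
  set A := 64 * J * (Real.sqrt (2 * (X / J)) / s) with hA
  have hA0 : 0 ≤ A := by positivity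
  have key : ∀ c, M.mag c ≤ M.mag (z - c) → pairWeight m J X c (z - c) ≤
      ENNReal.ofReal A * t c + ENNReal.ofReal (32 * J * s) * t' c := by
    intro c hc
    obtain ⟨h1, h2, -⟩ := mag_sub_bounds z c
    unfold pairWeight
    split_ifs with h
    · have htr : trip c (z - c) = s * (M.mag c * M.mag (z - c)) := by unfold trip; rw [hz, hs]
      rw [htr] at h ⊢
      rw [← hs] at h1 h2
      have hc0 : 0 < M.mag c := by
        rcases (mag_nonneg c).eq_or_lt with h3 | h3
        · rw [← h3] at h; simp at h; linarith
        · exact h3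
      have hd0 : 0 < M.mag (z - c) := hc0.trans_le hc
      have hk : kernel m c (z - c) ^ 2 ≤ ENNReal.ofReal ((M.mag c * M.mag (z - c)) ^ 2)⁻¹ := by
        unfold kernel
        split_ifs
        · rw [← ENNReal.ofReal_pow (by positivity), inv_pow]
        · simp
      calc _ ≤ ENNReal.ofReal ((M.mag c * M.mag (z - c)) ^ 2)⁻¹ *
              ENNReal.ofReal (32 * (J * (s * (M.mag c * M.mag (z - c))))) *
              ENNReal.ofReal (Real.sqrt (X / (J * (s * (M.mag c * M.mag (z - c)))))) := by gcongr
        _ = ENNReal.ofReal (((M.mag c * M.mag (z - c)) ^ 2)⁻¹ *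
              (32 * (J * (s * (M.mag c * M.mag (z - c))))) *
              (Real.sqrt (X / (J * (s * (M.mag c * M.mag (z - c))))))) := by
            rw [← ENNReal.ofReal_mul (by positivity), ← ENNReal.ofReal_mul (by positivity)]
        _ ≤ _ := by
          rcases pair_bound hJ hX h0 hc0 h2 h1 hc h with h4 | h4
          · refine le_trans ?_ le_self_add
            rw [ht]; simp only [if_pos (show Y ≤ M.mag c from h4.1)]
            rw [← ENNReal.ofReal_mul hA0]
            exact ENNReal.ofReal_le_ofReal h4.2
          · refine le_trans ?_ le_add_self
            rw [ht']; simp only [if_pos h4.1]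
            rw [← ENNReal.ofReal_mul (by positivity)]
            exact ENNReal.ofReal_le_ofReal h4.2
    · simp
  have hgm : Measurable fun c => ENNReal.ofReal A * t c + ENNReal.ofReal (32 * J * s) * t' c :=
    (htm.const_mul _).add (htm'.const_mul _)
  refine (lintegral_le_two_mul_of_reflect hgm z key ?_).trans ?_
  · intro c hc
    rw [pairWeight_comm]
    have := key (z - c) (by rwa [sub_sub_cancel])
    rwa [sub_sub_cancel] at this
  · rw [lintegral_add_left (htm.const_mul _), lintegral_const_mul _ htm, lintegral_const_mul _ htm']
    refine (mul_le_mul_right (add_le_add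
      (mul_le_mul_right (lintegral_inv_three_halves_tail hY0) _)
      (mul_le_mul_right (lintegral_inv_sq_tail h0) _)) _).trans ?_
    rw [show (2 : ℝ≥0∞) = ENNReal.ofReal 2 by simp, ← ENNReal.ofReal_mul hA0,
      ← ENNReal.ofReal_mul (by positivity), ← ENNReal.ofReal_add (by positivity) (by positivity),
      ← ENNReal.ofReal_mul (by positivity)]
    apply ENNReal.ofReal_le_ofReal
    have e1 : Real.sqrt Y = Real.sqrt (X / J) / (Real.sqrt 2 * s) := by
      rw [hY, Real.sqrt_div (by positivity), Real.sqrt_mul (by norm_num), Real.sqrt_sq h0.le]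
    have e2 : Real.sqrt (2 * (X / J)) = Real.sqrt 2 * Real.sqrt (X / J) :=
      Real.sqrt_mul (by norm_num) _
    have hq : 0 < Real.sqrt (X / J) := by positivity
    have h22 : Real.sqrt 2 * Real.sqrt 2 = 2 := Real.mul_self_sqrt (by norm_num)
    have e3 : A * (6 / Real.sqrt Y) = 768 * J := by
      rw [hA, e1, e2]
      field_simp
      nlinarith
    have e4 : 32 * J * s * (4 / s) = 128 * J := by field_simp; norm_num
    rw [e3, e4]
    linarith

/-- Two generations with disjoint sets of children: a nonresonant one at `z` and a nearly
resonant one at `a`, whose threshold is set by the former. -/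
def pairForm (m J : ℝ) (u₁ u₂ v₁ v₂ : M.Freq → ℝ≥0∞) (z a : M.Freq) : ℝ≥0∞ :=
  ∫⁻ e, kernel m e (z - e) * (u₁ e * u₂ (z - e)) * resBil (J * trip e (z - e)) v₁ v₂ a

/-- The near-resonance threshold at a depends on the variable e of the other generation, so the two
generations do not decouple. After Cauchy–Schwarz in e and `sq_resBil_le`, the integrals are
exchanged: for fixed c the weight left over is a function of e alone, controlled by
`lintegral_pairWeight_le`. -/
theorem sq_pairForm_le {J : ℝ} (hJ : 0 < J) (m : ℝ) {u₁ u₂ v₁ v₂ : M.Freq → ℝ≥0∞}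
    (hu₁ : Measurable u₁) (hu₂ : Measurable u₂) (hv₁ : Measurable v₁) (hv₂ : Measurable v₂)
    (z a : M.Freq) :
    pairForm m J u₁ u₂ v₁ v₂ z a ^ 2 ≤ ENNReal.ofReal (2000 * J) *
      ((∫⁻ e, (u₁ e * u₂ (z - e)) ^ 2) * ∫⁻ c, (v₁ c * v₂ (a - c)) ^ 2) := by
  classical
  have hk : Measurable fun e => kernel m e (z - e) :=
    measurable_kernel_comp m (by fun_prop) (by fun_prop)
  have htr : Measurable fun e : M.Freq => trip e (z - e) :=
    measurable_trip_comp (by fun_prop) (by fun_prop)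
  have hres : Measurable fun e => resBil (J * trip e (z - e)) v₁ v₂ a := by
    refine Measurable.lintegral_prod_right' (f := fun p : M.Freq × M.Freq =>
      resKernel (J * trip p.1 (z - p.1)) p.2 (a - p.2) * (v₁ p.2 * v₂ (a - p.2))) ?_
    exact (measurable_resKernel_comp ((htr.comp measurable_fst).const_mul J) (by fun_prop)
      (by fun_prop)).mul (by fun_prop)
  have hlow : Measurable (fun p : M.Freq × M.Freq =>
      lowWeight (J * trip p.1 (z - p.1)) p.2 (a - p.2)) :=
    measurable_lowWeight_comp ((htr.comp measurable_fst).const_mul J) (by fun_prop) (by fun_prop)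
  have h1 : pairForm m J u₁ u₂ v₁ v₂ z a = ∫⁻ e, (u₁ e * u₂ (z - e)) *
      (kernel m e (z - e) * resBil (J * trip e (z - e)) v₁ v₂ a) :=
    lintegral_congr fun e => by ring
  rw [h1]
  refine (sq_lintegral_mul_le volume (by fun_prop) (hk.mul hres).aemeasurable).trans ?_
  rw [mul_left_comm]
  refine mul_le_mul_right ?_ _
  have h2 : ∀ e, (kernel m e (z - e) * resBil (J * trip e (z - e)) v₁ v₂ a) ^ 2 ≤
      ∫⁻ c, kernel m e (z - e) ^ 2 * ENNReal.ofReal (32 * (J * trip e (z - e))) *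
        lowWeight (J * trip e (z - e)) c (a - c) * (v₁ c * v₂ (a - c)) ^ 2 := by
    intro e
    have hJt : 0 ≤ J * trip e (z - e) := mul_nonneg hJ.le (trip_nonneg _ _)
    rw [mul_pow]
    refine (mul_le_mul_right (sq_resBil_le hJt hv₁ hv₂ a) _).trans ?_
    have hm : Measurable fun c => lowWeight (J * trip e (z - e)) c (a - c) :=
      measurable_lowWeight_comp (by fun_prop) (by fun_prop) (by fun_prop)
    rw [← mul_assoc, ← lintegral_const_mul]
    · simp_rw [← mul_assoc]; exact le_rfl
    · exact hm.mul (by fun_prop)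
  refine (lintegral_mono h2).trans ?_
  rw [lintegral_lintegral_swap, ← lintegral_const_mul _ (by fun_prop)]
  · refine lintegral_mono fun c => ?_
    -- With c frozen, the condition on c becomes a lower bound on the resonance of e with X = `trip
    -- c (a - c)`. The degenerate case X = 0 drops out because the surviving weight vanishes there.
    have hfac : ∀ e, kernel m e (z - e) ^ 2 * ENNReal.ofReal (32 * (J * trip e (z - e))) *
        lowWeight (J * trip e (z - e)) c (a - c) ≤
        if 0 < trip c (a - c) then pairWeight m J (trip c (a - c)) e (z - e) else 0 := by
      intro e
      unfold lowWeight
      split_ifs with h h' h'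
      · unfold pairWeight
        rw [if_pos h.2.2]
      · have : trip c (a - c) = 0 := le_antisymm (not_lt.1 h') (trip_nonneg _ _)
        rw [this]; simp
      · simp
      · simp
    have hmu : Measurable fun e => kernel m e (z - e) ^ 2 *
        ENNReal.ofReal (32 * (J * trip e (z - e))) * lowWeight (J * trip e (z - e)) c (a - c) :=
      ((hk.pow_const 2).mul ((htr.const_mul J).const_mul 32).ennreal_ofReal).mul
        (measurable_lowWeight_comp (htr.const_mul J) measurable_const measurable_const)
    rw [lintegral_mul_const _ hmu]
    refine mul_le_mul_left ((lintegral_mono hfac).trans ?_) _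
    split_ifs with h
    · exact lintegral_pairWeight_le hJ h m z
    · simp
  · refine Measurable.aemeasurable (Measurable.mul (Measurable.mul (Measurable.mul ?_ ?_) hlow) ?_)
    · exact (hk.comp measurable_fst).pow_const 2
    · exact (((htr.comp measurable_fst).const_mul J).const_mul 32).ennreal_ofReal
    · fun_prop

/-! ### Trilinear estimates -/

theorem lintegral_trilinear_sq {f g h : M.Freq → ℝ≥0∞} (hf : Measurable f) (hg : Measurable g)
    (hh : Measurable h) :
    ∫⁻ z, ∫⁻ b, ∫⁻ c, (f b * (g c * h (z - b - c))) ^ 2 = sqNorm f * (sqNorm g * sqNorm h) := by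
  have hG : Measurable fun y : M.Freq => ∫⁻ c, (g c * h (y - c)) ^ 2 :=
    Measurable.lintegral_prod_right'
      (f := fun p : M.Freq × M.Freq => (g p.2 * h (p.1 - p.2)) ^ 2) (by fun_prop)
  have h1 : ∀ z b, ∫⁻ c, (f b * (g c * h (z - b - c))) ^ 2 =
      f b ^ 2 * ∫⁻ c, (g c * h (z - b - c)) ^ 2 := by
    intro z b
    rw [← lintegral_const_mul _ (by fun_prop)]
    exact lintegral_congr fun c => by ring
  simp_rw [h1]
  rw [lintegral_lintegral_swap]
  · have h2 : ∀ b, ∫⁻ z, f b ^ 2 * ∫⁻ c, (g c * h (z - b - c)) ^ 2 =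
        f b ^ 2 * (sqNorm g * sqNorm h) := by
      intro b
      rw [lintegral_const_mul _ (show Measurable fun z => ∫⁻ c, (g c * h (z - b - c)) ^ 2 from
          hG.comp (measurable_id.sub_const b)),
        lintegral_sub_right_eq_self (fun z => ∫⁻ c, (g c * h (z - c)) ^ 2),
        lintegral_convolution_sq hg hh]
    simp_rw [h2]
    rw [lintegral_mul_const _ (hf.pow_const 2)]
    rfl
  · exact (((hf.comp measurable_snd).pow_const 2).mul
      (hG.comp (measurable_fst.sub measurable_snd))).aemeasurable

open Classical in
/-- `|b|^{-1} 1_{0 < |c| ≤ B |b|}` -/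
def hilbertKernel (B : ℝ) (b c : M.Freq) : ℝ≥0∞ :=
  if 0 < M.mag c ∧ M.mag c ≤ B * M.mag b then ENNReal.ofReal (M.mag b)⁻¹ else 0

theorem measurableSet_hilbert (B : ℝ) :
    MeasurableSet {p : M.Freq × M.Freq | 0 < M.mag p.2 ∧ M.mag p.2 ≤ B * M.mag p.1} :=
  (measurableSet_lt measurable_const (measurable_mag.comp measurable_snd)).inter
    (measurableSet_le (measurable_mag.comp measurable_snd)
      ((measurable_mag.comp measurable_fst).const_mul B))

theorem measurable_hilbertKernel (B : ℝ) :
    Measurable fun p : M.Freq × M.Freq => hilbertKernel B p.1 p.2 :=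
  Measurable.ite (measurableSet_hilbert B)
    (measurable_mag.comp measurable_fst).inv.ennreal_ofReal measurable_const

/-- The trilinear operator with kernel `hilbertKernel B`. -/
def hilbertTri (B : ℝ) (f g h : M.Freq → ℝ≥0∞) (z : M.Freq) : ℝ≥0∞ :=
  ∫⁻ b, ∫⁻ c, hilbertKernel B b c * (f b * (g c * h (z - b - c)))

/-- Schur's test. The square of the kernel has a logarithmically divergent double integral, so plain
Cauchy–Schwarz fails. Instead 1/|b|² is split as k₁k₂ with k₁ = (|b||c|)^(−1/2), integrable in c
over |c| ≤ B|b|, and k₂ = |c|^(1/2)|b|^(−3/2), integrable in b over |b| ≥ |c|/B. The constant is 8√B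
· 6√B. -/
theorem sqNorm_hilbertTri_le {B : ℝ} (hB : 0 < B) {f g h : M.Freq → ℝ≥0∞} (hf : Measurable f)
    (hg : Measurable g) (hh : Measurable h) :
    sqNorm (hilbertTri B f g h) ≤
      ENNReal.ofReal (48 * B) * (sqNorm f * (sqNorm g * sqNorm h)) := by
  classical
  set S : Set (M.Freq × M.Freq) := {p | 0 < M.mag p.2 ∧ M.mag p.2 ≤ B * M.mag p.1} with hSdef
  have hS : MeasurableSet S := measurableSet_hilbert B
  have hmb : Measurable fun p : M.Freq × M.Freq => M.mag p.1 := measurable_mag.comp measurable_fst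
  have hmc : Measurable fun p : M.Freq × M.Freq => M.mag p.2 := measurable_mag.comp measurable_snd
  set k₁ : M.Freq × M.Freq → ℝ≥0∞ := S.indicator fun p =>
    ENNReal.ofReal (Real.sqrt (M.mag p.1) * Real.sqrt (M.mag p.2))⁻¹ with hk₁
  set k₂ : M.Freq × M.Freq → ℝ≥0∞ := S.indicator fun p =>
    ENNReal.ofReal (Real.sqrt (M.mag p.2) * (M.mag p.1 * Real.sqrt (M.mag p.1))⁻¹) with hk₂
  set q₁ : M.Freq × M.Freq → ℝ≥0∞ := S.indicator fun p =>
    ENNReal.ofReal (Real.sqrt (Real.sqrt (M.mag p.1) * Real.sqrt (M.mag p.2))⁻¹) with hq₁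
  set q₂ : M.Freq × M.Freq → ℝ≥0∞ := S.indicator fun p => ENNReal.ofReal
    (Real.sqrt (Real.sqrt (M.mag p.2) * (M.mag p.1 * Real.sqrt (M.mag p.1))⁻¹)) with hq₂
  have hk₁m : Measurable k₁ := (hmb.sqrt.mul hmc.sqrt).inv.ennreal_ofReal.indicator hS
  have hk₂m : Measurable k₂ := (hmc.sqrt.mul (hmb.mul hmb.sqrt).inv).ennreal_ofReal.indicator hS
  have hq₁m : Measurable q₁ := (hmb.sqrt.mul hmc.sqrt).inv.sqrt.ennreal_ofReal.indicator hS
  have hq₂m : Measurable q₂ :=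
    (hmc.sqrt.mul (hmb.mul hmb.sqrt).inv).sqrt.ennreal_ofReal.indicator hS
  have hq₁sq : ∀ p, q₁ p ^ 2 = k₁ p := by
    intro p
    by_cases hp : p ∈ S
    · simp only [hq₁, hk₁, Set.indicator_of_mem hp]
      rw [← ENNReal.ofReal_pow (Real.sqrt_nonneg _), Real.sq_sqrt]
      positivity
    · simp [hq₁, hk₁, hp]
  have hq₂sq : ∀ p, q₂ p ^ 2 = k₂ p := by
    intro p
    by_cases hp : p ∈ S
    · simp only [hq₂, hk₂, Set.indicator_of_mem hp]
      have := mag_nonneg p.1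
      rw [← ENNReal.ofReal_pow (Real.sqrt_nonneg _), Real.sq_sqrt]
      positivity
    · simp [hq₂, hk₂, hp]
  have hsplit : ∀ b c, hilbertKernel B b c = q₁ (b, c) * q₂ (b, c) := by
    intro b c
    by_cases hp : (b, c) ∈ S
    · have hp' : 0 < M.mag c ∧ M.mag c ≤ B * M.mag b := hp
      have hb : 0 < M.mag b := by
        by_contra hb
        have : B * M.mag b ≤ 0 := mul_nonpos_of_nonneg_of_nonpos hB.le (not_lt.1 hb)
        linarith [hp'.1, hp'.2]
      simp only [hq₁, hq₂, Set.indicator_of_mem hp, hilbertKernel, if_pos hp']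
      have hc := hp'.1
      rw [← ENNReal.ofReal_mul (by positivity), ← Real.sqrt_mul (by positivity)]
      congr 1
      have : (Real.sqrt (M.mag b) * Real.sqrt (M.mag c))⁻¹ *
          (Real.sqrt (M.mag c) * (M.mag b * Real.sqrt (M.mag b))⁻¹) = ((M.mag b)⁻¹) ^ 2 := by
        have h1 : 0 < Real.sqrt (M.mag b) := Real.sqrt_pos.2 hb
        have h2 : 0 < Real.sqrt (M.mag c) := Real.sqrt_pos.2 hc
        have h3 := Real.mul_self_sqrt hb.le
        field_simp
        nlinarith
      rw [this, Real.sqrt_sq (by positivity)]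
    · have hp' : ¬ (0 < M.mag c ∧ M.mag c ≤ B * M.mag b) := hp
      simp [hq₁, hp, hilbertKernel, hp']
  -- the two Schur integrals
  have hI₁ : ∀ b, ∫⁻ c, k₁ (b, c) ≤ ENNReal.ofReal (8 * Real.sqrt B) := by
    intro b
    rcases (mag_nonneg b).eq_or_lt with hb | hb
    · have : ∀ c, k₁ (b, c) = 0 := by
        intro c
        have : (b, c) ∉ S := by
          rintro ⟨h1, h2⟩
          simp only [← hb] at h1 h2
          linarith
        simp [hk₁, this]
      simp [this]
    · have h1 : ∀ c, k₁ (b, c) ≤ ENNReal.ofReal (Real.sqrt (M.mag b))⁻¹ *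
          (if 0 < M.mag c ∧ M.mag c ≤ B * M.mag b then
            ENNReal.ofReal (Real.sqrt (M.mag c))⁻¹ else 0) := by
        intro c
        by_cases hp : (b, c) ∈ S
        · have hp' : 0 < M.mag c ∧ M.mag c ≤ B * M.mag b := hp
          simp only [hk₁, Set.indicator_of_mem hp, if_pos hp']
          rw [← ENNReal.ofReal_mul (by positivity), mul_inv]
        · simp [hk₁, hp]
      refine (lintegral_mono h1).trans ?_
      rw [lintegral_const_mul]
      · refine (mul_le_mul_right (lintegral_inv_sqrt_ball _ (by positivity)) _).trans ?_
        rw [← ENNReal.ofReal_mul (by positivity)]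
        apply ENNReal.ofReal_le_ofReal
        rw [Real.sqrt_mul hB.le]
        apply le_of_eq
        have : 0 < Real.sqrt (M.mag b) := Real.sqrt_pos.2 hb
        field_simp
      · exact Measurable.ite ((measurableSet_lt measurable_const measurable_mag).inter
          (measurableSet_le measurable_mag measurable_const))
          measurable_mag.sqrt.inv.ennreal_ofReal measurable_const
  have hI₂ : ∀ c, ∫⁻ b, k₂ (b, c) ≤ ENNReal.ofReal (6 * Real.sqrt B) := by
    intro c
    rcases (mag_nonneg c).eq_or_lt with hc | hc
    · have : ∀ b, k₂ (b, c) = 0 := by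
        intro b
        have : (b, c) ∉ S := by
          rintro ⟨h1, h2⟩
          simp only [← hc] at h1
          exact lt_irrefl _ h1
        simp [hk₂, this]
      simp [this]
    · have h1 : ∀ b, k₂ (b, c) ≤ ENNReal.ofReal (Real.sqrt (M.mag c)) *
          (if M.mag c / B ≤ M.mag b then
            ENNReal.ofReal (M.mag b * Real.sqrt (M.mag b))⁻¹ else 0) := by
        intro b
        by_cases hp : (b, c) ∈ S
        · have hp' : 0 < M.mag c ∧ M.mag c ≤ B * M.mag b := hp
          have hp2 : M.mag c / B ≤ M.mag b := by
            rw [div_le_iff₀ hB]; linarith [hp'.2]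
          simp only [hk₂, Set.indicator_of_mem hp, if_pos hp2]
          rw [← ENNReal.ofReal_mul (by positivity)]
        · simp [hk₂, hp]
      refine (lintegral_mono h1).trans ?_
      rw [lintegral_const_mul _ (measurable_tail _ (fun r => (r * Real.sqrt r)⁻¹) (by fun_prop))]
      refine (mul_le_mul_right (lintegral_inv_three_halves_tail (by positivity)) _).trans ?_
      rw [← ENNReal.ofReal_mul (by positivity)]
      apply ENNReal.ofReal_le_ofReal
      rw [Real.sqrt_div hc.le]
      apply le_of_eq
      have : 0 < Real.sqrt (M.mag c) := Real.sqrt_pos.2 hc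
      field_simp
  -- The functions f and h go with k₁ and g with k₂: the factor containing g is then independent of
  -- z, and in the other one the integral over z reaches h alone.
  have hcs : ∀ z, hilbertTri B f g h z ^ 2 ≤
      (∫⁻ b, ∫⁻ c, k₁ (b, c) * (f b * h (z - b - c)) ^ 2) *
        (ENNReal.ofReal (6 * Real.sqrt B) * sqNorm g) := by
    intro z
    have h1 : hilbertTri B f g h z = ∫⁻ b, ∫⁻ c,
        (q₁ (b, c) * (f b * h (z - b - c))) * (q₂ (b, c) * g c) := by
      unfold hilbertTri
      refine lintegral_congr fun b => lintegral_congr fun c => ?_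
      rw [hsplit]; ring
    rw [h1]
    refine (sq_lintegral_lintegral_mul_le volume volume ?_ ?_).trans ?_
    · unfold Function.uncurry
      exact hq₁m.mul (by fun_prop)
    · unfold Function.uncurry
      exact hq₂m.mul (by fun_prop)
    · simp_rw [mul_pow, hq₁sq, hq₂sq]
      refine mul_le_mul_right ?_ _
      rw [lintegral_lintegral_swap]
      · unfold sqNorm
        rw [← lintegral_const_mul _ (hg.pow_const 2)]
        refine lintegral_mono fun c => ?_
        rw [lintegral_mul_const _ (show Measurable fun b => k₂ (b, c) from hk₂m.comp (by fun_prop))]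
        exact mul_le_mul_left (hI₂ c) _
      · exact (hk₂m.mul (by fun_prop)).aemeasurable
  have hF : Measurable fun p : (M.Freq × M.Freq) × M.Freq =>
      k₁ (p.1.2, p.2) * (f p.1.2 * h (p.1.1 - p.1.2 - p.2)) ^ 2 :=
    (hk₁m.comp (by fun_prop)).mul (by fun_prop)
  have hF' : Measurable fun p : M.Freq × M.Freq =>
      ∫⁻ c, k₁ (p.2, c) * (f p.2 * h (p.1 - p.2 - c)) ^ 2 := hF.lintegral_prod_right'
  calc sqNorm (hilbertTri B f g h) ≤ ∫⁻ z, (∫⁻ b, ∫⁻ c, k₁ (b, c) * (f b * h (z - b - c)) ^ 2) *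
        (ENNReal.ofReal (6 * Real.sqrt B) * sqNorm g) := lintegral_mono hcs
    _ = (∫⁻ z, ∫⁻ b, ∫⁻ c, k₁ (b, c) * (f b * h (z - b - c)) ^ 2) *
        (ENNReal.ofReal (6 * Real.sqrt B) * sqNorm g) :=
      lintegral_mul_const _ hF'.lintegral_prod_right'
    _ ≤ (ENNReal.ofReal (8 * Real.sqrt B) * (sqNorm f * sqNorm h)) *
        (ENNReal.ofReal (6 * Real.sqrt B) * sqNorm g) := by
      refine mul_le_mul_left ?_ _
      rw [lintegral_lintegral_swap hF'.aemeasurable]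
      have h2 : ∀ b, ∫⁻ z, ∫⁻ c, k₁ (b, c) * (f b * h (z - b - c)) ^ 2 ≤
          f b ^ 2 * (ENNReal.ofReal (8 * Real.sqrt B) * sqNorm h) := by
        intro b
        rw [lintegral_lintegral_swap]
        · have h3 : ∀ c, ∫⁻ z, k₁ (b, c) * (f b * h (z - b - c)) ^ 2 =
              k₁ (b, c) * (f b ^ 2 * sqNorm h) := by
            intro c
            rw [lintegral_const_mul _ (by fun_prop)]
            simp_rw [mul_pow]
            rw [lintegral_const_mul _ (by fun_prop)]
            simp_rw [sub_sub]
            rw [lintegral_sub_right_eq_self (fun z => h z ^ 2)]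
            rfl
          simp_rw [h3]
          rw [lintegral_mul_const _ (show Measurable fun c => k₁ (b, c) from hk₁m.comp (by fun_prop)),
            mul_left_comm]
          exact mul_le_mul_right (mul_le_mul_left (hI₁ b) _) _
        · exact ((hk₁m.comp (by fun_prop)).mul (by fun_prop)).aemeasurable
      refine (lintegral_mono h2).trans ?_
      rw [lintegral_mul_const _ (hf.pow_const 2)]
      unfold sqNorm
      rw [mul_left_comm]
    _ = _ := by
      have : ENNReal.ofReal (48 * B) =
          ENNReal.ofReal (8 * Real.sqrt B) * ENNReal.ofReal (6 * Real.sqrt B) := by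
        rw [← ENNReal.ofReal_mul (by positivity)]
        congr 1
        nlinarith [Real.mul_self_sqrt hB.le]
      rw [this]; ring

theorem ennreal_add_sq_le (a b : ℝ≥0∞) : (a + b) ^ 2 ≤ 2 * (a ^ 2 + b ^ 2) := by
  induction a with
  | top => simp
  | coe a =>
    induction b with
    | top => simp
    | coe b =>
      have h := add_sq_le (a := a) (b := b)
      exact_mod_cast h

/-- A nonresonant generation at `z` with children `b` and `z - b`, followed by a nearly resonant
one at `z - b`. -/
def nestForm (m J : ℝ) (f g h : M.Freq → ℝ≥0∞) (z : M.Freq) : ℝ≥0∞ :=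
  ∫⁻ b, kernel m b (z - b) * (f b * resBil (J * trip b (z - b)) g h (z - b))

open Classical in
/-- `|b|^{-1}` on the region `|z| ≤ 2 |b|`, `|c d| ≤ J |z b|`. -/
def outerKernel (J : ℝ) (z b c d : M.Freq) : ℝ≥0∞ :=
  if (0 < M.mag c ∧ 0 < M.mag d ∧ M.mag c * M.mag d ≤ J * (M.mag z * M.mag b)) ∧
    (0 < M.mag z ∧ M.mag z / 2 ≤ M.mag b) then ENNReal.ofReal (M.mag b)⁻¹ else 0

theorem measurable_outerKernel_comp {α : Type*} [MeasurableSpace α] (J : ℝ) (z : M.Freq)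
    {b c d : α → M.Freq} (hb : Measurable b) (hc : Measurable c) (hd : Measurable d) :
    Measurable fun a => outerKernel J z (b a) (c a) (d a) := by
  have hb' := measurable_mag.comp hb
  have hc' := measurable_mag.comp hc
  have hd' := measurable_mag.comp hd
  refine Measurable.ite ?_ hb'.inv.ennreal_ofReal measurable_const
  refine MeasurableSet.inter (MeasurableSet.inter (measurableSet_lt measurable_const hc')
    (MeasurableSet.inter (measurableSet_lt measurable_const hd')
      (measurableSet_le (hc'.mul hd') ((hb'.const_mul _).const_mul _))))
    (MeasurableSet.inter (MeasurableSet.const _) (measurableSet_le measurable_const hb'))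

/-- The smaller of |c| and |a − c| is at most √Λ. -/
theorem volume_mul_reflect_le (Λ : ℝ) (a : M.Freq) :
    volume {c : M.Freq | 0 < M.mag c ∧ 0 < M.mag (a - c) ∧ M.mag c * M.mag (a - c) ≤ Λ} ≤
      ENNReal.ofReal (4 * Real.sqrt Λ) := by
  set S : Set M.Freq := {c | 0 < M.mag c ∧ 0 < M.mag (a - c) ∧ M.mag c * M.mag (a - c) ≤ Λ}
  set S' : Set M.Freq := {c | 0 < M.mag c ∧ M.mag c ≤ Real.sqrt Λ}
  have hmr : Measurable fun c : M.Freq => M.mag (a - c) := measurable_mag.comp (by fun_prop)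
  have hS : MeasurableSet S := (measurableSet_lt measurable_const measurable_mag).inter
    ((measurableSet_lt measurable_const hmr).inter
      (measurableSet_le (measurable_mag.mul hmr) measurable_const))
  have hS' : MeasurableSet S' := (measurableSet_lt measurable_const measurable_mag).inter
    (measurableSet_le measurable_mag measurable_const)
  have key : ∀ c, M.mag c ≤ M.mag (a - c) →
      S.indicator (fun _ => (1 : ℝ≥0∞)) c ≤ S'.indicator (fun _ => 1) c := by
    intro c hc
    by_cases h : c ∈ S
    · have : c ∈ S' := by
        refine ⟨h.1, Real.le_sqrt_of_sq_le ?_⟩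
        have := h.2.2
        nlinarith [mul_le_mul_of_nonneg_left hc h.1.le]
      simp [h, this]
    · simp [h]
  have h := lintegral_le_two_mul_of_reflect (f := S.indicator fun _ => (1 : ℝ≥0∞))
    (measurable_const.indicator hS') a key ?_
  · rw [lintegral_indicator_const hS, lintegral_indicator_const hS', one_mul, one_mul] at h
    refine h.trans ((mul_le_mul_right (volume_mag_le _) _).trans ?_)
    rw [show (2 : ℝ≥0∞) = ENNReal.ofReal 2 by simp, ← ENNReal.ofReal_mul (by norm_num)]
    apply ENNReal.ofReal_le_ofReal
    linarith
  · intro c hc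
    have h1 := key (a - c) (by rwa [sub_sub_cancel])
    refine le_trans (le_of_eq ?_) h1
    have : c ∈ S ↔ a - c ∈ S := by
      simp only [S, Set.mem_ofPred_eq, sub_sub_cancel, mul_comm (M.mag c)]
      rw [← and_assoc, and_comm (a := 0 < M.mag c), and_assoc]
    by_cases h : c ∈ S
    · rw [Set.indicator_of_mem h, Set.indicator_of_mem (this.1 h)]
    · rw [Set.indicator_of_notMem h, Set.indicator_of_notMem (fun h' => h (this.2 h'))]

/-- The condition |cd| ≤ J|zb| leaves measure at most 4√(J|zb|) for c. Multiplied by |b|^(−2) this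
is |b|^(−3/2), whose tail over |b| ≥ |z|/2 cancels √|z|. Here the kernel is square integrable, so no
Schur weights are needed. -/
theorem lintegral_outerKernel_sq_le {J : ℝ} (hJ : 1 ≤ J) (z : M.Freq) :
    ∫⁻ b, ∫⁻ c, outerKernel J z b c (z - b - c) ^ 2 ≤ ENNReal.ofReal (36 * J) := by
  classical
  rcases (mag_nonneg z).eq_or_lt with h0 | h0
  · have : ∀ b c, outerKernel J z b c (z - b - c) ^ 2 = 0 := by
      intro b c
      simp [outerKernel, ← h0]
    simp [this]
  have h1 : ∀ b, ∫⁻ c, outerKernel J z b c (z - b - c) ^ 2 ≤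
      ENNReal.ofReal (4 * Real.sqrt (J * M.mag z)) * (if M.mag z / 2 ≤ M.mag b then
        ENNReal.ofReal (M.mag b * Real.sqrt (M.mag b))⁻¹ else 0) := by
    intro b
    split_ifs with hb
    · have hb0 : 0 < M.mag b := by linarith
      have hJ0 : 0 < J := by linarith
      have h2 : ∀ c, outerKernel J z b c (z - b - c) ^ 2 ≤
          {c : M.Freq | 0 < M.mag c ∧ 0 < M.mag (z - b - c) ∧
            M.mag c * M.mag (z - b - c) ≤ J * (M.mag z * M.mag b)}.indicator
            (fun _ => ENNReal.ofReal ((M.mag b) ^ 2)⁻¹) c := by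
        intro c
        unfold outerKernel
        split_ifs with h
        · rw [Set.indicator_of_mem (by exact h.1), ← ENNReal.ofReal_pow (by positivity), inv_pow]
        · simp
      refine (lintegral_mono h2).trans ((lintegral_indicator_const_le _ _).trans ?_)
      refine (mul_le_mul_right (volume_mul_reflect_le _ _) _).trans ?_
      rw [← ENNReal.ofReal_mul (by positivity), ← ENNReal.ofReal_mul (by positivity)]
      apply ENNReal.ofReal_le_ofReal
      rw [← mul_assoc J, Real.sqrt_mul (by positivity) (M.mag b)]
      have h3 : 0 < Real.sqrt (M.mag b) := Real.sqrt_pos.2 hb0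
      have h4 := Real.mul_self_sqrt hb0.le
      apply le_of_eq
      field_simp
      nlinarith
    · have : ∀ c, outerKernel J z b c (z - b - c) ^ 2 = 0 := by
        intro c; simp [outerKernel, hb]
      simp [this]
  refine (lintegral_mono h1).trans ?_
  rw [lintegral_const_mul _ (measurable_tail _ (fun r => (r * Real.sqrt r)⁻¹) (by fun_prop))]
  refine (mul_le_mul_right (lintegral_inv_three_halves_tail (by positivity)) _).trans ?_
  rw [← ENNReal.ofReal_mul (by positivity)]
  apply ENNReal.ofReal_le_ofReal
  rw [Real.sqrt_mul (by linarith), Real.sqrt_div h0.le]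
  have h3 : 0 < Real.sqrt (M.mag z) := Real.sqrt_pos.2 h0
  have h4 : Real.sqrt J ≤ J := by
    rw [Real.sqrt_le_left (by linarith)]; nlinarith
  have h5 : Real.sqrt 2 ≤ 3 / 2 := by
    rw [Real.sqrt_le_left (by norm_num)]; norm_num
  have e : 4 * (Real.sqrt J * Real.sqrt (M.mag z)) * (6 / (Real.sqrt (M.mag z) / Real.sqrt 2)) =
      24 * Real.sqrt 2 * Real.sqrt J := by field_simp; norm_num
  rw [e]
  nlinarith [Real.sqrt_nonneg J, Real.sqrt_nonneg 2]

/-- The derivative weight |z−b| of the second generation cancels that factor in the first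
denominator, and |z−b| also cancels from the near-resonance condition, leaving 1/|b| and |cd| ≤
J|zb|. If |b| ≥ |z|/2 this is the outer kernel. Otherwise |z−b| ≥ |z|/2, the larger of |c|, |d| is
at least |z|/4, and the smaller one is at most 4J|b|. -/
theorem kernel_mul_resKernel_le {m : ℝ} (hm : 0 < m) (J : ℝ) (z b c : M.Freq) :
    kernel m b (z - b) * resKernel (J * trip b (z - b)) c (z - b - c) ≤
      outerKernel J z b c (z - b - c) + (hilbertKernel (4 * J) b c +
        hilbertKernel (4 * J) b (z - b - c)) := by
  classical
  have hz : b + (z - b) = z := by abel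
  have ha : c + (z - b - c) = z - b := by abel
  obtain ⟨-, h2, -⟩ := mag_sub_bounds z b
  obtain ⟨-, h4, -⟩ := mag_sub_bounds (z - b) c
  unfold kernel resKernel trip
  rw [hz, ha]
  set d := z - b - c
  set a := z - b
  by_cases h : m ≤ M.mag z * (M.mag b * M.mag a)
  swap
  · rw [if_neg h, zero_mul]; exact zero_le
  by_cases h' : 0 < M.mag c ∧ 0 < M.mag d ∧
      M.mag a * (M.mag c * M.mag d) ≤ J * (M.mag z * (M.mag b * M.mag a))
  swap
  · rw [if_neg h', mul_zero]; exact zero_le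
  rw [if_pos h, if_pos h']
  have hz0 : 0 < M.mag z := (mag_nonneg z).lt_of_ne (fun h0 => by rw [← h0] at h; simp at h; linarith)
  have hb0 : 0 < M.mag b := (mag_nonneg b).lt_of_ne (fun h0 => by rw [← h0] at h; simp at h; linarith)
  have ha0 : 0 < M.mag a := (mag_nonneg a).lt_of_ne (fun h0 => by rw [← h0] at h; simp at h; linarith)
  obtain ⟨hc0, hd0, hcd⟩ := h'
  have hcd' : M.mag c * M.mag d ≤ J * (M.mag z * M.mag b) := by
    refine le_of_mul_le_mul_left ?_ ha0
    calc _ ≤ _ := hcd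
      _ = _ := by ring
  have e : ENNReal.ofReal (M.mag b * M.mag a)⁻¹ * ENNReal.ofReal (M.mag a) =
      ENNReal.ofReal (M.mag b)⁻¹ := by
    rw [← ENNReal.ofReal_mul (by positivity)]
    congr 1; field_simp
  rw [e]
  by_cases hzb : M.mag z / 2 ≤ M.mag b
  · refine le_trans ?_ le_self_add
    rw [outerKernel, if_pos ⟨⟨hc0, hd0, hcd'⟩, hz0, hzb⟩]
  · refine le_trans ?_ le_add_self
    rw [not_le] at hzb
    rcases le_total (M.mag c) (M.mag d) with hle | hle
    · refine le_trans ?_ le_self_add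
      have : M.mag z ≤ 4 * M.mag d := by linarith
      have h6 : M.mag c ≤ 4 * J * M.mag b := by
        refine le_of_mul_le_mul_left ?_ hz0
        nlinarith [mul_le_mul_of_nonneg_left this hc0.le]
      rw [hilbertKernel, if_pos ⟨hc0, h6⟩]
    · refine le_trans ?_ le_add_self
      have : M.mag z ≤ 4 * M.mag c := by linarith
      have h6 : M.mag d ≤ 4 * J * M.mag b := by
        refine le_of_mul_le_mul_left ?_ hz0
        nlinarith [mul_le_mul_of_nonneg_left this hd0.le]
      rw [hilbertKernel, if_pos ⟨hd0, h6⟩]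

/-- The outer piece by Cauchy–Schwarz, the two inner pieces by Schur's test, one of them after
exchanging c with z − b − c. The constants add up to 2·36 + 8·192 = 1608. -/
theorem sqNorm_nestForm_le {m J : ℝ} (hm : 0 < m) (hJ : 1 ≤ J) {f g h : M.Freq → ℝ≥0∞}
    (hf : Measurable f) (hg : Measurable g) (hh : Measurable h) :
    sqNorm (nestForm m J f g h) ≤
      ENNReal.ofReal (2000 * J) * (sqNorm f * (sqNorm g * sqNorm h)) := by
  have hJ0 : 0 < J := by linarith
  have hH := measurable_hilbertKernel (M := M) (4 * J)
  set T : M.Freq → ℝ≥0∞ := fun z =>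
    ∫⁻ b, ∫⁻ c, outerKernel J z b c (z - b - c) * (f b * (g c * h (z - b - c))) with hT
  have hle : ∀ z, nestForm m J f g h z ≤
      T z + (hilbertTri (4 * J) f g h z + hilbertTri (4 * J) f h g z) := by
    intro z
    have e1 : hilbertTri (4 * J) f h g z = ∫⁻ b, ∫⁻ c,
        hilbertKernel (4 * J) b (z - b - c) * (f b * (g c * h (z - b - c))) := by
      unfold hilbertTri
      refine lintegral_congr fun b => ?_
      rw [← lintegral_sub_left_eq_self _ (z - b)]
      refine lintegral_congr fun c => ?_
      rw [sub_sub_cancel, mul_comm (h _)]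
    rw [e1, hT]
    unfold hilbertTri
    have hO : Measurable fun p : M.Freq × M.Freq =>
        outerKernel J z p.1 p.2 (z - p.1 - p.2) * (f p.1 * (g p.2 * h (z - p.1 - p.2))) :=
      (measurable_outerKernel_comp J z (by fun_prop) (by fun_prop) (by fun_prop)).mul (by fun_prop)
    have hK : Measurable fun p : M.Freq × M.Freq =>
        hilbertKernel (4 * J) p.1 p.2 * (f p.1 * (g p.2 * h (z - p.1 - p.2))) :=
      hH.mul (by fun_prop)
    rw [← lintegral_add_left hK.lintegral_prod_right', ← lintegral_add_left hO.lintegral_prod_right']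
    refine lintegral_mono fun b => ?_
    have hO' : Measurable fun c : M.Freq =>
        outerKernel J z b c (z - b - c) * (f b * (g c * h (z - b - c))) :=
      hO.comp measurable_prodMk_left
    have hK' : Measurable fun c : M.Freq =>
        hilbertKernel (4 * J) b c * (f b * (g c * h (z - b - c))) := hK.comp measurable_prodMk_left
    have hr : Measurable fun c => resKernel (J * trip b (z - b)) c (z - b - c) :=
      measurable_resKernel_comp (by fun_prop) (by fun_prop) (by fun_prop)
    rw [← lintegral_add_left hK', ← lintegral_add_left hO']
    unfold resBil
    have hrm : Measurable fun c : M.Freq =>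
        resKernel (J * trip b (z - b)) c (z - b - c) * (g c * h (z - b - c)) :=
      hr.mul (by fun_prop)
    rw [← lintegral_const_mul _ hrm, ← lintegral_const_mul _ (hrm.const_mul _)]
    refine lintegral_mono fun c => ?_
    calc kernel m b (z - b) * (f b * (resKernel (J * trip b (z - b)) c (z - b - c) *
            (g c * h (z - b - c))))
        = (kernel m b (z - b) * resKernel (J * trip b (z - b)) c (z - b - c)) *
            (f b * (g c * h (z - b - c))) := by ring
      _ ≤ _ := mul_le_mul_left (kernel_mul_resKernel_le hm J z b c) _
      _ = _ := by ring
  have hTn : sqNorm T ≤ ENNReal.ofReal (36 * J) * (sqNorm f * (sqNorm g * sqNorm h)) := by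
    rw [← lintegral_trilinear_sq hf hg hh, ← lintegral_const_mul]
    · refine lintegral_mono fun z => ?_
      refine (sq_lintegral_lintegral_mul_le volume volume ?_ ?_).trans
        (mul_le_mul_left (lintegral_outerKernel_sq_le hJ z) _)
      · have hm : Measurable fun p : M.Freq × M.Freq =>
            outerKernel J z p.1 p.2 (z - p.1 - p.2) :=
          measurable_outerKernel_comp J z (by fun_prop) (by fun_prop) (by fun_prop)
        exact hm
      · unfold Function.uncurry; fun_prop
    · have h1 : Measurable fun p : (M.Freq × M.Freq) × M.Freq =>
        (f p.1.2 * (g p.2 * h (p.1.1 - p.1.2 - p.2))) ^ 2 := by fun_prop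
      exact h1.lintegral_prod_right'.lintegral_prod_right'
  have hHm : ∀ g h : M.Freq → ℝ≥0∞, Measurable g → Measurable h →
      Measurable (hilbertTri (4 * J) f g h) := by
    intro g h hg hh
    have h1 : Measurable fun p : (M.Freq × M.Freq) × M.Freq =>
        hilbertKernel (4 * J) p.1.2 p.2 * (f p.1.2 * (g p.2 * h (p.1.1 - p.1.2 - p.2))) :=
      Measurable.mul (hH.comp ((measurable_snd.comp measurable_fst).prodMk measurable_snd))
        (by fun_prop)
    exact h1.lintegral_prod_right'.lintegral_prod_right'
  have hN1 := sqNorm_hilbertTri_le (show 0 < 4 * J by positivity) hf hg hh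
  have hN2 := sqNorm_hilbertTri_le (show 0 < 4 * J by positivity) hf hh hg
  rw [mul_comm (sqNorm h)] at hN2
  calc sqNorm (nestForm m J f g h)
      ≤ ∫⁻ z, (2 * T z ^ 2 + (4 * hilbertTri (4 * J) f g h z ^ 2 +
          4 * hilbertTri (4 * J) f h g z ^ 2)) := by
        refine lintegral_mono fun z => (pow_le_pow_left' (hle z) 2).trans ?_
        refine (ennreal_add_sq_le _ _).trans ?_
        rw [mul_add]
        gcongr
        calc 2 * (hilbertTri (4 * J) f g h z + hilbertTri (4 * J) f h g z) ^ 2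
            ≤ 2 * (2 * (hilbertTri (4 * J) f g h z ^ 2 + hilbertTri (4 * J) f h g z ^ 2)) :=
              mul_le_mul_right (ennreal_add_sq_le _ _) _
          _ = _ := by ring
    _ = 2 * sqNorm T + (4 * sqNorm (hilbertTri (4 * J) f g h) +
          4 * sqNorm (hilbertTri (4 * J) f h g)) := by
        have hs : Measurable fun z => 4 * hilbertTri (4 * J) f g h z ^ 2 +
            4 * hilbertTri (4 * J) f h g z ^ 2 :=
          (((hHm g h hg hh).pow_const 2).const_mul 4).add
            (((hHm h g hh hg).pow_const 2).const_mul 4)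
        rw [lintegral_add_right _ hs,
          lintegral_add_left (((hHm g h hg hh).pow_const 2).const_mul 4),
          lintegral_const_mul _ ((hHm g h hg hh).pow_const 2),
          lintegral_const_mul _ ((hHm h g hh hg).pow_const 2),
          lintegral_const_mul' _ _ (by norm_num)]
        rfl
    _ ≤ 2 * (ENNReal.ofReal (36 * J) * (sqNorm f * (sqNorm g * sqNorm h))) +
          (4 * (ENNReal.ofReal (48 * (4 * J)) * (sqNorm f * (sqNorm g * sqNorm h))) +
          4 * (ENNReal.ofReal (48 * (4 * J)) * (sqNorm f * (sqNorm g * sqNorm h)))) := by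
        gcongr
    _ = ENNReal.ofReal (1608 * J) * (sqNorm f * (sqNorm g * sqNorm h)) := by
        have h2 : (2 : ℝ≥0∞) * ENNReal.ofReal (36 * J) + (4 * ENNReal.ofReal (48 * (4 * J)) +
            4 * ENNReal.ofReal (48 * (4 * J))) = ENNReal.ofReal (1608 * J) := by
          rw [show (2 : ℝ≥0∞) = ENNReal.ofReal 2 by simp,
            show (4 : ℝ≥0∞) = ENNReal.ofReal 4 by simp, ← ENNReal.ofReal_mul (by positivity),
            ← ENNReal.ofReal_mul (by positivity), ← ENNReal.ofReal_add (by positivity) (by positivity),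
            ← ENNReal.ofReal_add (by positivity) (by positivity)]
          congr 1; ring
        rw [← h2]; ring
    _ ≤ _ := by
        refine mul_le_mul_left (ENNReal.ofReal_le_ofReal ?_) _
        linarith

/-! ### Growing a tree by one generation -/

namespace OrderedTree

variable {j : ℕ}

/-- The tree without its last generation. -/
def init (T : OrderedTree (j + 1)) : OrderedTree j where
  branch k := T.branch k.castSucc
  injective := T.injective.comp (Fin.castSucc_injective j)
  root k hk := T.root k.castSucc hk
  grow k hk := by
    obtain ⟨i, hi, b, hb⟩ := T.grow k.castSucc hk
    refine ⟨⟨i, lt_trans (show (i : ℕ) < k from hi) k.2⟩, hi, b, hb⟩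

/-- The root node of the last generation. -/
def last (T : OrderedTree (j + 1)) : Node := T.branch (Fin.last j)

/-- The terminal nodes; for a tree of no generation this is the root. -/
def terminal (T : OrderedTree j) : Finset Node :=
  insert [] (T.internal.image (List.cons false) ∪ T.internal.image (List.cons true)) \ T.internal

theorem terminal_eq_leaves (T : OrderedTree (j + 1)) : T.terminal = T.leaves := by
  have h : ([] : Node) ∈ T.internal :=
    Finset.mem_image.2 ⟨0, Finset.mem_univ _, T.root 0 rfl⟩
  unfold terminal leaves
  rw [Finset.insert_sdiff_of_mem _ h]

theorem branch_mem_internal (T : OrderedTree j) (k : Fin j) : T.branch k ∈ T.internal :=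
  Finset.mem_image_of_mem _ (Finset.mem_univ _)

theorem mem_internal {T : OrderedTree j} {a : Node} : a ∈ T.internal ↔ ∃ k, T.branch k = a := by
  simp [internal]

/-- Parents are branched before their children. This makes the internal nodes closed under passing
to the parent and shows that the children of the last root are leaves. -/
theorem exists_lt_of_branch_eq_cons (T : OrderedTree j) {k : Fin j} {b : Bool} {a : Node}
    (h : T.branch k = b :: a) : ∃ i < k, T.branch i = a := by
  have hk : (k : ℕ) ≠ 0 := fun h0 => by rw [T.root k h0] at h; cases h
  obtain ⟨i, hi, b', hb⟩ := T.grow k hk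
  rw [hb] at h
  exact ⟨i, hi, (List.cons.inj h).2⟩

theorem mem_internal_of_cons_mem {T : OrderedTree j} {b : Bool} {a : Node}
    (h : b :: a ∈ T.internal ∪ T.terminal) : a ∈ T.internal := by
  rcases Finset.mem_union.1 h with h | h
  · obtain ⟨k, hk⟩ := mem_internal.1 h
    obtain ⟨i, -, hi⟩ := T.exists_lt_of_branch_eq_cons hk
    exact mem_internal.2 ⟨i, hi⟩
  · unfold terminal at h
    simp only [Finset.mem_sdiff, Finset.mem_insert, Finset.mem_union, Finset.mem_image] at h
    rcases h.1 with h | ⟨c, hc, h⟩ | ⟨c, hc, h⟩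
    · cases h
    · rw [← (List.cons.inj h).2]; exact hc
    · rw [← (List.cons.inj h).2]; exact hc

theorem mem_terminal_cons {T : OrderedTree j} {b : Bool} {a : Node} :
    b :: a ∈ T.terminal ↔ a ∈ T.internal ∧ b :: a ∉ T.internal := by
  constructor
  · intro h
    exact ⟨mem_internal_of_cons_mem (Finset.mem_union_right _ h), (Finset.mem_sdiff.1 h).2⟩
  · rintro ⟨h1, h2⟩
    refine Finset.mem_sdiff.2 ⟨?_, h2⟩
    cases b <;> simp [h1]

theorem nil_mem_terminal {T : OrderedTree j} : [] ∈ T.terminal ↔ [] ∉ T.internal := by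
  simp [terminal]

theorem internal_succ (T : OrderedTree (j + 1)) :
    T.internal = insert T.last T.init.internal := by
  ext a
  simp only [Finset.mem_insert, mem_internal]
  constructor
  · rintro ⟨k, rfl⟩
    refine Fin.lastCases (Or.inl rfl) (fun i => Or.inr ⟨i, rfl⟩) k
  · rintro (rfl | ⟨k, rfl⟩)
    · exact ⟨Fin.last j, rfl⟩
    · exact ⟨k.castSucc, rfl⟩

theorem last_notMem_internal_init (T : OrderedTree (j + 1)) : T.last ∉ T.init.internal := by
  intro h
  obtain ⟨k, hk⟩ := mem_internal.1 h
  exact (Fin.castSucc_lt_last k).ne (T.injective hk)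

theorem last_mem_terminal_init (T : OrderedTree (j + 1)) : T.last ∈ T.init.terminal := by
  have h := T.last_notMem_internal_init
  rcases hl : T.last with _ | ⟨b, a⟩
  · rw [hl] at h; exact nil_mem_terminal.2 h
  · rw [hl] at h
    refine mem_terminal_cons.2 ⟨?_, h⟩
    obtain ⟨i, hi, hia⟩ := T.exists_lt_of_branch_eq_cons hl
    exact mem_internal.2 ⟨⟨i, hi⟩, hia⟩

theorem child_notMem_internal (T : OrderedTree (j + 1)) (b : Bool) : b :: T.last ∉ T.internal := by
  intro h
  obtain ⟨k, hk⟩ := mem_internal.1 h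
  obtain ⟨i, hi, hia⟩ := T.exists_lt_of_branch_eq_cons hk
  have := T.injective hia
  rw [this] at hi
  exact absurd hi (not_lt.2 (Fin.le_last k))

theorem child_notMem_terminal_init (T : OrderedTree (j + 1)) (b : Bool) :
    b :: T.last ∉ T.init.terminal := fun h =>
  T.last_notMem_internal_init (mem_internal_of_cons_mem (Finset.mem_union_right _ h))

/-- One generation exchanges a single leaf for its two children and touches no other leaf; every
induction on trees below rests on this. -/
theorem terminal_succ (T : OrderedTree (j + 1)) :
    T.terminal = insert (false :: T.last) (insert (true :: T.last) (T.init.terminal.erase T.last)) := by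
  ext a
  simp only [Finset.mem_insert, Finset.mem_erase]
  rcases a with _ | ⟨b, a⟩
  · rw [nil_mem_terminal, nil_mem_terminal, internal_succ]
    simp only [Finset.mem_insert, not_or, ne_eq]
    constructor
    · exact fun h => Or.inr (Or.inr h)
    · rintro (h | h | h)
      · cases h
      · cases h
      · exact h
  · rw [mem_terminal_cons, mem_terminal_cons]
    constructor
    · rintro ⟨h1, h2⟩
      rw [internal_succ] at h1 h2
      rcases Finset.mem_insert.1 h1 with rfl | h1
      · cases b <;> simp
      · rw [Finset.mem_insert, not_or] at h2
        exact Or.inr (Or.inr ⟨h2.1, h1, h2.2⟩)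
    · rintro (h | h | h)
      · rw [h]
        refine ⟨?_, T.child_notMem_internal _⟩
        rw [(List.cons.inj h).2]; exact T.branch_mem_internal _
      · rw [h]
        refine ⟨?_, T.child_notMem_internal _⟩
        rw [(List.cons.inj h).2]; exact T.branch_mem_internal _
      · rw [internal_succ, Finset.mem_insert, Finset.mem_insert, not_or]
        exact ⟨Or.inr h.2.1, h.1, h.2.2⟩

theorem prod_terminal_succ {α : Type*} [CommMonoid α] (T : OrderedTree (j + 1)) (g : Node → α) :
    ∏ a ∈ T.terminal, g a =
      g (false :: T.last) * (g (true :: T.last) * ∏ a ∈ T.init.terminal.erase T.last, g a) := by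
  rw [terminal_succ, Finset.prod_insert, Finset.prod_insert]
  · intro h
    exact T.child_notMem_terminal_init true (Finset.mem_of_mem_erase h)
  · rw [Finset.mem_insert, not_or]
    refine ⟨by simp, fun h => T.child_notMem_terminal_init false (Finset.mem_of_mem_erase h)⟩

theorem card_terminal (T : OrderedTree j) : T.terminal.card = j + 1 := by
  induction j with
  | zero =>
    have : T.internal = ∅ := by simp [internal]
    simp [terminal, this]
  | succ j ih =>
    rw [terminal_succ, Finset.card_insert_of_notMem, Finset.card_insert_of_notMem,
      Finset.card_erase_of_mem T.last_mem_terminal_init, ih]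
    · omega
    · exact fun h => T.child_notMem_terminal_init true (Finset.mem_of_mem_erase h)
    · rw [Finset.mem_insert, not_or]
      exact ⟨by simp, fun h => T.child_notMem_terminal_init false (Finset.mem_of_mem_erase h)⟩

/-! ### Frequencies -/

/-- By injectivity of the chronicle, the index chosen in the definition of `freq` can only be k. -/
theorem freq_child (T : OrderedTree j) (ξ : M.Freq) (η : Fin j → M.Freq) (k : Fin j) :
    T.freq ξ η (false :: T.branch k) = η k ∧
      T.freq ξ η (true :: T.branch k) = T.freq ξ η (T.branch k) - η k := by
  have h : ∃ i, T.branch i = T.branch k := ⟨k, rfl⟩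
  have hc : h.choose = k := T.injective h.choose_spec
  constructor
  · rw [freq, dif_pos h]; simp [hc]
  · rw [freq, dif_pos h]; simp [hc]

/-- The frequency of a node is computed along its path from the root, which for nodes of the
truncated tree never passes through the last generation. The last variable is therefore invisible
outside the two newest leaves. -/
theorem freq_init (T : OrderedTree (j + 1)) (ξ : M.Freq) (η : Fin (j + 1) → M.Freq) (a : Node)
    (ha : a ∈ T.init.internal ∪ T.init.terminal) :
    T.freq ξ η a = T.init.freq ξ (fun k => η k.castSucc) a := by
  induction a with
  | nil => rfl
  | cons b a ih =>
    have h := mem_internal_of_cons_mem ha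
    have h1 := ih (Finset.mem_union_left _ h)
    obtain ⟨k, rfl⟩ := mem_internal.1 h
    have h2 := T.freq_child ξ η k.castSucc
    have h3 := T.init.freq_child ξ (fun k => η k.castSucc) k
    cases b
    · exact h2.1.trans h3.1.symm
    · refine h2.2.trans (Eq.trans ?_ h3.2.symm)
      exact congrArg (· - η k.castSucc) h1

theorem measurable_freq (T : OrderedTree j) (a : Node) :
    Measurable fun p : M.Freq × (Fin j → M.Freq) => T.freq p.1 p.2 a := by
  classical
  induction a with
  | nil => exact measurable_fst
  | cons b a ih =>
    simp only [freq]
    split_ifs with h hb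
    · exact ih.sub ((measurable_pi_apply _).comp measurable_snd)
    · exact (measurable_pi_apply _).comp measurable_snd
    · exact measurable_const

theorem measurable_freq_right (T : OrderedTree j) (ξ : M.Freq) (a : Node) :
    Measurable fun η : Fin j → M.Freq => T.freq ξ η a :=
  (T.measurable_freq a).comp measurable_prodMk_left

end OrderedTree

/-! ### Splitting off the last variable -/

theorem lintegral_snoc {j : ℕ} {g : (Fin (j + 1) → M.Freq) → ℝ≥0∞} (hg : Measurable g) :
    ∫⁻ η, g η = ∫⁻ η : Fin j → M.Freq, ∫⁻ c : M.Freq, g (Fin.snoc (α := fun _ => M.Freq) η c) := by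
  have h := (volume_preserving_piFinSuccAbove (fun _ : Fin (j + 1) => M.Freq) (Fin.last j)).symm
  rw [← h.lintegral_comp hg]
  have e : ∀ p : M.Freq × (Fin j → M.Freq),
      (MeasurableEquiv.piFinSuccAbove (fun _ : Fin (j + 1) => M.Freq) (Fin.last j)).symm p =
        Fin.snoc (α := fun _ => M.Freq) p.2 p.1 := by
    intro p
    change Fin.insertNth (α := fun _ => M.Freq) (Fin.last j) p.1 p.2 = _
    rw [Fin.insertNth_last']
  have hm : Measurable fun p : M.Freq × (Fin j → M.Freq) =>
      g (Fin.snoc (α := fun _ => M.Freq) p.2 p.1) := by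
    simp_rw [← e]
    exact hg.comp (MeasurableEquiv.measurable _)
  simp_rw [e]
  exact lintegral_prod_symm' _ hm

theorem lintegral_fin_zero (g : (Fin 0 → M.Freq) → ℝ≥0∞) : ∫⁻ η, g η = g default := by
  have : (volume : Measure (Fin 0 → M.Freq)) = Measure.dirac default :=
    Measure.pi_of_empty _ _
  rw [this, lintegral_dirac]

/-! ### Multilinear forms of trees and their recursion -/

namespace OrderedTree

variable {j : ℕ}

/-- Fubini in the last variable c: it occurs in κ and in the functions at the two newest leaves,
whose frequencies are c and the frequency of their parent minus c. All other factors come out of the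
inner integral. Allowing κ to depend on the earlier variables is what covers nearly resonant last
generations. -/
theorem lintegral_peel (T : OrderedTree (j + 1)) (ξ : M.Freq)
    {P : (Fin j → M.Freq) → ℝ≥0∞} (hP : Measurable P) {κ : (Fin j → M.Freq) → M.Freq → ℝ≥0∞}
    (hκ : Measurable (Function.uncurry κ)) {f : Node → M.Freq → ℝ≥0∞} (hf : ∀ a, Measurable (f a)) :
    ∫⁻ η : Fin (j + 1) → M.Freq, P (fun k => η k.castSucc) *
        (κ (fun k => η k.castSucc) (η (Fin.last j)) * ∏ a ∈ T.terminal, f a (T.freq ξ η a)) =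
      ∫⁻ η : Fin j → M.Freq, P η *
        ((∫⁻ c, κ η c * (f (false :: T.last) c *
          f (true :: T.last) (T.init.freq ξ η T.last - c))) *
            ∏ a ∈ T.init.terminal.erase T.last, f a (T.init.freq ξ η a)) := by
  have hi : Measurable fun η : Fin (j + 1) → M.Freq => fun k : Fin j => η k.castSucc := by fun_prop
  rw [lintegral_snoc]
  · refine lintegral_congr fun η => ?_
    have hκη : Measurable (κ η) := hκ.comp measurable_prodMk_left
    have hm : Measurable fun c => κ η c * (f (false :: T.last) c *
          f (true :: T.last) (T.init.freq ξ η T.last - c)) :=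
      hκη.mul (((hf _)).mul ((hf _).comp (measurable_const.sub measurable_id)))
    rw [← lintegral_mul_const _ hm, ← lintegral_const_mul _ (hm.mul_const _)]
    refine lintegral_congr fun c => ?_
    have e1 : (fun k : Fin j => (Fin.snoc (α := fun _ => M.Freq) η c : Fin (j + 1) → M.Freq)
        k.castSucc) = η := by funext k; simp
    have e2 : T.freq ξ (Fin.snoc (α := fun _ => M.Freq) η c) (false :: T.last) = c := by
      rw [last, (T.freq_child ξ _ (Fin.last j)).1]; simp
    have e3 : T.freq ξ (Fin.snoc (α := fun _ => M.Freq) η c) (true :: T.last) =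
        T.init.freq ξ η T.last - c := by
      rw [last, (T.freq_child ξ _ (Fin.last j)).2]
      have := T.freq_init ξ (Fin.snoc (α := fun _ => M.Freq) η c) T.last
        (Finset.mem_union_right _ T.last_mem_terminal_init)
      rw [e1] at this
      unfold last at this
      rw [this]; simp
    rw [e1, Fin.snoc_last, prod_terminal_succ, e2, e3]
    have e4 : ∏ a ∈ T.init.terminal.erase T.last,
        f a (T.freq ξ (Fin.snoc (α := fun _ => M.Freq) η c) a) =
        ∏ a ∈ T.init.terminal.erase T.last, f a (T.init.freq ξ η a) := by
      refine Finset.prod_congr rfl fun a ha => ?_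
      rw [T.freq_init ξ _ a (Finset.mem_union_right _ (Finset.mem_of_mem_erase ha)), e1]
    rw [e4]
    ring
  · refine (hP.comp hi).mul (Measurable.mul ?_ ?_)
    · exact hκ.comp (hi.prodMk (measurable_pi_apply _))
    · exact Finset.measurable_prod _ fun a _ => (hf a).comp (T.measurable_freq_right ξ a)

/-- The product of the kernels of all generations. -/
def kernelProd (T : OrderedTree j) (m : ℕ → ℝ) (ξ : M.Freq) (η : Fin j → M.Freq) : ℝ≥0∞ :=
  ∏ k : Fin j, kernel (m k) (T.freq ξ η (false :: T.branch k)) (T.freq ξ η (true :: T.branch k))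

theorem measurable_kernelProd (T : OrderedTree j) (m : ℕ → ℝ) (ξ : M.Freq) :
    Measurable (T.kernelProd m ξ) :=
  Finset.measurable_prod _ fun _ _ => measurable_kernel_comp _ (T.measurable_freq_right ξ _)
    (T.measurable_freq_right ξ _)

theorem kernelProd_init (T : OrderedTree (j + 1)) (m : ℕ → ℝ) (ξ : M.Freq)
    (η : Fin (j + 1) → M.Freq) :
    T.init.kernelProd m ξ (fun k => η k.castSucc) = ∏ k : Fin j, kernel (m k)
      (T.freq ξ η (false :: T.branch k.castSucc)) (T.freq ξ η (true :: T.branch k.castSucc)) := by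
  refine Finset.prod_congr rfl fun k _ => ?_
  have h1 := T.freq_child ξ η k.castSucc
  have h2 := T.init.freq_child ξ (fun k => η k.castSucc) k
  have h3 := T.freq_init ξ η (T.init.branch k)
    (Finset.mem_union_left _ (T.init.branch_mem_internal k))
  rw [h1.1, h1.2, h2.1, h2.2, ← h3]
  rfl

theorem freq_last (T : OrderedTree (j + 1)) (ξ : M.Freq) (η : Fin (j + 1) → M.Freq) :
    T.freq ξ η T.last = T.init.freq ξ (fun k => η k.castSucc) T.last :=
  T.freq_init ξ η T.last (Finset.mem_union_right _ T.last_mem_terminal_init)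

theorem freq_children_last (T : OrderedTree (j + 1)) (ξ : M.Freq) (η : Fin (j + 1) → M.Freq) :
    T.freq ξ η (false :: T.last) = η (Fin.last j) ∧ T.freq ξ η (true :: T.last) =
      T.init.freq ξ (fun k => η k.castSucc) T.last - η (Fin.last j) := by
  rw [← freq_last]
  exact T.freq_child ξ η (Fin.last j)

theorem kernelProd_succ (T : OrderedTree (j + 1)) (m : ℕ → ℝ) (ξ : M.Freq)
    (η : Fin (j + 1) → M.Freq) :
    T.kernelProd m ξ η = T.init.kernelProd m ξ (fun k => η k.castSucc) *
      kernel (m j) (η (Fin.last j)) (T.init.freq ξ (fun k => η k.castSucc) T.last - η (Fin.last j)) := by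
  have h := T.freq_children_last ξ η
  rw [kernelProd_init, kernelProd, Fin.prod_univ_castSucc, ← h.2, ← h.1]
  rfl

/-- The multilinear form of a tree whose generations all carry nonresonant kernels. -/
def treeForm (T : OrderedTree j) (m : ℕ → ℝ) (f : Node → M.Freq → ℝ≥0∞) (ξ : M.Freq) : ℝ≥0∞ :=
  ∫⁻ η, T.kernelProd m ξ η * ∏ a ∈ T.terminal, f a (T.freq ξ η a)

theorem treeForm_zero (T : OrderedTree 0) (m : ℕ → ℝ) (f : Node → M.Freq → ℝ≥0∞) (ξ : M.Freq) :
    T.treeForm m f ξ = f [] ξ := by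
  have h : T.internal = ∅ := by simp [internal]
  unfold treeForm kernelProd
  rw [lintegral_fin_zero]
  simp [terminal, h, freq]

theorem prod_update {s : Finset Node} {r : Node} (hr : r ∈ s) (f : Node → M.Freq → ℝ≥0∞)
    (φ : M.Freq → ℝ≥0∞) (x : Node → M.Freq) :
    ∏ a ∈ s, Function.update f r φ a (x a) = φ (x r) * ∏ a ∈ s.erase r, f a (x a) := by
  rw [← Finset.mul_prod_erase s _ hr, Function.update_self]
  congr 1
  refine Finset.prod_congr rfl fun a ha => ?_
  rw [Function.update_of_ne (Finset.ne_of_mem_erase ha)]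

theorem prod_sqNorm_update {s : Finset Node} {r : Node} (hr : r ∈ s) (f : Node → M.Freq → ℝ≥0∞)
    (φ : M.Freq → ℝ≥0∞) :
    ∏ a ∈ s, sqNorm (Function.update f r φ a) = sqNorm φ * ∏ a ∈ s.erase r, sqNorm (f a) := by
  rw [← Finset.mul_prod_erase s _ hr, Function.update_self]
  congr 1
  refine Finset.prod_congr rfl fun a ha => ?_
  rw [Function.update_of_ne (Finset.ne_of_mem_erase ha)]

theorem measurable_update {f : Node → M.Freq → ℝ≥0∞} (hf : ∀ a, Measurable (f a)) (r : Node)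
    {φ : M.Freq → ℝ≥0∞} (hφ : Measurable φ) (a : Node) : Measurable (Function.update f r φ a) := by
  rcases eq_or_ne a r with rfl | h
  · rwa [Function.update_self]
  · rw [Function.update_of_ne h]; exact hf a

theorem treeForm_update (T : OrderedTree j) (m : ℕ → ℝ) (f : Node → M.Freq → ℝ≥0∞)
    {r : Node} (hr : r ∈ T.terminal) (φ : M.Freq → ℝ≥0∞) (ξ : M.Freq) :
    T.treeForm m (Function.update f r φ) ξ =
      ∫⁻ η, T.kernelProd m ξ η *
        (φ (T.freq ξ η r) * ∏ a ∈ T.terminal.erase r, f a (T.freq ξ η a)) := by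
  refine lintegral_congr fun η => ?_
  rw [prod_update hr]

/-- Integrating out the last generation places the bilinear operator of its two leaf functions at
the parent, so a multilinear estimate is a bilinear one iterated. -/
theorem treeForm_succ (T : OrderedTree (j + 1)) (m : ℕ → ℝ) {f : Node → M.Freq → ℝ≥0∞}
    (hf : ∀ a, Measurable (f a)) (ξ : M.Freq) :
    T.treeForm m f ξ = T.init.treeForm m (Function.update f T.last
      (bil (m j) (f (false :: T.last)) (f (true :: T.last)))) ξ := by
  rw [treeForm_update _ _ _ T.last_mem_terminal_init]
  unfold treeForm bil
  rw [← T.lintegral_peel ξ (T.init.measurable_kernelProd m ξ)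
    (κ := fun η c => kernel (m j) c (T.init.freq ξ η T.last - c)) _ hf]
  · refine lintegral_congr fun η => ?_
    rw [kernelProd_succ, mul_assoc]
  · exact measurable_kernel_comp _ measurable_snd
      (((T.init.measurable_freq_right ξ _).comp measurable_fst).sub measurable_snd)

theorem sqNorm_treeForm_le (T : OrderedTree j) {m : ℕ → ℝ} (hm : ∀ k, 0 < m k)
    {f : Node → M.Freq → ℝ≥0∞} (hf : ∀ a, Measurable (f a)) :
    sqNorm (T.treeForm m f) ≤
      (∏ k ∈ Finset.range j, ENNReal.ofReal (80 / m k)) * ∏ a ∈ T.terminal, sqNorm (f a) := by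
  induction j generalizing f with
  | zero =>
    have h : T.internal = ∅ := by simp [internal]
    have : T.treeForm m f = f [] := funext fun ξ => T.treeForm_zero m f ξ
    rw [this]
    simp [terminal, h]
  | succ j ih =>
    have : T.treeForm m f = _ := funext fun ξ => T.treeForm_succ m hf ξ
    rw [this]
    refine (ih T.init (measurable_update hf _ (measurable_bil _ (hf _) (hf _)))).trans ?_
    rw [prod_sqNorm_update T.last_mem_terminal_init, prod_terminal_succ, Finset.prod_range_succ]
    calc _ ≤ (∏ k ∈ Finset.range j, ENNReal.ofReal (80 / m k)) *
          (ENNReal.ofReal (80 / m j) * (sqNorm (f (false :: T.last)) * sqNorm (f (true :: T.last))) *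
            ∏ a ∈ T.init.terminal.erase T.last, sqNorm (f a)) := by
          gcongr
          exact sqNorm_bil_le (hm j) (hf _) (hf _)
      _ = _ := by ring

end OrderedTree

/-! ### Pointwise bounds with linear growth -/

theorem sq_bil_le_of_sq_le_bracket {m : ℝ} (hm : 1 ≤ m) {f g : M.Freq → ℝ≥0∞} {A : ℝ≥0∞}
    (hg : Measurable g) (hfA : ∀ c, f c ^ 2 ≤ A * ENNReal.ofReal (bracket c ^ 2)) (z : M.Freq) :
    bil m f g z ^ 2 ≤
      ENNReal.ofReal (100 / Real.sqrt m) * (A * sqNorm g) * ENNReal.ofReal (bracket z ^ 2) := by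
  have hA : (A ^ (1 / 2 : ℝ)) ^ 2 = A := by
    rw [← ENNReal.rpow_two, ← ENNReal.rpow_mul]; norm_num
  have h := sq_bil_le_of_le_bracket (A := A ^ (1 / 2 : ℝ)) hm hg (f := f) ?_ z
  · rw [hA] at h
    rw [mul_comm _ (ENNReal.ofReal (bracket z ^ 2))]
    exact h
  · intro c
    have hb := one_le_bracket c
    have h1 := hfA c
    rw [ENNReal.ofReal_pow (by linarith), ← hA, ← mul_pow] at h1
    exact (ENNReal.pow_le_pow_left_iff (by norm_num)).1 h1

namespace OrderedTree

variable {j : ℕ}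

/-- Writing a missing factor as a factor 1 lets the recursion for products over all leaves be used
when one leaf is left out. -/
theorem prod_erase_eq {s : Finset Node} {r : Node} (hr : r ∈ s) (g : Node → ℝ≥0∞) :
    ∏ a ∈ s.erase r, g a = ∏ a ∈ s, Function.update g r 1 a := by
  rw [Finset.prod_update_of_mem hr, one_mul, Finset.sdiff_singleton_eq_erase]

/-- One distinguished leaf grows linearly, the others are in L². If the last generation contains
that leaf, its parent inherits the growth and becomes the distinguished leaf of the truncated tree.
If not, the L² bilinear estimate applies, and its constant 80/m is below 100/√m. At the end only the
root is left and the growth is in ξ. -/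
theorem sq_treeForm_le_of_growth (T : OrderedTree j) {m : ℕ → ℝ} (hm : ∀ k, 1 ≤ m k)
    {f : Node → M.Freq → ℝ≥0∞} (hf : ∀ a, Measurable (f a)) {a₀ : Node} (ha₀ : a₀ ∈ T.terminal)
    {A : ℝ≥0∞} (hA : ∀ c, f a₀ c ^ 2 ≤ A * ENNReal.ofReal (bracket c ^ 2)) (ξ : M.Freq) :
    T.treeForm m f ξ ^ 2 ≤ (∏ k ∈ Finset.range j, ENNReal.ofReal (100 / Real.sqrt (m k))) *
      (A * ∏ a ∈ T.terminal.erase a₀, sqNorm (f a)) * ENNReal.ofReal (bracket ξ ^ 2) := by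
  induction j generalizing f a₀ A with
  | zero =>
    have h : T.internal = ∅ := by simp [internal]
    have h' : a₀ = [] := by simpa [terminal, h] using ha₀
    rw [treeForm_zero, h']
    simp only [Finset.range_zero, Finset.prod_empty, one_mul, terminal, h, Finset.image_empty,
      Finset.union_idempotent, Finset.sdiff_empty, insert_empty_eq, Finset.erase_singleton, mul_one]
    rw [← h']; exact hA ξ
  | succ j ih =>
    have hlast := T.last_mem_terminal_init
    set r := T.last with hr
    set D := ENNReal.ofReal (100 / Real.sqrt (m j)) with hD
    rw [treeForm_succ _ _ hf, Finset.prod_range_succ]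
    have hmu := measurable_update hf r (measurable_bil (m j) (hf (false :: r)) (hf (true :: r)))
    have herase : ∀ φ : M.Freq → ℝ≥0∞, ∏ a ∈ T.init.terminal.erase r,
        sqNorm (Function.update f r φ a) = ∏ a ∈ T.init.terminal.erase r, sqNorm (f a) := by
      intro φ
      refine Finset.prod_congr rfl fun a ha => ?_
      rw [Function.update_of_ne (Finset.ne_of_mem_erase ha)]
    have hne : ∀ b : Bool, ∀ a ∈ T.init.terminal.erase r, a ≠ b :: r := by
      rintro b a ha rfl
      exact T.child_notMem_terminal_init b (Finset.mem_of_mem_erase ha)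
    have hprod : ∀ b : Bool, ∏ a ∈ T.init.terminal.erase r,
        Function.update (fun a => sqNorm (f a)) (b :: r) 1 a =
          ∏ a ∈ T.init.terminal.erase r, sqNorm (f a) := by
      intro b
      refine Finset.prod_congr rfl fun a ha => ?_
      rw [Function.update_of_ne (hne b a ha)]
    rw [prod_erase_eq ha₀, prod_terminal_succ]
    rw [terminal_succ] at ha₀
    rcases Finset.mem_insert.1 ha₀ with rfl | ha₀
    · have h1 := ih T.init hmu hlast (A := D * (A * sqNorm (f (true :: r)))) (by
        intro c
        rw [Function.update_self]
        exact sq_bil_le_of_sq_le_bracket (hm j) (hf _) hA c)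
      rw [herase] at h1
      rw [Function.update_self, Function.update_of_ne (by simp), hprod]
      refine h1.trans (le_of_eq ?_)
      ring
    rcases Finset.mem_insert.1 ha₀ with rfl | ha₀
    · have h1 := ih T.init hmu hlast (A := D * (A * sqNorm (f (false :: r)))) (by
        intro c
        rw [Function.update_self, bil_comm]
        exact sq_bil_le_of_sq_le_bracket (hm j) (hf _) hA c)
      rw [herase] at h1
      rw [Function.update_self, Function.update_of_ne (by simp), hprod]
      refine h1.trans (le_of_eq ?_)
      ring
    · have har := Finset.ne_of_mem_erase ha₀
      have h1 := ih T.init hmu (Finset.mem_of_mem_erase ha₀) (A := A) (by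
        intro c
        rw [Function.update_of_ne har]
        exact hA c)
      rw [prod_sqNorm_update (Finset.mem_erase.2 ⟨har.symm, hlast⟩)] at h1
      rw [Function.update_of_ne (hne _ _ ha₀).symm, Function.update_of_ne (hne _ _ ha₀).symm,
        ← prod_erase_eq ha₀, Finset.erase_right_comm]
      refine h1.trans ?_
      have h2 : sqNorm (bil (m j) (f (false :: r)) (f (true :: r))) ≤
          D * (sqNorm (f (false :: r)) * sqNorm (f (true :: r))) := by
        refine (sqNorm_bil_le (by linarith [hm j]) (hf _) (hf _)).trans ?_
        refine mul_le_mul_left (ENNReal.ofReal_le_ofReal ?_) _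
        have h3 := hm j
        have h4 : Real.sqrt (m j) ≤ m j := by
          rw [Real.sqrt_le_left (by linarith)]; nlinarith
        have h5 : 0 < Real.sqrt (m j) := Real.sqrt_pos.2 (by linarith)
        rw [div_le_div_iff₀ (by linarith) h5]
        linarith
      calc _ ≤ (∏ k ∈ Finset.range j, ENNReal.ofReal (100 / Real.sqrt (m k))) *
            (A * (D * (sqNorm (f (false :: r)) * sqNorm (f (true :: r))) *
              ∏ a ∈ (T.init.terminal.erase a₀).erase r, sqNorm (f a))) *
                ENNReal.ofReal (bracket ξ ^ 2) := by gcongr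
        _ = _ := by ring

/-- The multilinear form of a tree whose last generation carries no kernel other than the
derivative weight. -/
def freeForm (T : OrderedTree (j + 1)) (m : ℕ → ℝ) (f : Node → M.Freq → ℝ≥0∞) (ξ : M.Freq) :
    ℝ≥0∞ :=
  ∫⁻ η, T.init.kernelProd m ξ (fun k => η k.castSucc) *
    (ENNReal.ofReal (M.mag (T.init.freq ξ (fun k => η k.castSucc) T.last)) *
      ∏ a ∈ T.terminal, f a (T.freq ξ η a))

/-- A convolution of two L² functions is bounded, so the last root carries a function φ with φ(x) ≤
|x| ‖f‖‖g‖; this root is the distinguished leaf of the truncated tree. -/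
theorem sq_freeForm_le (T : OrderedTree (j + 1)) {m : ℕ → ℝ} (hm : ∀ k, 1 ≤ m k)
    {f : Node → M.Freq → ℝ≥0∞} (hf : ∀ a, Measurable (f a)) (ξ : M.Freq) :
    T.freeForm m f ξ ^ 2 ≤ (∏ k ∈ Finset.range j, ENNReal.ofReal (100 / Real.sqrt (m k))) *
      (∏ a ∈ T.terminal, sqNorm (f a)) * ENNReal.ofReal (bracket ξ ^ 2) := by
  set r := T.last
  set φ : M.Freq → ℝ≥0∞ := fun x => ENNReal.ofReal (M.mag x) *
    ∫⁻ c, f (false :: r) c * f (true :: r) (x - c) with hφ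
  have hφm : Measurable φ := by
    refine measurable_mag.ennreal_ofReal.mul ?_
    exact Measurable.lintegral_prod_right'
      (f := fun p : M.Freq × M.Freq => f (false :: r) p.2 * f (true :: r) (p.1 - p.2))
      (((hf _).comp measurable_snd).mul ((hf _).comp (measurable_fst.sub measurable_snd)))
  have h1 : T.freeForm m f ξ = T.init.treeForm m (Function.update f r φ) ξ := by
    rw [treeForm_update _ _ _ T.last_mem_terminal_init]
    unfold freeForm
    rw [T.lintegral_peel ξ (T.init.measurable_kernelProd m ξ)
      (κ := fun η _ => ENNReal.ofReal (M.mag (T.init.freq ξ η T.last))) _ hf]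
    · refine lintegral_congr fun η => ?_
      rw [lintegral_const_mul]
      exact (hf _).mul ((hf _).comp (measurable_const.sub measurable_id))
    · exact ((measurable_mag.comp (T.init.measurable_freq_right ξ _)).comp
        measurable_fst).ennreal_ofReal
  rw [h1]
  refine (T.init.sq_treeForm_le_of_growth hm (measurable_update hf r hφm)
    T.last_mem_terminal_init (A := sqNorm (f (false :: r)) * sqNorm (f (true :: r))) ?_ ξ).trans ?_
  · intro c
    rw [Function.update_self, hφ]
    simp only
    rw [mul_pow, mul_comm]
    refine mul_le_mul' (lintegral_mul_reflect_sq_le (hf _) (hf _) c) ?_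
    rw [← ENNReal.ofReal_pow (mag_nonneg c)]
    exact ENNReal.ofReal_le_ofReal (pow_le_pow_left₀ (mag_nonneg c) (le_max_right _ _) 2)
  · rw [prod_terminal_succ]
    have : ∏ a ∈ T.init.terminal.erase r, sqNorm (Function.update f r φ a) =
        ∏ a ∈ T.init.terminal.erase r, sqNorm (f a) := by
      refine Finset.prod_congr rfl fun a ha => ?_
      rw [Function.update_of_ne (Finset.ne_of_mem_erase ha)]
    rw [this, mul_assoc (sqNorm _)]

/-! ### Trees ending in a nonresonant and a nearly resonant generation -/

/-- The multilinear form of a tree whose last generation is nearly resonant relative to the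
preceding one. -/
def nearForm (T : OrderedTree (j + 2)) (m : ℕ → ℝ) (J : ℝ) (f : Node → M.Freq → ℝ≥0∞)
    (ξ : M.Freq) : ℝ≥0∞ :=
  ∫⁻ η, T.init.kernelProd m ξ (fun k => η k.castSucc) *
    (resKernel (J * trip (T.init.freq ξ (fun k => η k.castSucc) (false :: T.init.last))
        (T.init.freq ξ (fun k => η k.castSucc) (true :: T.init.last)))
      (η (Fin.last _)) (T.init.freq ξ (fun k => η k.castSucc) T.last - η (Fin.last _)) *
      ∏ a ∈ T.terminal, f a (T.freq ξ η a))

theorem measurable_resBil_comp {α : Type*} [MeasurableSpace α] {L : α → ℝ} {x : α → M.Freq}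
    (hL : Measurable L) (hx : Measurable x) {f g : M.Freq → ℝ≥0∞} (hf : Measurable f)
    (hg : Measurable g) : Measurable fun a => resBil (L a) f g (x a) := by
  have h : Measurable fun p : α × M.Freq => resKernel (L p.1) p.2 (x p.1 - p.2) *
      (f p.2 * g (x p.1 - p.2)) :=
    (measurable_resKernel_comp (hL.comp measurable_fst) measurable_snd
      ((hx.comp measurable_fst).sub measurable_snd)).mul
      ((hf.comp measurable_snd).mul (hg.comp ((hx.comp measurable_fst).sub measurable_snd)))
  exact h.lintegral_prod_right'

/-- Only the last variable is integrated out here. The resulting function at `T.last` has a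
threshold involving the preceding variable, so it cannot be treated as a leaf function: it stays in
the kernel, and the leaf itself receives the constant function 1. -/
theorem nearForm_eq (T : OrderedTree (j + 2)) (m : ℕ → ℝ) (J : ℝ) {f : Node → M.Freq → ℝ≥0∞}
    (hf : ∀ a, Measurable (f a)) (ξ : M.Freq) :
    T.nearForm m J f ξ = ∫⁻ η, T.init.init.kernelProd m ξ (fun k => η k.castSucc) *
      (kernel (m j) (η (Fin.last j))
          (T.init.init.freq ξ (fun k => η k.castSucc) T.init.last - η (Fin.last j)) *
        resBil (J * trip (η (Fin.last j))
          (T.init.init.freq ξ (fun k => η k.castSucc) T.init.last - η (Fin.last j)))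
          (f (false :: T.last)) (f (true :: T.last)) (T.init.freq ξ η T.last) *
        ∏ a ∈ T.init.terminal, Function.update f T.last (fun _ => 1) a (T.init.freq ξ η a)) := by
  unfold nearForm
  rw [T.lintegral_peel ξ (T.init.measurable_kernelProd m ξ)
    (κ := fun η c => resKernel (J * trip (T.init.freq ξ η (false :: T.init.last))
        (T.init.freq ξ η (true :: T.init.last))) c (T.init.freq ξ η T.last - c)) _ hf]
  · refine lintegral_congr fun η => ?_
    have h1 := T.init.freq_child ξ η (Fin.last j)
    have h3 := T.init.freq_init ξ η T.init.last
      (Finset.mem_union_right _ T.init.last_mem_terminal_init)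
    have e1 : T.init.freq ξ η (false :: T.init.last) = η (Fin.last j) := h1.1
    have e2 : T.init.freq ξ η (true :: T.init.last) =
        T.init.init.freq ξ (fun k => η k.castSucc) T.init.last - η (Fin.last j) :=
      h1.2.trans (congrArg (· - η (Fin.last j)) h3)
    rw [kernelProd_succ, prod_update T.last_mem_terminal_init, one_mul, e1, e2]
    unfold resBil
    ring
  · refine measurable_resKernel_comp ?_ measurable_snd
      (((T.init.measurable_freq_right ξ _).comp measurable_fst).sub measurable_snd)
    exact ((measurable_trip_comp (T.init.measurable_freq_right ξ _)
      (T.init.measurable_freq_right ξ _)).comp measurable_fst).const_mul J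

/-- The last root r is the left child of the preceding root q, the right child, or a leaf untouched
by that generation. In the first two cases the two generations form a trilinear operator at q,
estimated by `sqNorm_nestForm_le`. In the third, `sq_pairForm_le` separates them into functions of
the frequencies at q and at r. In each case a purely nonresonant tree of j generations is left. -/
theorem sqNorm_nearForm_le (T : OrderedTree (j + 2)) {m : ℕ → ℝ} (hm : ∀ k, 0 < m k) {J : ℝ}
    (hJ : 1 ≤ J) {f : Node → M.Freq → ℝ≥0∞} (hf : ∀ a, Measurable (f a)) :
    sqNorm (T.nearForm m J f) ≤ ENNReal.ofReal (2000 * J) *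
      ((∏ k ∈ Finset.range j, ENNReal.ofReal (80 / m k)) * ∏ a ∈ T.terminal, sqNorm (f a)) := by
  have hJ0 : 0 < J := by linarith
  set r := T.last with hr
  set q := T.init.last with hq
  set R := T.init.init with hR
  have hrS : r ∈ T.init.terminal := T.last_mem_terminal_init
  have hqR : q ∈ R.terminal := T.init.last_mem_terminal_init
  have hne : ∀ b : Bool, ∀ a ∈ R.terminal.erase q, a ≠ b :: q := by
    rintro b a ha rfl
    exact T.init.child_notMem_terminal_init b (Finset.mem_of_mem_erase ha)
  set f' := Function.update f r (fun _ => 1) with hf'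
  have hf'm : ∀ a, Measurable (f' a) := measurable_update hf r measurable_const
  have hg : ∏ a ∈ T.terminal, sqNorm (f a) = sqNorm (f (false :: r)) * (sqNorm (f (true :: r)) *
      (Function.update (fun a => sqNorm (f a)) r 1 (false :: q) *
        (Function.update (fun a => sqNorm (f a)) r 1 (true :: q) *
        ∏ a ∈ R.terminal.erase q, Function.update (fun a => sqNorm (f a)) r 1 a))) := by
    rw [prod_terminal_succ, prod_erase_eq hrS, prod_terminal_succ T.init]
  have hsplit : r = false :: q ∨ r = true :: q ∨ r ∈ R.terminal.erase q := by
    have := hrS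
    rw [terminal_succ] at this
    simpa only [Finset.mem_insert] using this
  have hP := R.measurable_kernelProd (M := M) m
  have hκ : ∀ {x : (Fin j → M.Freq) × M.Freq → M.Freq}, Measurable x → ∀ ξ, Measurable
      (Function.uncurry fun (η : Fin j → M.Freq) (c : M.Freq) =>
        kernel (m j) c (R.freq ξ η q - c) * resBil (J * trip c (R.freq ξ η q - c))
          (f (false :: r)) (f (true :: r)) (x (η, c))) := by
    intro x hx ξ
    have hs : Measurable fun p : (Fin j → M.Freq) × M.Freq => R.freq ξ p.1 q - p.2 :=
      ((R.measurable_freq_right ξ q).comp measurable_fst).sub measurable_snd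
    exact (measurable_kernel_comp _ measurable_snd hs).mul (measurable_resBil_comp
      ((measurable_trip_comp measurable_snd hs).const_mul J) hx (hf _) (hf _))
  -- the case in which the last root is a child of the preceding one
  have hchild : ∀ b : Bool, r = b :: q → (∀ ξ, T.nearForm m J f ξ = R.treeForm m
      (Function.update f' q (nestForm (m j) J (f ((!b) :: q)) (f (false :: r)) (f (true :: r)))) ξ) →
      sqNorm (T.nearForm m J f) ≤ ENNReal.ofReal (2000 * J) *
      ((∏ k ∈ Finset.range j, ENNReal.ofReal (80 / m k)) * ∏ a ∈ T.terminal, sqNorm (f a)) := by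
    intro b hb h
    have hnm : Measurable (nestForm (m j) J (f ((!b) :: q)) (f (false :: r)) (f (true :: r))) := by
      have h1 : Measurable fun p : M.Freq × M.Freq => kernel (m j) p.2 (p.1 - p.2) *
          (f ((!b) :: q) p.2 * resBil (J * trip p.2 (p.1 - p.2)) (f (false :: r)) (f (true :: r))
            (p.1 - p.2)) := by
        have hs : Measurable fun p : M.Freq × M.Freq => p.1 - p.2 := measurable_fst.sub measurable_snd
        exact (measurable_kernel_comp _ measurable_snd hs).mul (((hf _).comp measurable_snd).mul
          (measurable_resBil_comp ((measurable_trip_comp measurable_snd hs).const_mul J) hs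
            (hf _) (hf _)))
      exact h1.lintegral_prod_right'
    have h2 : sqNorm (T.nearForm m J f) = sqNorm (R.treeForm m (Function.update f' q
        (nestForm (m j) J (f ((!b) :: q)) (f (false :: r)) (f (true :: r))))) := by
      unfold sqNorm; simp_rw [h]
    rw [h2]
    refine (R.sqNorm_treeForm_le hm (measurable_update hf'm q hnm)).trans ?_
    rw [prod_sqNorm_update hqR, hg]
    have h3 : ∏ a ∈ R.terminal.erase q, sqNorm (f' a) =
        ∏ a ∈ R.terminal.erase q, Function.update (fun a => sqNorm (f a)) r 1 a := by
      refine Finset.prod_congr rfl fun a ha => ?_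
      have : a ≠ r := hb ▸ hne b a ha
      rw [Function.update_of_ne this, hf', Function.update_of_ne this]
    have h4 : Function.update (fun a => sqNorm (f a)) r 1 (false :: q) *
        Function.update (fun a => sqNorm (f a)) r 1 (true :: q) = sqNorm (f ((!b) :: q)) := by
      rw [hb]; cases b <;> simp [Function.update]
    rw [h3, ← mul_assoc (Function.update _ _ _ (false :: q)), h4]
    calc _ ≤ (∏ k ∈ Finset.range j, ENNReal.ofReal (80 / m k)) *
          (ENNReal.ofReal (2000 * J) * (sqNorm (f ((!b) :: q)) *
            (sqNorm (f (false :: r)) * sqNorm (f (true :: r)))) *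
            ∏ a ∈ R.terminal.erase q, Function.update (fun a => sqNorm (f a)) r 1 a) := by
          gcongr
          exact sqNorm_nestForm_le (hm j) hJ (hf _) (hf _) (hf _)
      _ = _ := by ring
  have hnear := fun ξ => T.nearForm_eq m J hf ξ
  have hfc := fun ξ (η : Fin (j + 1) → M.Freq) => T.init.freq_child ξ η (Fin.last j)
  have hfi := fun ξ (η : Fin (j + 1) → M.Freq) => T.init.freq_init ξ η q
      (Finset.mem_union_right _ T.init.last_mem_terminal_init)
  rcases hsplit with hb | hb | hb
  · refine hchild false hb fun ξ => ?_
    rw [hnear, treeForm_update _ _ _ hqR]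
    have e : ∀ η : Fin (j + 1) → M.Freq, T.init.freq ξ η r = η (Fin.last j) := fun η => by
      rw [hb]; exact (hfc ξ η).1
    simp_rw [← hr, ← hq, e]
    rw [T.init.lintegral_peel ξ (hP ξ) (hκ (x := fun p => p.2) measurable_snd ξ) hf'm]
    refine lintegral_congr fun η => ?_
    congr 2
    unfold nestForm
    -- The trilinear operator has the subdivided child as second argument. For a left child the
    -- reflection of the integration variable, under which the kernel is symmetric, brings it there.
    rw [← lintegral_sub_left_eq_self _ (R.freq ξ η q)]
    refine lintegral_congr fun c => ?_
    have h1 : f' (false :: q) = fun _ => 1 := by rw [hf', hb, Function.update_self]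
    have h2 : f' (true :: q) = f (true :: q) := by
      rw [hf', hb, Function.update_of_ne (by simp)]
    rw [← hq, h1, h2, sub_sub_cancel, kernel_comm, trip_comm]
    simp only [Bool.not_false]
    ring
  · refine hchild true hb fun ξ => ?_
    rw [hnear, treeForm_update _ _ _ hqR]
    have e : ∀ η : Fin (j + 1) → M.Freq, T.init.freq ξ η r =
        R.freq ξ (fun k => η k.castSucc) q - η (Fin.last j) := fun η => by
      rw [hb, ← hfi]; exact (hfc ξ η).2
    simp_rw [← hr, ← hq, e]
    rw [T.init.lintegral_peel ξ (hP ξ) (hκ (x := fun p => R.freq ξ p.1 q - p.2)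
      (((R.measurable_freq_right ξ q).comp measurable_fst).sub measurable_snd) ξ) hf'm]
    refine lintegral_congr fun η => ?_
    congr 2
    unfold nestForm
    refine lintegral_congr fun c => ?_
    have h1 : f' (true :: q) = fun _ => 1 := by rw [hf', hb, Function.update_self]
    have h2 : f' (false :: q) = f (false :: q) := by
      rw [hf', hb, Function.update_of_ne (by simp)]
    rw [← hq, h1, h2]
    simp only [Bool.not_true]
    ring
  · -- the last two roots have disjoint sets of children
    have hrR := Finset.mem_of_mem_erase hb
    -- Q and H are square roots of convolutions of squares, as they come out of the pair estimate;
    -- their L² norms are the products of the norms of the two leaf functions, so nothing is lost by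
    -- placing them at q and r.
    set Q : M.Freq → ℝ≥0∞ := fun z =>
      (∫⁻ e, (f (false :: q) e * f (true :: q) (z - e)) ^ 2) ^ (1 / 2 : ℝ) with hQ
    set H : M.Freq → ℝ≥0∞ := fun z =>
      (∫⁻ e, (f (false :: r) e * f (true :: r) (z - e)) ^ 2) ^ (1 / 2 : ℝ) with hH
    have hmeas : ∀ a b, Measurable fun z : M.Freq =>
        (∫⁻ e, (f a e * f b (z - e)) ^ 2) ^ (1 / 2 : ℝ) := by
      intro a b
      refine Measurable.pow_const ?_ _
      exact Measurable.lintegral_prod_right'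
        (f := fun p : M.Freq × M.Freq => (f a p.2 * f b (p.1 - p.2)) ^ 2)
        ((((hf a).comp measurable_snd).mul
          ((hf b).comp (measurable_fst.sub measurable_snd))).pow_const 2)
    have hsq : ∀ x : ℝ≥0∞, (x ^ (1 / 2 : ℝ)) ^ 2 = x := fun x => by
      rw [← ENNReal.rpow_two, ← ENNReal.rpow_mul]; norm_num
    have hQn : sqNorm Q = sqNorm (f (false :: q)) * sqNorm (f (true :: q)) := by
      rw [← lintegral_convolution_sq (hf _) (hf _)]
      unfold sqNorm; simp_rw [hQ, hsq]
    have hHn : sqNorm H = sqNorm (f (false :: r)) * sqNorm (f (true :: r)) := by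
      rw [← lintegral_convolution_sq (hf _) (hf _)]
      unfold sqNorm; simp_rw [hH, hsq]
    set c₀ := ENNReal.ofReal (2000 * J) ^ (1 / 2 : ℝ) with hc₀
    set g := Function.update (Function.update f r H) q Q with hgdef
    have hgm : ∀ a, Measurable (g a) :=
      measurable_update (measurable_update hf r (hmeas _ _)) q (hmeas _ _)
    have hle : ∀ ξ, T.nearForm m J f ξ ≤ c₀ * R.treeForm m g ξ := by
      intro ξ
      rw [hnear, hgdef, treeForm_update _ _ _ hqR]
      have e : ∀ η : Fin (j + 1) → M.Freq, T.init.freq ξ η r =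
          R.freq ξ (fun k => η k.castSucc) r := fun η =>
        T.init.freq_init ξ η r (Finset.mem_union_right _ hrR)
      simp_rw [← hr, ← hq, e]
      rw [T.init.lintegral_peel ξ (hP ξ) (hκ (x := fun p => R.freq ξ p.1 r)
        ((R.measurable_freq_right ξ r).comp measurable_fst) ξ) hf'm, ← lintegral_const_mul']
      · refine lintegral_mono fun η => ?_
        have h1 : ∀ b : Bool, f' (b :: q) = f (b :: q) := fun b => by
          rw [hf', Function.update_of_ne (hne b r hb).symm]
        have h2 : ∏ a ∈ R.terminal.erase q, f' a (R.freq ξ η a) =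
            ∏ a ∈ (R.terminal.erase q).erase r, f a (R.freq ξ η a) := by
          rw [hf', prod_update hb, one_mul]
        have h3 : ∏ a ∈ R.terminal.erase q, Function.update f r H a (R.freq ξ η a) =
            H (R.freq ξ η r) * ∏ a ∈ (R.terminal.erase q).erase r, f a (R.freq ξ η a) := by
          rw [prod_update hb]
        have h4 : (∫⁻ c, kernel (m j) c (R.freq ξ η q - c) *
            resBil (J * trip c (R.freq ξ η q - c)) (f (false :: r)) (f (true :: r)) (R.freq ξ η r) *
            (f' (false :: q) c * f' (true :: q) (R.freq ξ η q - c))) ≤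
            c₀ * (Q (R.freq ξ η q) * H (R.freq ξ η r)) := by
          have h5 := sq_pairForm_le hJ0 (m j) (hf (false :: q)) (hf (true :: q)) (hf (false :: r))
            (hf (true :: r)) (R.freq ξ η q) (R.freq ξ η r)
          have h6 : (c₀ * (Q (R.freq ξ η q) * H (R.freq ξ η r))) ^ 2 =
              ENNReal.ofReal (2000 * J) *
                ((∫⁻ e, (f (false :: q) e * f (true :: q) (R.freq ξ η q - e)) ^ 2) *
                  ∫⁻ c, (f (false :: r) c * f (true :: r) (R.freq ξ η r - c)) ^ 2) := by
            rw [mul_pow, mul_pow, hc₀, hQ, hH, hsq, hsq, hsq]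
          rw [← h6] at h5
          refine le_trans (le_of_eq ?_) ((ENNReal.pow_le_pow_left_iff (by norm_num)).1 h5)
          unfold pairForm
          refine lintegral_congr fun c => ?_
          rw [h1, h1]; ring
        rw [← hq, h2, h3]
        calc _ ≤ R.kernelProd m ξ η * (c₀ * (Q (R.freq ξ η q) * H (R.freq ξ η r)) *
              ∏ a ∈ (R.terminal.erase q).erase r, f a (R.freq ξ η a)) := by
              gcongr
          _ = _ := by ring
      · exact ENNReal.rpow_ne_top_of_nonneg (by norm_num) ENNReal.ofReal_ne_top
    calc sqNorm (T.nearForm m J f) ≤ ∫⁻ ξ, (c₀ * R.treeForm m g ξ) ^ 2 :=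
          lintegral_mono fun ξ => pow_le_pow_left' (hle ξ) 2
      _ = ENNReal.ofReal (2000 * J) * sqNorm (R.treeForm m g) := by
          simp_rw [mul_pow, hc₀, hsq]
          rw [lintegral_const_mul' _ _ ENNReal.ofReal_ne_top]
          rfl
      _ ≤ _ := by
          refine mul_le_mul_right ((R.sqNorm_treeForm_le hm hgm).trans (le_of_eq ?_)) _
          rw [hg, hgdef, prod_sqNorm_update hqR, prod_sqNorm_update hb, hQn, hHn,
            Function.update_of_ne (hne _ r hb).symm, Function.update_of_ne (hne _ r hb).symm,
            ← prod_erase_eq hb]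
          ring

end OrderedTree

/-! ### Measurability of the integrands -/

theorem measurable_hat (u : M.L2) : Measurable (hat M u) := by
  cases M
  · exact measurable_from_top (α := ℤ)
  · refine Measurable.const_mul ?_ _
    exact (Lp.stronglyMeasurable (Lp.fourierTransformₗᵢ ℝ ℂ u)).measurable.comp
      ((measurable_id (α := ℝ)).div_const _)

theorem measurable_symbolILW (δ : ℝ) : Measurable (symbolILW δ) := by
  refine Measurable.ite (measurableSet_singleton (0 : ℝ)) measurable_const ?_
  have h1 : Measurable fun ξ : ℝ => Real.cosh (δ * ξ) :=
    Real.continuous_cosh.measurable.comp (measurable_id.const_mul δ)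
  have h2 : Measurable fun ξ : ℝ => Real.sinh (δ * ξ) :=
    Real.continuous_sinh.measurable.comp (measurable_id.const_mul δ)
  exact ((measurable_id.mul (h1.div h2)).sub_const _).const_mul _

namespace OrderedTree

variable {j : ℕ} (T : OrderedTree j)

theorem measurable_gen (k : ℕ) :
    Measurable fun p : M.Freq × (Fin j → M.Freq) => T.gen p.1 p.2 k :=
  measurable_toReal.comp (T.measurable_freq _)

theorem measurable_gen₁ (k : ℕ) :
    Measurable fun p : M.Freq × (Fin j → M.Freq) => T.gen₁ p.1 p.2 k :=
  measurable_toReal.comp (T.measurable_freq _)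

theorem measurable_gen₂ (k : ℕ) :
    Measurable fun p : M.Freq × (Fin j → M.Freq) => T.gen₂ p.1 p.2 k :=
  measurable_toReal.comp (T.measurable_freq _)

theorem measurable_muTilde (k : ℕ) :
    Measurable fun p : M.Freq × (Fin j → M.Freq) => T.muTilde p.1 p.2 k := by
  refine Finset.measurable_sum _ fun k _ => ?_
  exact (((T.measurable_gen k).pow_const 3).neg.add ((T.measurable_gen₁ k).pow_const 3)).add
    ((T.measurable_gen₂ k).pow_const 3)

theorem measurableSet_isIndex :
    MeasurableSet {p : M.Freq × (Fin j → M.Freq) | T.IsIndex p.1 p.2} := by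
  simp only [IsIndex, Set.ofPred_forall]
  refine Finset.measurableSet_biInter _ fun a _ => ?_
  exact T.measurable_freq a measurableSet_freqStar

theorem measurableSet_nearRes (K : ℝ) (k : ℕ) :
    MeasurableSet {p : M.Freq × (Fin j → M.Freq) | T.NearRes p.1 p.2 K k} := by
  unfold NearRes
  split_ifs
  · exact measurableSet_le (T.measurable_muTilde 1).abs measurable_const
  · exact measurableSet_le (T.measurable_muTilde k).abs
      ((T.measurable_muTilde (k - 1)).abs.const_mul _)

theorem measurableSet_nonRes (K : ℝ) (m : ℕ) :
    MeasurableSet {p : M.Freq × (Fin j → M.Freq) | T.NonRes p.1 p.2 K m} := by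
  simp only [NonRes, Set.ofPred_forall]
  refine Finset.measurableSet_biInter _ fun k _ => ?_
  exact (T.measurableSet_nearRes K k).compl

theorem measurable_phase (t : ℝ) (m : ℕ) :
    Measurable fun p : M.Freq × (Fin j → M.Freq) => T.phase p.1 p.2 t m :=
  (((T.measurable_muTilde m).const_mul t).complex_ofReal.const_mul _).cexp

theorem measurable_weight (m : ℕ) :
    Measurable fun p : M.Freq × (Fin j → M.Freq) => T.weight p.1 p.2 m :=
  ((Finset.measurable_prod _ fun k _ => T.measurable_gen k).div
    (Finset.measurable_prod _ fun k _ => T.measurable_muTilde k)).complex_ofReal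

theorem measurable_leafProd (u : M.L2) :
    Measurable fun p : M.Freq × (Fin j → M.Freq) => T.leafProd p.1 p.2 u :=
  Finset.measurable_prod _ fun a _ => (measurable_hat u).comp (T.measurable_freq a)

theorem measurable_phaseDiff (δ t : ℝ) (k : ℕ) : Measurable fun p : M.Freq × (Fin j → M.Freq) =>
    phaseDiff δ t (T.gen p.1 p.2 k) (T.gen₁ p.1 p.2 k) (T.gen₂ p.1 p.2 k) := by
  have hs := measurable_symbolILW δ
  have h0 := T.measurable_gen (M := M) k
  have h1 := T.measurable_gen₁ (M := M) k
  have h2 := T.measurable_gen₂ (M := M) k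
  refine Measurable.sub ?_ ?_
  · have : Measurable fun p : M.Freq × (Fin j → M.Freq) =>
        resILW δ (T.gen p.1 p.2 k) (T.gen₁ p.1 p.2 k) (T.gen₂ p.1 p.2 k) :=
      ((h0.mul (hs.comp h0)).neg.add (h1.mul (hs.comp h1))).add (h2.mul (hs.comp h2))
    exact ((this.const_mul t).complex_ofReal.const_mul _).cexp
  · have : Measurable fun p : M.Freq × (Fin j → M.Freq) =>
        resKdV (T.gen p.1 p.2 k) (T.gen₁ p.1 p.2 k) (T.gen₂ p.1 p.2 k) :=
      ((h0.pow_const 3).neg.add (h1.pow_const 3)).add (h2.pow_const 3)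
    exact ((this.const_mul t).complex_ofReal.const_mul _).cexp

end OrderedTree

/-! ### The coefficients of the four operators -/

namespace OrderedTree

variable {j : ℕ} (T : OrderedTree j) (K t : ℝ)

/-- The coefficient of `û ⊗ ⋯ ⊗ û` in `integrandN0`. -/
def coefN0 (ξ : M.Freq) : (Fin j → M.Freq) → ℂ :=
  Set.indicator {η | T.IsIndex ξ η ∧ T.NonRes ξ η K j}
    fun η => T.phase ξ η t j * T.weight ξ η j

/-- The coefficient of `û ⊗ ⋯ ⊗ û` in `integrandN1`. -/
def coefN1 (ξ : M.Freq) : (Fin j → M.Freq) → ℂ :=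
  Set.indicator {η | T.IsIndex ξ η ∧ T.NearRes ξ η K j ∧ T.NonRes ξ η K (j - 1)}
    fun η => Complex.I * T.phase ξ η t j * T.weight ξ η (j - 1)

/-- The coefficient of `û ⊗ ⋯ ⊗ û` in `integrandN2`. -/
def coefN2 (ξ : M.Freq) : (Fin j → M.Freq) → ℂ :=
  Set.indicator {η | T.IsIndex ξ η ∧ T.NonRes ξ η K j}
    fun η => Complex.I * T.phase ξ η t j * T.weight ξ η (j - 1)

/-- The coefficient of `û ⊗ ⋯ ⊗ û` in `integrandE`. -/
def coefE (δ : ℝ) (ξ : M.Freq) : (Fin j → M.Freq) → ℂ :=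
  Set.indicator {η | T.IsIndex ξ η ∧ T.NonRes ξ η K (j - 1)}
    fun η => phaseDiff δ t (T.gen ξ η j) (T.gen₁ ξ η j) (T.gen₂ ξ η j) *
      (Complex.I * T.phase ξ η t (j - 1)) * T.weight ξ η (j - 1)

theorem measurable_coefN0 :
    Measurable fun p : M.Freq × (Fin j → M.Freq) => T.coefN0 K t p.1 p.2 :=
  ((T.measurable_phase t j).mul (T.measurable_weight j)).indicator
    ((T.measurableSet_isIndex (M := M)).inter (T.measurableSet_nonRes K j))

theorem measurable_coefN1 :
    Measurable fun p : M.Freq × (Fin j → M.Freq) => T.coefN1 K t p.1 p.2 :=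
  (((T.measurable_phase t j).const_mul Complex.I).mul (T.measurable_weight (j - 1))).indicator
    ((T.measurableSet_isIndex (M := M)).inter
      ((T.measurableSet_nearRes K j).inter (T.measurableSet_nonRes K (j - 1))))

theorem measurable_coefN2 :
    Measurable fun p : M.Freq × (Fin j → M.Freq) => T.coefN2 K t p.1 p.2 :=
  (((T.measurable_phase t j).const_mul Complex.I).mul (T.measurable_weight (j - 1))).indicator
    ((T.measurableSet_isIndex (M := M)).inter (T.measurableSet_nonRes K j))

theorem measurable_coefE (δ : ℝ) :
    Measurable fun p : M.Freq × (Fin j → M.Freq) => T.coefE K t δ p.1 p.2 :=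
  (((T.measurable_phaseDiff δ t j).mul
    ((T.measurable_phase t (j - 1)).const_mul Complex.I)).mul (T.measurable_weight (j - 1))).indicator
      ((T.measurableSet_isIndex (M := M)).inter (T.measurableSet_nonRes K (j - 1)))

theorem integrandN0_eq (u : M.L2) (ξ : M.Freq) :
    integrandN0 K t u T ξ = fun η => T.coefN0 K t ξ η * T.leafProd ξ η u :=
  funext fun _ => Set.indicator_mul_left _ _ _

theorem integrandN1_eq (u : M.L2) (ξ : M.Freq) :
    integrandN1 K t u T ξ = fun η => T.coefN1 K t ξ η * T.leafProd ξ η u :=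
  funext fun _ => Set.indicator_mul_left _ _ _

theorem integrandN2_eq (u : M.L2) (ξ : M.Freq) :
    integrandN2 K t u T ξ = fun η => T.coefN2 K t ξ η * T.leafProd ξ η u :=
  funext fun _ => Set.indicator_mul_left _ _ _

theorem integrandE_eq (δ : ℝ) (u : M.L2) (ξ : M.Freq) :
    integrandE K δ t u T ξ = fun η => T.coefE K t δ ξ η * T.leafProd ξ η u :=
  funext fun _ => Set.indicator_mul_left _ _ _

end OrderedTree

theorem aestronglyMeasurable_sum_integral {j : ℕ}
    {c : OrderedTree j → M.Freq → (Fin j → M.Freq) → ℂ}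
    (hc : ∀ T, Measurable fun p : M.Freq × (Fin j → M.Freq) => c T p.1 p.2) (u : M.L2) (s : ℂ) :
    AEStronglyMeasurable fun ξ =>
      s * ∑ T : OrderedTree j, ∫ η, c T ξ η * T.leafProd ξ η u := by
  refine (StronglyMeasurable.const_mul ?_ s).aestronglyMeasurable
  refine Finset.stronglyMeasurable_fun_sum _ fun T _ => ?_
  exact ((hc T).mul (T.measurable_leafProd u)).stronglyMeasurable.integral_prod_right

/-! ### Pointwise bounds -/

/-- The lower bound for `|ξ ξ₁ ξ₂|` in generation `k + 1` of a nonresonant tree. -/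
def threshold (K : ℝ) (k : ℕ) : ℝ := K ^ 4 * ((k + 3).factorial : ℝ) ^ 4 / 96

theorem one_le_threshold {K : ℝ} (hK : 1 ≤ K) (k : ℕ) : 1 ≤ threshold K k := by
  have h1 : (1 : ℝ) ≤ K ^ 4 := one_le_pow₀ hK
  have h2 : (6 : ℝ) ≤ ((k + 3).factorial : ℝ) := by
    have : Nat.factorial 3 ≤ (k + 3).factorial := Nat.factorial_le (by omega)
    exact_mod_cast this
  have h3 : (6 : ℝ) ^ 4 ≤ ((k + 3).factorial : ℝ) ^ 4 := pow_le_pow_left₀ (by norm_num) h2 4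
  unfold threshold
  rw [le_div_iff₀ (by norm_num)]
  nlinarith

namespace OrderedTree

variable {j : ℕ} (T : OrderedTree j) (ξ : M.Freq) (η : Fin j → M.Freq)

/-- The shift that recurs throughout: generations are numbered from 1, the entries of `branch` from
0. -/
theorem r_succ (k : Fin j) : T.r (k + 1) = T.branch k := by
  have h : (k : ℕ) + 1 - 1 < j := by have := k.2; omega
  rw [r, dif_pos h]; congr

theorem abs_gen_succ (k : Fin j) : |T.gen ξ η (k + 1)| = M.mag (T.freq ξ η (T.branch k)) := by
  rw [gen, r_succ]; rfl

/-- The identity −(x+y)³ + x³ + y³ = −3(x+y)xy. -/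
theorem abs_mu_succ (k : Fin j) : |T.mu ξ η (k + 1)| =
    3 * trip (T.freq ξ η (false :: T.branch k)) (T.freq ξ η (true :: T.branch k)) := by
  unfold mu gen gen₁ gen₂ trip mag
  rw [r_succ, ← freq_eq_add]
  have h : M.toReal (T.freq ξ η (T.branch k)) = M.toReal (T.freq ξ η (false :: T.branch k)) +
      M.toReal (T.freq ξ η (true :: T.branch k)) := by rw [freq_eq_add, toReal_add]
  rw [← abs_mul, ← abs_mul, show (3 : ℝ) = |(-3 : ℝ)| by norm_num, ← abs_mul, h]
  congr 1
  unfold resKdV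
  ring

theorem muTilde_succ (k : ℕ) : T.muTilde ξ η (k + 1) = T.muTilde ξ η k + T.mu ξ η (k + 1) := by
  unfold muTilde
  rw [Finset.sum_Icc_succ_top (by omega)]

variable {T ξ η}

theorem NonRes.mono {K : ℝ} {m n : ℕ} (h : T.NonRes ξ η K n) (hmn : m ≤ n) : T.NonRes ξ η K m :=
  fun k hk => h k (Finset.Icc_subset_Icc_right hmn hk)

/-- The nonresonance conditions multiply up: (3K)⁴ · 4⁴ · 5⁴ ⋯ (k+3)⁴ = K⁴((k+3)!/2)⁴. The fourth
powers are the source of all factorial decay. -/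
theorem NonRes.lt_muTilde {K : ℝ} {m : ℕ} (h : T.NonRes ξ η K m) {k : ℕ} (hk : k < m) :
    K ^ 4 * ((k + 3).factorial : ℝ) ^ 4 / 16 < |T.muTilde ξ η (k + 1)| := by
  induction k with
  | zero =>
    have h1 := h 1 (Finset.mem_Icc.2 ⟨le_rfl, hk⟩)
    simp only [NearRes, if_true, not_le] at h1
    norm_num [Nat.factorial]
    nlinarith
  | succ k ih =>
    have ih := ih (by omega)
    have h1 := h (k + 2) (Finset.mem_Icc.2 ⟨by omega, hk⟩)
    rw [NearRes, if_neg (by omega), not_le] at h1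
    have e : (((k + 1 + 3).factorial : ℕ) : ℝ) = ((k + 2 : ℕ) + 2 : ℝ) * ((k + 3).factorial : ℝ) := by
      rw [show k + 1 + 3 = (k + 3) + 1 by ring, Nat.factorial_succ]; push_cast; ring
    rw [e]
    have hp : (0 : ℝ) < (((k + 2 : ℕ) : ℝ) + 2) ^ 4 := by positivity
    calc _ = (((k + 2 : ℕ) : ℝ) + 2) ^ 4 * (K ^ 4 * ((k + 3).factorial : ℝ) ^ 4 / 16) := by ring
      _ < (((k + 2 : ℕ) : ℝ) + 2) ^ 4 * |T.muTilde ξ η (k + 1)| := by gcongr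
      _ < _ := h1

/-- 256 = 4⁴ is the smallest of the factors, occurring in generation 2; for the first generation the
preceding sum is empty. -/
theorem NonRes.muTilde_pred_le {K : ℝ} {m : ℕ} (h : T.NonRes ξ η K m) {k : ℕ} (hk : k < m) :
    256 * |T.muTilde ξ η k| ≤ |T.muTilde ξ η (k + 1)| := by
  rcases k with _ | k
  · simp [muTilde]
  · have h1 := h (k + 2) (Finset.mem_Icc.2 ⟨by omega, hk⟩)
    rw [NearRes, if_neg (by omega), not_le] at h1
    refine le_trans ?_ h1.le
    have h2 : (256 : ℝ) ≤ (((k + 1 + 1 : ℕ) : ℝ) + 2) ^ 4 := by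
      have : (4 : ℝ) ≤ ((k + 1 + 1 : ℕ) : ℝ) + 2 := by
        push_cast
        have : (0 : ℝ) ≤ k := Nat.cast_nonneg k
        linarith
      calc (256 : ℝ) = 4 ^ 4 := by norm_num
        _ ≤ _ := pow_le_pow_left₀ (by norm_num) this 4
    exact mul_le_mul_of_nonneg_right h2 (abs_nonneg _)

theorem NonRes.mu_bounds {K : ℝ} {m : ℕ} (h : T.NonRes ξ η K m) {k : ℕ} (hk : k < m) :
    |T.muTilde ξ η (k + 1)| ≤ 2 * |T.mu ξ η (k + 1)| ∧
      |T.mu ξ η (k + 1)| ≤ 2 * |T.muTilde ξ η (k + 1)| := by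
  have h1 := h.muTilde_pred_le hk
  have h2 : T.mu ξ η (k + 1) = T.muTilde ξ η (k + 1) - T.muTilde ξ η k := by
    rw [muTilde_succ]; ring
  have h3 := abs_sub (T.muTilde ξ η (k + 1)) (T.muTilde ξ η k)
  have h4 := abs_sub_abs_le_abs_sub (T.muTilde ξ η (k + 1)) (T.muTilde ξ η k)
  rw [← h2] at h3 h4
  have := abs_nonneg (T.muTilde ξ η k)
  constructor <;> linarith

/-- Decoupling of the generations: the accumulated phase μ̃ is replaced by the phase μ of this
generation alone, which involves only three frequencies. -/
theorem NonRes.ratio_le {K : ℝ} {m : ℕ} (h : T.NonRes ξ η K m) (hK : 1 ≤ K) (k : Fin j)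
    (hk : (k : ℕ) < m) :
    ENNReal.ofReal |T.gen ξ η (k + 1) / T.muTilde ξ η (k + 1)| ≤
      kernel (threshold K k) (T.freq ξ η (false :: T.branch k))
        (T.freq ξ η (true :: T.branch k)) := by
  have h1 := h.mu_bounds hk
  have h2 := h.lt_muTilde hk
  rw [abs_mu_succ] at h1
  set x := T.freq ξ η (false :: T.branch k)
  set y := T.freq ξ η (true :: T.branch k)
  have hg : |T.gen ξ η (k + 1)| = M.mag (x + y) := by rw [abs_gen_succ, freq_eq_add]
  -- |μ̃| ≤ 2|μ| = 6 `trip x y`, and 16 · 6 = 96.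
  have hthr : threshold K k ≤ trip x y := by
    unfold threshold; linarith
  have hpos : 0 < trip x y := by linarith [one_le_threshold hK (k : ℕ)]
  rw [kernel, if_pos (show threshold K k ≤ M.mag (x + y) * (M.mag x * M.mag y) from hthr), abs_div, hg]
  apply ENNReal.ofReal_le_ofReal
  unfold trip at *
  have hxy : 0 < M.mag x * M.mag y := by
    by_contra h0
    have : M.mag x * M.mag y = 0 :=
      le_antisymm (not_lt.1 h0) (mul_nonneg (mag_nonneg _) (mag_nonneg _))
    rw [this] at hpos; simp at hpos
  have hmt : 0 < |T.muTilde ξ η (k + 1)| := by linarith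
  rw [div_le_iff₀ hmt, inv_mul_eq_div, le_div_iff₀ hxy]
  linarith

theorem prod_Icc_eq_range (F : ℕ → ℝ) (n : ℕ) :
    ∏ k ∈ Finset.Icc 1 n, F k = ∏ k ∈ Finset.range n, F (k + 1) := by
  induction n with
  | zero => simp
  | succ n ih => rw [Finset.prod_Icc_succ_top (by omega), ih, Finset.prod_range_succ]

theorem enorm_weight_self_le {K : ℝ} (hK : 1 ≤ K) (h : T.NonRes ξ η K j) :
    ‖T.weight ξ η j‖ₑ ≤ T.kernelProd (threshold K) ξ η := by
  rw [weight, ← ofReal_norm, Complex.norm_real, prod_Icc_eq_range, prod_Icc_eq_range,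
    ← Finset.prod_div_distrib, Real.norm_eq_abs, Finset.abs_prod,
    ENNReal.ofReal_prod_of_nonneg (fun _ _ => abs_nonneg _), kernelProd,
    ← Fin.prod_univ_eq_prod_range (fun k => ENNReal.ofReal |T.gen ξ η (k + 1) / T.muTilde ξ η (k + 1)|)]
  exact Finset.prod_le_prod' fun k _ => h.ratio_le hK k k.2

end OrderedTree

namespace OrderedTree

variable {j : ℕ} {T : OrderedTree (j + 1)} {ξ : M.Freq} {η : Fin (j + 1) → M.Freq}

theorem abs_gen_last : |T.gen ξ η (j + 1)| =
    M.mag (T.init.freq ξ (fun k => η k.castSucc) T.last) := by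
  rw [← freq_last]
  exact T.abs_gen_succ ξ η (Fin.last j)

theorem enorm_weight_pred_le {K : ℝ} (hK : 1 ≤ K) (h : T.NonRes ξ η K j) :
    ‖T.weight ξ η j‖ₑ ≤ T.init.kernelProd (threshold K) ξ (fun k => η k.castSucc) *
      ENNReal.ofReal (M.mag (T.init.freq ξ (fun k => η k.castSucc) T.last)) := by
  rw [weight, ← ofReal_norm, Complex.norm_real, prod_Icc_eq_range, prod_Icc_eq_range,
    Finset.prod_range_succ, mul_div_right_comm, ← Finset.prod_div_distrib, Real.norm_eq_abs, abs_mul,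
    Finset.abs_prod, ENNReal.ofReal_mul (Finset.prod_nonneg fun _ _ => abs_nonneg _),
    ENNReal.ofReal_prod_of_nonneg (fun _ _ => abs_nonneg _), kernelProd_init, abs_gen_last,
    ← Fin.prod_univ_eq_prod_range (fun k => ENNReal.ofReal |T.gen ξ η (k + 1) / T.muTilde ξ η (k + 1)|)]
  refine mul_le_mul_left (Finset.prod_le_prod' fun k _ => ?_) _
  exact h.ratio_le hK k.castSucc k.2

/-- The omitted denominator is at least 1. For absolute convergence the coefficient of N₀ can thus
share the majorant of N₁, N₂ and E. -/
theorem enorm_weight_self_le_pred {K : ℝ} (hK : 1 ≤ K) (h : T.NonRes ξ η K (j + 1)) :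
    ‖T.weight ξ η (j + 1)‖ₑ ≤ ‖T.weight ξ η j‖ₑ := by
  unfold weight
  rw [prod_Icc_eq_range _ (j + 1), prod_Icc_eq_range (fun k => T.muTilde ξ η k) (j + 1),
    Finset.prod_range_succ (fun k => T.muTilde ξ η (k + 1)), ← prod_Icc_eq_range (T.muTilde ξ η),
    ← div_div, ← ofReal_norm, ← ofReal_norm, Complex.norm_real, Complex.norm_real]
  apply ENNReal.ofReal_le_ofReal
  rw [norm_div]
  refine div_le_self (norm_nonneg _) ?_
  have h1 := h.lt_muTilde (Nat.lt_succ_self j)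
  have h2 := one_le_threshold hK j
  unfold threshold at h2
  rw [Real.norm_eq_abs]
  have : K ^ 4 * ((j + 3).factorial : ℝ) ^ 4 / 96 ≤ K ^ 4 * ((j + 3).factorial : ℝ) ^ 4 / 16 := by
    have : 0 ≤ K ^ 4 * ((j + 3).factorial : ℝ) ^ 4 := by positivity
    linarith
  linarith

/-- The children of the last root carry nonzero frequencies for almost every index function. -/
theorem ae_mag_child_pos (T : OrderedTree (j + 1)) (ξ : M.Freq) :
    ∀ᵐ η : Fin (j + 1) → M.Freq, ∀ b : Bool, T.freq ξ η (b :: T.last) ∈ M.freqStar →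
      0 < M.mag (T.freq ξ η (b :: T.last)) := by
  rw [ae_all_iff]
  intro b
  have hS : MeasurableSet {x : M.Freq | ¬ (x ∈ M.freqStar → 0 < M.mag x)} := by
    have h1 : MeasurableSet {x : M.Freq | x ∈ M.freqStar ∧ ¬ 0 < M.mag x} :=
      measurableSet_freqStar.inter (measurableSet_lt measurable_const measurable_mag).compl
    simpa only [Classical.not_imp] using h1
  set S : Set M.Freq := {x : M.Freq | ¬ (x ∈ M.freqStar → 0 < M.mag x)} with hSdef
  have hS0 : volume S = 0 := ae_iff.1 ae_mag_pos
  rw [ae_iff]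
  change volume ((fun η => T.freq ξ η (b :: T.last)) ⁻¹' S) = 0
  have hm := (T.measurable_freq_right ξ (b :: T.last)) hS
  rw [← lintegral_indicator_one hm, lintegral_snoc (measurable_one.indicator hm)]
  refine (lintegral_congr fun η => ?_).trans lintegral_zero
  cases b
  · have h : ∀ c : M.Freq, ((fun η => T.freq ξ η (false :: T.last)) ⁻¹' S).indicator
        (1 : (Fin (j + 1) → M.Freq) → ℝ≥0∞) (Fin.snoc (α := fun _ => M.Freq) η c) =
        S.indicator 1 c := by
      intro c
      have e2 : T.freq ξ (Fin.snoc (α := fun _ => M.Freq) η c) (false :: T.last) = c := by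
        rw [(T.freq_children_last ξ _).1]; simp
      exact Set.indicator_eq_indicator (by rw [Set.mem_preimage, e2]) rfl
    simp_rw [h]
    rw [lintegral_indicator_one hS, hS0]
  · have h : ∀ c : M.Freq, ((fun η => T.freq ξ η (true :: T.last)) ⁻¹' S).indicator
        (1 : (Fin (j + 1) → M.Freq) → ℝ≥0∞) (Fin.snoc (α := fun _ => M.Freq) η c) =
        S.indicator 1 (T.init.freq ξ η T.last - c) := by
      intro c
      have e2 : T.freq ξ (Fin.snoc (α := fun _ => M.Freq) η c) (true :: T.last) =
          T.init.freq ξ η T.last - c := by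
        rw [(T.freq_children_last ξ _).2]; simp
      exact Set.indicator_eq_indicator (by rw [Set.mem_preimage, e2]) rfl
    simp_rw [h]
    rw [lintegral_sub_left_eq_self (fun c => S.indicator (1 : M.Freq → ℝ≥0∞) c),
      lintegral_indicator_one hS, hS0]

theorem IsIndex.children_last (h : T.IsIndex ξ η) (b : Bool) :
    T.freq ξ η (b :: T.last) ∈ M.freqStar := by
  refine h _ (Finset.mem_union_right _ ?_)
  rw [← terminal_eq_leaves]
  exact mem_terminal_cons.2 ⟨T.branch_mem_internal _, T.child_notMem_internal b⟩

end OrderedTree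

/-! ### Bounds for the coefficients -/

theorem enorm_I : ‖Complex.I‖ₑ = 1 := by
  rw [← ofReal_norm, Complex.norm_I, ENNReal.ofReal_one]

namespace OrderedTree

variable {j : ℕ}

theorem enorm_phase (T : OrderedTree j) (ξ : M.Freq) (η : Fin j → M.Freq) (t : ℝ) (m : ℕ) :
    ‖T.phase ξ η t m‖ₑ = 1 := by
  rw [phase, ← ofReal_norm, mul_comm, Complex.norm_exp_ofReal_mul_I, ENNReal.ofReal_one]

/-- The integral of the modulus of a coefficient against a product over the terminal nodes. -/
def absForm (T : OrderedTree j) (c : M.Freq → (Fin j → M.Freq) → ℂ) (f : Node → M.Freq → ℝ≥0∞)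
    (ξ : M.Freq) : ℝ≥0∞ :=
  ∫⁻ η, ‖c ξ η‖ₑ * ∏ a ∈ T.terminal, f a (T.freq ξ η a)

theorem measurable_absForm (T : OrderedTree j) {c : M.Freq → (Fin j → M.Freq) → ℂ}
    (hc : Measurable fun p : M.Freq × (Fin j → M.Freq) => c p.1 p.2)
    {f : Node → M.Freq → ℝ≥0∞} (hf : ∀ a, Measurable (f a)) : Measurable (T.absForm c f) :=
  Measurable.lintegral_prod_right'
    (f := fun p : M.Freq × (Fin j → M.Freq) => ‖c p.1 p.2‖ₑ * ∏ a ∈ T.terminal,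
      f a (T.freq p.1 p.2 a))
    (hc.enorm.mul (Finset.measurable_prod _ fun a _ => (hf a).comp (T.measurable_freq a)))

theorem enorm_coefN0_le (T : OrderedTree j) {K : ℝ} (hK : 1 ≤ K) (t : ℝ) (ξ : M.Freq)
    (η : Fin j → M.Freq) : ‖T.coefN0 K t ξ η‖ₑ ≤ T.kernelProd (threshold K) ξ η := by
  unfold coefN0
  by_cases h : η ∈ {η | T.IsIndex ξ η ∧ T.NonRes ξ η K j}
  · rw [Set.indicator_of_mem h, enorm_mul, enorm_phase, one_mul]
    exact enorm_weight_self_le hK h.2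
  · rw [Set.indicator_of_notMem h, enorm_zero]
    exact zero_le

theorem absForm_coefN0_le (T : OrderedTree j) {K : ℝ} (hK : 1 ≤ K) (t : ℝ)
    (f : Node → M.Freq → ℝ≥0∞) (ξ : M.Freq) :
    T.absForm (T.coefN0 K t) f ξ ≤ T.treeForm (threshold K) f ξ :=
  lintegral_mono fun η => mul_le_mul_left (T.enorm_coefN0_le hK t ξ η) _

theorem sqNorm_absForm_coefN0_le (T : OrderedTree j) {K : ℝ} (hK : 1 ≤ K) (t : ℝ)
    {f : Node → M.Freq → ℝ≥0∞} (hf : ∀ a, Measurable (f a)) :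
    sqNorm (T.absForm (T.coefN0 K t) f) ≤
      (∏ k ∈ Finset.range j, ENNReal.ofReal (80 / threshold K k)) *
        ∏ a ∈ T.terminal, sqNorm (f a) :=
  (lintegral_mono fun ξ => pow_le_pow_left' (T.absForm_coefN0_le hK t f ξ) 2).trans
    (T.sqNorm_treeForm_le (fun k => zero_lt_one.trans_le (one_le_threshold hK k)) hf)

/-- The common majorant of the coefficients. -/
def freeKernel (T : OrderedTree (j + 1)) (K : ℝ) (ξ : M.Freq) (η : Fin (j + 1) → M.Freq) : ℝ≥0∞ :=
  T.init.kernelProd (threshold K) ξ (fun k => η k.castSucc) *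
    ENNReal.ofReal (M.mag (T.init.freq ξ (fun k => η k.castSucc) T.last))

theorem enorm_coefN0_le_freeKernel (T : OrderedTree (j + 1)) {K : ℝ} (hK : 1 ≤ K) (t : ℝ)
    (ξ : M.Freq) (η : Fin (j + 1) → M.Freq) : ‖T.coefN0 K t ξ η‖ₑ ≤ T.freeKernel K ξ η := by
  unfold coefN0
  by_cases h : η ∈ {η | T.IsIndex ξ η ∧ T.NonRes ξ η K (j + 1)}
  · rw [Set.indicator_of_mem h, enorm_mul, enorm_phase, one_mul]
    exact (enorm_weight_self_le_pred hK h.2).trans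
      (enorm_weight_pred_le hK (h.2.mono (Nat.le_succ j)))
  · rw [Set.indicator_of_notMem h, enorm_zero]
    exact zero_le

theorem enorm_coefN1_le_freeKernel (T : OrderedTree (j + 1)) {K : ℝ} (hK : 1 ≤ K) (t : ℝ)
    (ξ : M.Freq) (η : Fin (j + 1) → M.Freq) : ‖T.coefN1 K t ξ η‖ₑ ≤ T.freeKernel K ξ η := by
  unfold coefN1
  by_cases h : η ∈ {η | T.IsIndex ξ η ∧ T.NearRes ξ η K (j + 1) ∧ T.NonRes ξ η K (j + 1 - 1)}
  · rw [Set.indicator_of_mem h, enorm_mul, enorm_mul, enorm_phase, enorm_I, one_mul, one_mul]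
    exact enorm_weight_pred_le hK h.2.2
  · rw [Set.indicator_of_notMem h, enorm_zero]
    exact zero_le

theorem enorm_coefN2_le_freeKernel (T : OrderedTree (j + 1)) {K : ℝ} (hK : 1 ≤ K) (t : ℝ)
    (ξ : M.Freq) (η : Fin (j + 1) → M.Freq) : ‖T.coefN2 K t ξ η‖ₑ ≤ T.freeKernel K ξ η := by
  unfold coefN2
  by_cases h : η ∈ {η | T.IsIndex ξ η ∧ T.NonRes ξ η K (j + 1)}
  · rw [Set.indicator_of_mem h, enorm_mul, enorm_mul, enorm_phase, enorm_I, one_mul, one_mul]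
    exact enorm_weight_pred_le hK (h.2.mono (Nat.le_succ j))
  · rw [Set.indicator_of_notMem h, enorm_zero]
    exact zero_le

theorem enorm_coefE_le_freeKernel (T : OrderedTree (j + 1)) {K : ℝ} (hK : 1 ≤ K) (t δ : ℝ)
    (ξ : M.Freq) (η : Fin (j + 1) → M.Freq) : ‖T.coefE K t δ ξ η‖ₑ ≤
      ‖phaseDiff δ t (T.gen ξ η (j + 1)) (T.gen₁ ξ η (j + 1)) (T.gen₂ ξ η (j + 1))‖ₑ *
        T.freeKernel K ξ η := by
  unfold coefE
  by_cases h : η ∈ {η | T.IsIndex ξ η ∧ T.NonRes ξ η K (j + 1 - 1)}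
  · rw [Set.indicator_of_mem h, enorm_mul, enorm_mul, enorm_mul, enorm_phase, enorm_I, one_mul,
      mul_one]
    exact mul_le_mul_right (enorm_weight_pred_le hK h.2) _
  · rw [Set.indicator_of_notMem h, enorm_zero]
    exact zero_le

theorem lintegral_freeKernel (T : OrderedTree (j + 1)) (K : ℝ) (f : Node → M.Freq → ℝ≥0∞)
    (ξ : M.Freq) : ∫⁻ η, T.freeKernel K ξ η * ∏ a ∈ T.terminal, f a (T.freq ξ η a) =
      T.freeForm (threshold K) f ξ := by
  unfold freeForm freeKernel
  simp_rw [mul_assoc]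

/-! ### The nearly resonant terms -/

/-- For a single generation the near-resonance condition is absolute, 3|ξξ₁ξ₂| ≤ (3K)⁴, hence the
level 27K⁴. The bound is almost everywhere because `resKernel` excludes children of frequency zero,
which are admissible on the line. -/
theorem enorm_coefN1_one_le (T : OrderedTree 1) (K t : ℝ) (ξ : M.Freq) :
    ∀ᵐ η : Fin 1 → M.Freq, ‖T.coefN1 K t ξ η‖ₑ ≤
      resKernel (27 * K ^ 4) (η (Fin.last 0))
        (T.init.freq ξ (fun k => η k.castSucc) T.last - η (Fin.last 0)) := by
  filter_upwards [T.ae_mag_child_pos ξ] with η hη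
  unfold coefN1
  by_cases h : η ∈ {η | T.IsIndex ξ η ∧ T.NearRes ξ η K 1 ∧ T.NonRes ξ η K (1 - 1)}
  · rw [Set.indicator_of_mem h, enorm_mul, enorm_mul, enorm_phase, enorm_I, one_mul, one_mul]
    obtain ⟨h0, h1, -⟩ := h
    have hc := T.freq_children_last ξ η
    rw [← hc.2, ← hc.1]
    have hmu := T.abs_mu_succ ξ η (Fin.last 0)
    have hmt : T.muTilde ξ η 1 = T.mu ξ η 1 := by simp [muTilde]
    simp only [NearRes, if_true, hmt] at h1
    rw [Fin.val_last, zero_add] at hmu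
    change _ = 3 * trip (T.freq ξ η (false :: T.last)) (T.freq ξ η (true :: T.last)) at hmu
    have hw : ‖T.weight ξ η (1 - 1)‖ₑ =
        ENNReal.ofReal (M.mag (T.freq ξ η (false :: T.last) + T.freq ξ η (true :: T.last))) := by
      have h2 : |T.gen ξ η 1| =
          M.mag (T.freq ξ η (false :: T.last) + T.freq ξ η (true :: T.last)) :=
        (T.abs_gen_succ ξ η (Fin.last 0)).trans (congrArg M.mag (T.freq_eq_add ξ η (Fin.last 0)))
      rw [weight, ← ofReal_norm, Complex.norm_real, Real.norm_eq_abs, ← h2]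
      simp
    have hL : trip (T.freq ξ η (false :: T.last)) (T.freq ξ η (true :: T.last)) ≤ 27 * K ^ 4 := by
      rw [hmu] at h1
      linarith
    rw [hw, resKernel, if_pos ⟨hη _ (h0.children_last _), hη _ (h0.children_last _), hL⟩]
  · rw [Set.indicator_of_notMem h, enorm_zero]
    exact zero_le

theorem sqNorm_absForm_coefN1_one_le (T : OrderedTree 1) (K t : ℝ)
    {f : Node → M.Freq → ℝ≥0∞} (hf : ∀ a, Measurable (f a)) :
    sqNorm (T.absForm (T.coefN1 K t) f) ≤
      ENNReal.ofReal (216 * K ^ 4) * ∏ a ∈ T.terminal, sqNorm (f a) := by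
  have hT : T.last = [] := T.root _ rfl
  have he : T.init.terminal.erase T.last = ∅ := by
    rw [← Finset.card_eq_zero, Finset.card_erase_of_mem T.last_mem_terminal_init, card_terminal]
  have hle : ∀ ξ, T.absForm (T.coefN1 K t) f ξ ≤
      resBil (27 * K ^ 4) (f (false :: T.last)) (f (true :: T.last)) ξ := by
    intro ξ
    have hfr : ∀ η : Fin 0 → M.Freq, T.init.freq ξ η T.last = ξ := fun η => by rw [hT]; rfl
    have hκ : Measurable (Function.uncurry fun (η : Fin 0 → M.Freq) (c : M.Freq) =>
        resKernel (27 * K ^ 4) c (T.init.freq ξ η T.last - c)) := by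
      unfold Function.uncurry
      exact measurable_resKernel_comp measurable_const measurable_snd
        (((T.init.measurable_freq_right ξ _).comp measurable_fst).sub measurable_snd)
    have h := T.lintegral_peel ξ (P := fun _ => 1) measurable_const hκ hf
    rw [lintegral_fin_zero, he] at h
    simp only [one_mul, Finset.prod_empty, mul_one, hfr] at h
    refine le_trans (lintegral_mono_ae ?_) h.le
    filter_upwards [T.enorm_coefN1_one_le K t ξ] with η hη
    rw [hfr] at hη
    exact mul_le_mul_left hη _
  calc sqNorm (T.absForm (T.coefN1 K t) f)
      ≤ sqNorm (resBil (27 * K ^ 4) (f (false :: T.last)) (f (true :: T.last))) :=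
        lintegral_mono fun ξ => pow_le_pow_left' (hle ξ) 2
    _ ≤ _ := sqNorm_resBil_le _ (hf _) (hf _)
    _ = _ := by
      rw [prod_terminal_succ, he, Finset.prod_empty, mul_one]
      congr 2
      ring

/-- The last phase is a difference of consecutive sums, so near resonance gives |μ_{j+2}| ≤
((j+4)⁴+1)|μ̃_{j+1}|, and |μ̃_{j+1}| ≤ 2|μ_{j+1}| by nonresonance of the preceding generation. Near
resonance thereby becomes a comparison of two adjacent generations only. -/
theorem enorm_coefN1_le_resKernel (T : OrderedTree (j + 2)) {K : ℝ} (hK : 1 ≤ K) (t : ℝ)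
    (ξ : M.Freq) :
    ∀ᵐ η : Fin (j + 2) → M.Freq, ‖T.coefN1 K t ξ η‖ₑ ≤
      T.init.kernelProd (threshold K) ξ (fun k => η k.castSucc) *
        resKernel (2 * (((j : ℝ) + 4) ^ 4 + 1) *
          trip (T.init.freq ξ (fun k => η k.castSucc) (false :: T.init.last))
            (T.init.freq ξ (fun k => η k.castSucc) (true :: T.init.last)))
          (η (Fin.last _)) (T.init.freq ξ (fun k => η k.castSucc) T.last - η (Fin.last _)) := by
  filter_upwards [T.ae_mag_child_pos ξ] with η hη
  unfold coefN1
  by_cases h : η ∈ {η | T.IsIndex ξ η ∧ T.NearRes ξ η K (j + 2) ∧ T.NonRes ξ η K (j + 2 - 1)}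
  · rw [Set.indicator_of_mem h, enorm_mul, enorm_mul, enorm_phase, enorm_I, one_mul, one_mul]
    obtain ⟨h0, h1, h2⟩ := h
    refine (enorm_weight_pred_le hK h2).trans (mul_le_mul_right ?_ _)
    have hc := T.freq_children_last ξ η
    have hadd : T.init.freq ξ (fun k => η k.castSucc) T.last =
        T.freq ξ η (false :: T.last) + T.freq ξ η (true :: T.last) := by
      rw [← freq_last]; exact T.freq_eq_add ξ η (Fin.last _)
    rw [← hc.2, ← hc.1, hadd]
    have hpar : ∀ b : Bool, T.init.freq ξ (fun k => η k.castSucc) (b :: T.init.last) =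
        T.freq ξ η (b :: T.init.last) := fun b =>
      (T.freq_init ξ η _ (Finset.mem_union_right _ (mem_terminal_cons.2
        ⟨T.init.branch_mem_internal _, T.init.child_notMem_internal b⟩))).symm
    rw [hpar, hpar]
    have hmu := T.abs_mu_succ ξ η (Fin.last (j + 1))
    rw [Fin.val_last] at hmu
    change _ = 3 * trip (T.freq ξ η (false :: T.last)) (T.freq ξ η (true :: T.last)) at hmu
    have hmu' := T.abs_mu_succ ξ η (Fin.last j).castSucc
    rw [Fin.val_castSucc, Fin.val_last] at hmu'
    change _ = 3 * trip (T.freq ξ η (false :: T.init.last)) (T.freq ξ η (true :: T.init.last)) at hmu'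
    have hb := (NonRes.mu_bounds h2 (k := j) (by omega)).1
    rw [NearRes, if_neg (by omega)] at h1
    have e1 : ((j + 2 : ℕ) : ℝ) + 2 = (j : ℝ) + 4 := by push_cast; ring
    rw [e1, show j + 2 - 1 = j + 1 by omega] at h1
    have h3 : T.mu ξ η (j + 1 + 1) = T.muTilde ξ η (j + 2) - T.muTilde ξ η (j + 1) := by
      rw [muTilde_succ]; ring
    have h4 := abs_sub (T.muTilde ξ η (j + 2)) (T.muTilde ξ η (j + 1))
    rw [← h3, hmu] at h4
    rw [hmu'] at hb
    have hq : 0 ≤ ((j : ℝ) + 4) ^ 4 := by positivity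
    have h5 := mul_le_mul_of_nonneg_left hb (add_nonneg hq zero_le_one)
    have hL : trip (T.freq ξ η (false :: T.last)) (T.freq ξ η (true :: T.last)) ≤
        2 * (((j : ℝ) + 4) ^ 4 + 1) * trip (T.freq ξ η (false :: T.init.last))
          (T.freq ξ η (true :: T.init.last)) := by linarith
    rw [resKernel, if_pos ⟨hη _ (h0.children_last _), hη _ (h0.children_last _), hL⟩]
  · rw [Set.indicator_of_notMem h, enorm_zero]
    exact zero_le

/-- The product runs over j of the j+2 generations, since the last two are consumed by the joint
estimate. -/
theorem sqNorm_absForm_coefN1_le (T : OrderedTree (j + 2)) {K : ℝ} (hK : 1 ≤ K) (t : ℝ)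
    {f : Node → M.Freq → ℝ≥0∞} (hf : ∀ a, Measurable (f a)) :
    sqNorm (T.absForm (T.coefN1 K t) f) ≤
      ENNReal.ofReal (4000 * (((j : ℝ) + 4) ^ 4 + 1)) *
        (∏ k ∈ Finset.range j, ENNReal.ofReal (80 / threshold K k)) *
          ∏ a ∈ T.terminal, sqNorm (f a) := by
  have hle : ∀ ξ, T.absForm (T.coefN1 K t) f ξ ≤
      T.nearForm (threshold K) (2 * (((j : ℝ) + 4) ^ 4 + 1)) f ξ := by
    intro ξ
    refine lintegral_mono_ae ?_
    filter_upwards [T.enorm_coefN1_le_resKernel hK t ξ] with η hη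
    rw [← mul_assoc]
    exact mul_le_mul_left hη _
  have hJ : 1 ≤ 2 * (((j : ℝ) + 4) ^ 4 + 1) := by
    have : 0 ≤ ((j : ℝ) + 4) ^ 4 := by positivity
    linarith
  refine (lintegral_mono fun ξ => pow_le_pow_left' (hle ξ) 2).trans
    ((T.sqNorm_nearForm_le (fun k => zero_lt_one.trans_le (one_le_threshold hK k)) hJ hf).trans
      (le_of_eq ?_))
  rw [mul_assoc]
  congr 2
  ring

end OrderedTree

/-! ### `L²` bounds for the Fourier transform -/

theorem sq_eLpNorm_two {α ε : Type*} [MeasurableSpace α] [TopologicalSpace ε] [ContinuousENorm ε]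
    (μ : Measure α) (f : α → ε) : eLpNorm f 2 μ ^ 2 = ∫⁻ x, ‖f x‖ₑ ^ 2 ∂μ := by
  have h := eLpNorm_nnreal_pow_eq_lintegral (f := f) (μ := μ) (p := 2) two_ne_zero
  simpa using h

theorem integral_circle_eq (f : AddCircle (2 * Real.pi) → ℂ) :
    ∫ x, f x = ((2 * Real.pi : ℝ) : ℂ) * ∫ x, f x ∂AddCircle.haarAddCircle := by
  rw [AddCircle.volume_eq_smul_haarAddCircle, integral_smul_measure,
    ENNReal.toReal_ofReal Real.two_pi_pos.le, Complex.real_smul]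

theorem lintegral_circle_eq (f : AddCircle (2 * Real.pi) → ℝ≥0∞) :
    ∫⁻ x, f x = ENNReal.ofReal (2 * Real.pi) * ∫⁻ x, f x ∂AddCircle.haarAddCircle := by
  rw [AddCircle.volume_eq_smul_haarAddCircle, lintegral_smul_measure, smul_eq_mul]

theorem ae_haar_of_ae_circle {p : AddCircle (2 * Real.pi) → Prop} (h : ∀ᵐ x, p x) :
    ∀ᵐ x ∂AddCircle.haarAddCircle, p x := by
  rw [AddCircle.volume_eq_smul_haarAddCircle] at h
  exact (Measure.ae_ennreal_smul_measure_iff (by simp [Real.pi_pos])).1 h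

/-- `fourierCoeff` integrates against the Haar probability measure, whereas the volume has mass 2π;
this changes the factor (2π)^(−1/2) into (2π)^(1/2). -/
theorem hatCircle_eq (u : Lp ℂ 2 (volume : Measure (AddCircle (2 * Real.pi)))) (n : ℤ) :
    hatCircle u n = (Real.sqrt (2 * Real.pi) : ℂ) * fourierCoeff u n := by
  have hs : (Real.sqrt (2 * Real.pi) : ℂ) ≠ 0 := by
    exact_mod_cast (Real.sqrt_pos.2 Real.two_pi_pos).ne'
  have hsq : (Real.sqrt (2 * Real.pi) : ℂ) * Real.sqrt (2 * Real.pi) = ((2 * Real.pi : ℝ) : ℂ) := by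
    rw [← Complex.ofReal_mul, Real.mul_self_sqrt Real.two_pi_pos.le]
  unfold hatCircle fourierCoeff
  rw [integral_circle_eq, ← hsq, ← mul_assoc, ← mul_assoc,
    inv_mul_cancel₀ hs, one_mul]
  simp only [smul_eq_mul]

/-- Parseval's identity, transferred from the probability measure to the volume: the two factors 2π
agree. -/
theorem eLpNorm_hatCircle (u : Lp ℂ 2 (volume : Measure (AddCircle (2 * Real.pi)))) :
    eLpNorm (hatCircle u) 2 Measure.count = ‖u‖ₑ := by
  refine (ENNReal.pow_right_strictMono two_ne_zero).injective ?_
  rw [Lp.enorm_def, sq_eLpNorm_two, sq_eLpNorm_two]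
  have hL : MemLp u 2 (AddCircle.haarAddCircle (T := 2 * Real.pi)) := (Lp.memLp u).haarAddCircle
  set v := hL.toLp with hv
  have hvu : v =ᵐ[AddCircle.haarAddCircle] u := hL.coeFn_toLp
  have hc : ∀ n, fourierCoeff v n = fourierCoeff (T := 2 * Real.pi) u n := fun n => by
    unfold fourierCoeff
    refine integral_congr_ae ?_
    filter_upwards [hvu] with x hx
    rw [hx]
  have hsum := hasSum_sq_fourierCoeff v
  have h1 : ∀ n, ‖hatCircle u n‖ₑ ^ 2 =
      ENNReal.ofReal (2 * Real.pi) * ENNReal.ofReal (‖fourierCoeff v n‖ ^ 2) := fun n => by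
    rw [hatCircle_eq, hc, enorm_mul, mul_pow, ← ofReal_norm, ← ofReal_norm, Complex.norm_real,
      ← ENNReal.ofReal_pow (norm_nonneg _), ← ENNReal.ofReal_pow (norm_nonneg _), Real.norm_eq_abs,
      sq_abs, Real.sq_sqrt Real.two_pi_pos.le]
  rw [lintegral_count]
  simp_rw [h1]
  rw [ENNReal.tsum_mul_left, ← ENNReal.ofReal_tsum_of_nonneg (fun _ => sq_nonneg _) hsum.summable,
    hsum.tsum_eq, lintegral_circle_eq,
    ofReal_integral_eq_lintegral_ofReal]
  · congr 1
    refine lintegral_congr_ae ?_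
    filter_upwards [hvu] with x hx
    rw [hx, ENNReal.ofReal_pow (norm_nonneg _), ofReal_norm]
  · exact (memLp_two_iff_integrable_sq_norm (Lp.aestronglyMeasurable v)).1 (Lp.memLp v)
  · exact Eventually.of_forall fun _ => sq_nonneg _

theorem fourierCoeff_sum_fourier (N : ℕ) (c : ℤ → ℂ) (m : ℤ) :
    fourierCoeff (T := 2 * Real.pi) (⇑(∑ n ∈ Finset.Icc (-(N : ℤ)) (N : ℤ), c n • fourier n)) m =
      if m ∈ Finset.Icc (-(N : ℤ)) (N : ℤ) then c m else 0 := by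
  have h : ∀ x : AddCircle (2 * Real.pi), fourier (-m) x •
      (∑ n ∈ Finset.Icc (-(N : ℤ)) (N : ℤ), c n • fourier n : C(AddCircle (2 * Real.pi), ℂ)) x =
      ∑ n ∈ Finset.Icc (-(N : ℤ)) (N : ℤ), c n * fourier (n - m) x := fun x => by
    rw [ContinuousMap.sum_apply, Finset.smul_sum]
    refine Finset.sum_congr rfl fun n _ => ?_
    rw [ContinuousMap.smul_apply, smul_eq_mul, smul_eq_mul, sub_eq_add_neg, fourier_add]
    ring
  unfold fourierCoeff
  simp_rw [h]
  rw [integral_finsetSum]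
  · have h2 : ∀ n : ℤ, ∫ x : AddCircle (2 * Real.pi), c n * fourier (n - m) x
        ∂AddCircle.haarAddCircle = if m = n then c n else 0 := fun n => by
      rw [integral_const_mul]
      have h3 := orthonormal_iff_ite.1 (orthonormal_fourier (T := 2 * Real.pi)) m n
      rw [ContinuousMap.inner_toLp (AddCircle.haarAddCircle (T := 2 * Real.pi)) (fourier m)
        (fourier n)] at h3
      simp_rw [← fourier_neg, ← fourier_add] at h3
      rw [show n - m = n + -m from sub_eq_add_neg _ _, h3]
      split_ifs <;> simp
    simp_rw [h2]
    rw [Finset.sum_ite_eq]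
  · intro n _
    exact ((map_continuous (fourier (n - m))).const_mul (c n)).integrable_of_hasCompactSupport
      (HasCompactSupport.of_compactSpace _)

theorem hatCircle_highPass (N : ℕ) (u : Lp ℂ 2 (volume : Measure (AddCircle (2 * Real.pi)))) (n : ℤ) :
    hatCircle (highPassCircle N u) n = if n ∈ Finset.Icc (-(N : ℤ)) (N : ℤ) then 0
      else hatCircle u n := by
  have hs : (Real.sqrt (2 * Real.pi) : ℂ) ≠ 0 := by
    exact_mod_cast (Real.sqrt_pos.2 Real.two_pi_pos).ne'
  set P : C(AddCircle (2 * Real.pi), ℂ) := ∑ n ∈ Finset.Icc (-(N : ℤ)) (N : ℤ),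
    (((Real.sqrt (2 * Real.pi))⁻¹ : ℂ) * hatCircle u n) • fourier n with hP
  have hae : ∀ᵐ x ∂(AddCircle.haarAddCircle (T := 2 * Real.pi)),
      highPassCircle N u x = u x - P x := by
    have h1 : ∀ᵐ x : AddCircle (2 * Real.pi), highPassCircle N u x = u x - P x := by
      filter_upwards [Lp.coeFn_sub u (ContinuousMap.toLp (E := ℂ) 2 volume ℂ P),
        ContinuousMap.coeFn_toLp (E := ℂ) (p := 2) (𝕜 := ℂ)
          (volume : Measure (AddCircle (2 * Real.pi))) P] with x h1 h2
      rw [highPassCircle, h1, Pi.sub_apply, h2]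
    exact ae_haar_of_ae_circle h1
  have hint : ∀ f : AddCircle (2 * Real.pi) → ℂ, Integrable f AddCircle.haarAddCircle →
      Integrable (fun x => fourier (-n) x • f x) AddCircle.haarAddCircle := fun f hf =>
    hf.bdd_mul (c := 1) (map_continuous (fourier (-n))).aestronglyMeasurable
      (Eventually.of_forall fun x => (Circle.norm_coe _).le)
  have hsub : fourierCoeff (T := 2 * Real.pi) (highPassCircle N u) n =
      fourierCoeff (T := 2 * Real.pi) u n - fourierCoeff (T := 2 * Real.pi) P n := by
    unfold fourierCoeff
    rw [← integral_sub (hint _ ?_) (hint _ ?_)]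
    · refine integral_congr_ae ?_
      filter_upwards [hae] with x hx
      rw [hx, smul_sub]
    · exact ((Lp.memLp u).haarAddCircle).integrable (by norm_num)
    · exact (map_continuous P).integrable_of_hasCompactSupport (HasCompactSupport.of_compactSpace _)
  rw [hatCircle_eq, hsub, hP, fourierCoeff_sum_fourier, hatCircle_eq u n]
  split_ifs
  · rw [← mul_assoc, inv_mul_cancel₀ hs, one_mul, sub_self, mul_zero]
  · rw [sub_zero]

theorem lintegral_comp_div_two_pi {g : ℝ → ℝ≥0∞} (hg : Measurable g) :
    ∫⁻ ξ : ℝ, g (ξ / (2 * Real.pi)) = ENNReal.ofReal (2 * Real.pi) * ∫⁻ ξ, g ξ := by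
  have h := Real.map_volume_mul_left (a := (2 * Real.pi)⁻¹) (inv_pos.2 Real.two_pi_pos).ne'
  rw [inv_inv, abs_of_pos Real.two_pi_pos] at h
  rw [← smul_eq_mul (ENNReal.ofReal _), ← lintegral_smul_measure, ← h, lintegral_map hg (measurable_const_mul _)]
  simp_rw [div_eq_inv_mul]

theorem enorm_hatLine_sq (u : Lp ℂ 2 (volume : Measure ℝ)) (ξ : ℝ) : ‖hatLine u ξ‖ₑ ^ 2 =
    ENNReal.ofReal (2 * Real.pi)⁻¹ * ‖(Lp.fourierTransformₗᵢ ℝ ℂ u) (ξ / (2 * Real.pi))‖ₑ ^ 2 := by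
  rw [hatLine, enorm_mul, mul_pow]
  congr 1
  rw [← Complex.ofReal_inv, ← ofReal_norm, Complex.norm_real, ← ENNReal.ofReal_pow (norm_nonneg _),
    Real.norm_eq_abs, sq_abs, inv_pow, Real.sq_sqrt Real.two_pi_pos.le]

theorem eLpNorm_hatLine (u : Lp ℂ 2 (volume : Measure ℝ)) :
    eLpNorm (hatLine u) 2 volume = ‖u‖ₑ := by
  refine (ENNReal.pow_right_strictMono two_ne_zero).injective ?_
  rw [sq_eLpNorm_two]
  have hm : Measurable fun x : ℝ => ‖(Lp.fourierTransformₗᵢ ℝ ℂ u) x‖ₑ ^ 2 :=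
    (Lp.stronglyMeasurable _).measurable.enorm.pow_const 2
  simp_rw [enorm_hatLine_sq]
  rw [lintegral_const_mul' _ _ ENNReal.ofReal_ne_top, lintegral_comp_div_two_pi hm, ← mul_assoc,
    ← ENNReal.ofReal_mul (inv_pos.2 Real.two_pi_pos).le, inv_mul_cancel₀ Real.two_pi_pos.ne',
    ENNReal.ofReal_one, one_mul, ← sq_eLpNorm_two, ← Lp.enorm_def, LinearIsometryEquiv.enorm_map]

theorem freqNorm_hat (u : M.L2) : freqNorm 2 (hat M u) = ‖u‖ₑ := by
  cases M
  · exact eLpNorm_hatCircle u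
  · exact eLpNorm_hatLine u

theorem hatCircle_highPass_ite (N : ℕ) (u : Lp ℂ 2 (volume : Measure (AddCircle (2 * Real.pi))))
    (n : ℤ) : hatCircle (highPassCircle N u) n = if (N : ℝ) < |(n : ℝ)| then hatCircle u n else 0 := by
  have h : (N : ℝ) < |(n : ℝ)| ↔ ¬ n ∈ Finset.Icc (-(N : ℤ)) (N : ℤ) := by
    rw [Finset.mem_Icc, ← abs_le, not_le]
    exact_mod_cast Iff.rfl
  rw [hatCircle_highPass]
  simp only [h, ite_not]

/-- The cutoff identity holds almost everywhere in the frequency variable η of the underlying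
transform; the scaling ξ = 2πη preserves null sets and carries it to ξ. -/
theorem hatLine_highPass (N : ℕ) (u : Lp ℂ 2 (volume : Measure ℝ)) :
    ∀ᵐ ξ : ℝ, hatLine (highPassLine N u) ξ = if (N : ℝ) < |ξ| then hatLine u ξ else 0 := by
  have hq : Measure.QuasiMeasurePreserving (fun ξ : ℝ => ξ / (2 * Real.pi)) := by
    refine ⟨(measurable_id (α := ℝ)).div_const _, ?_⟩
    have h := Real.map_volume_mul_left (a := (2 * Real.pi)⁻¹) (inv_pos.2 Real.two_pi_pos).ne'
    simp_rw [div_eq_inv_mul]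
    rw [h]
    exact Measure.smul_absolutelyContinuous
  have h1 : (Lp.fourierTransformₗᵢ ℝ ℂ (highPassLine N u)) =ᵐ[(volume : Measure ℝ)]
      Set.indicator {η : ℝ | (N : ℝ) < |2 * Real.pi * η|} (Lp.fourierTransformₗᵢ ℝ ℂ u) := by
    rw [highPassLine, LinearIsometryEquiv.apply_symm_apply]
    exact MemLp.coeFn_toLp _
  filter_upwards [hq.ae h1] with ξ hξ
  rw [hatLine, hξ]
  have h2 : 2 * Real.pi * (ξ / (2 * Real.pi)) = ξ := mul_div_cancel₀ _ Real.two_pi_pos.ne'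
  split_ifs with h
  · rw [Set.indicator_of_mem]
    · rfl
    · rw [Set.mem_ofPred_eq, h2]; exact h
  · rw [Set.indicator_of_notMem, mul_zero]
    rw [Set.mem_ofPred_eq, h2]; exact h

theorem hat_highPass (N : ℕ) (u : M.L2) :
    {ξ | (N : ℝ) < M.mag ξ}.indicator (hat M u) =ᵐ[volume] hat M (highPass M N u) := by
  cases M
  · refine Eventually.of_forall fun n => ?_
    have e := hatCircle_highPass_ite N u n
    by_cases hn : n ∈ {ξ : Geometry.circle.Freq | (N : ℝ) < Geometry.circle.mag ξ}
    · exact (Set.indicator_of_mem hn _).trans (e.trans (if_pos hn)).symm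
    · exact (Set.indicator_of_notMem hn _).trans (e.trans (if_neg hn)).symm
  · refine (hatLine_highPass N u).mono fun ξ e => ?_
    by_cases hn : ξ ∈ {ξ : Geometry.line.Freq | (N : ℝ) < Geometry.line.mag ξ}
    · exact (Set.indicator_of_mem hn _).trans (e.trans (if_pos hn)).symm
    · exact (Set.indicator_of_notMem hn _).trans (e.trans (if_neg hn)).symm

theorem freqNorm_hat_tail (N : ℕ) (u : M.L2) :
    freqNorm 2 ({ξ | (N : ℝ) < M.mag ξ}.indicator (hat M u)) = ‖highPass M N u‖ₑ := by
  rw [← freqNorm_hat]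
  exact eLpNorm_congr_ae (hat_highPass N u)

/-! ### Integrability -/

theorem sqNorm_enorm (f : M.Freq → ℂ) : sqNorm (fun x => ‖f x‖ₑ) = freqNorm 2 f ^ 2 := by
  rw [freqNorm, sq_eLpNorm_two]
  rfl

theorem eLpNorm_eq_sqNorm (f : M.Freq → ℝ≥0∞) : eLpNorm f 2 volume ^ 2 = sqNorm f := by
  rw [sq_eLpNorm_two]
  rfl

theorem enorm_finsetProd {ι : Type*} (s : Finset ι) (x : ι → ℂ) : ‖∏ a ∈ s, x a‖ₑ = ∏ a ∈ s, ‖x a‖ₑ := by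
  classical
  induction s using Finset.induction_on with
  | empty => simp
  | insert a s ha ih => rw [Finset.prod_insert ha, Finset.prod_insert ha, enorm_mul, ih]

theorem enorm_leafProd {j : ℕ} (T : OrderedTree (j + 1)) (ξ : M.Freq) (η : Fin (j + 1) → M.Freq)
    (u : M.L2) : ‖T.leafProd ξ η u‖ₑ = ∏ a ∈ T.terminal, ‖hat M u (T.freq ξ η a)‖ₑ := by
  rw [OrderedTree.leafProd, ← OrderedTree.terminal_eq_leaves]
  exact enorm_finsetProd _ _

theorem freeForm_lt_top {j : ℕ} (T : OrderedTree (j + 1)) {m : ℕ → ℝ} (hm : ∀ k, 1 ≤ m k)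
    {f : Node → M.Freq → ℝ≥0∞} (hf : ∀ a, Measurable (f a)) (hfin : ∀ a, sqNorm (f a) < ∞)
    (ξ : M.Freq) : T.freeForm m f ξ < ∞ := by
  have h := T.sq_freeForm_le hm hf ξ
  have h2 : (T.freeForm m f ξ) ^ 2 < ∞ := by
    refine h.trans_lt ?_
    refine ENNReal.mul_lt_top (ENNReal.mul_lt_top ?_ ?_) ENNReal.ofReal_lt_top
    · exact ENNReal.prod_lt_top fun _ _ => ENNReal.ofReal_lt_top
    · exact ENNReal.prod_lt_top fun a _ => hfin a
  by_contra h3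
  rw [not_lt, top_le_iff] at h3
  rw [h3] at h2
  simp at h2

/-- The majorant is bounded pointwise in ξ, so absolute convergence holds at every ξ and not only
almost everywhere. -/
theorem integrable_mul_leafProd {j : ℕ} (T : OrderedTree (j + 1)) {K : ℝ} (hK : 1 ≤ K)
    {c : M.Freq → (Fin (j + 1) → M.Freq) → ℂ}
    (hc : Measurable fun p : M.Freq × (Fin (j + 1) → M.Freq) => c p.1 p.2) {C : ℝ≥0∞} (hC : C ≠ ∞)
    (hle : ∀ ξ η, ‖c ξ η‖ₑ ≤ C * T.freeKernel K ξ η) (u : M.L2) (ξ : M.Freq) :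
    Integrable fun η => c ξ η * T.leafProd ξ η u := by
  refine ⟨((hc.mul (T.measurable_leafProd u)).comp measurable_prodMk_left).aestronglyMeasurable, ?_⟩
  rw [hasFiniteIntegral_iff_enorm]
  have hm : ∀ a : Node, Measurable fun x => ‖hat M u x‖ₑ := fun _ => (measurable_hat u).enorm
  calc ∫⁻ η, ‖c ξ η * T.leafProd ξ η u‖ₑ
      ≤ ∫⁻ η, C * (T.freeKernel K ξ η * ∏ a ∈ T.terminal, ‖hat M u (T.freq ξ η a)‖ₑ) := by
        refine lintegral_mono fun η => ?_
        rw [enorm_mul, enorm_leafProd, ← mul_assoc]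
        exact mul_le_mul_left (hle ξ η) _
    _ = C * T.freeForm (threshold K) (fun _ x => ‖hat M u x‖ₑ) ξ := by
        rw [lintegral_const_mul' _ _ hC]
        exact congrArg (C * ·) (T.lintegral_freeKernel K (fun _ x => ‖hat M u x‖ₑ) ξ)
    _ < ∞ := by
        refine ENNReal.mul_lt_top hC.lt_top
          (freeForm_lt_top T (fun k => one_le_threshold hK k) hm (fun _ => ?_) ξ)
        rw [sqNorm_enorm, freqNorm_hat]
        exact ENNReal.pow_lt_top enorm_lt_top

theorem enorm_phaseDiff_le_two (δ t x y z : ℝ) : ‖phaseDiff δ t x y z‖ₑ ≤ 2 := by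
  unfold phaseDiff
  refine (enorm_sub_le).trans ?_
  rw [← ofReal_norm, ← ofReal_norm, mul_comm, Complex.norm_exp_ofReal_mul_I, mul_comm,
    Complex.norm_exp_ofReal_mul_I, ENNReal.ofReal_one]
  norm_num

/-! ### Differences of multilinear forms -/

/-- Telescoping: each term changes one factor, and the others, which are x or y depending on the
order, are bounded by |x| + |y|. Every term is again a product over the leaves, to which the
multilinear bounds apply. -/
theorem enorm_prod_sub_prod_le {ι : Type*} [DecidableEq ι] (s : Finset ι) (x y : ι → ℂ) :
    ‖∏ a ∈ s, x a - ∏ a ∈ s, y a‖ₑ ≤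
      ∑ a ∈ s, ∏ b ∈ s, if b = a then ‖x b - y b‖ₑ else ‖x b‖ₑ + ‖y b‖ₑ := by
  induction s using Finset.induction_on with
  | empty => simp
  | insert a s ha ih =>
    rw [Finset.prod_insert ha, Finset.prod_insert ha, Finset.sum_insert ha]
    have e : x a * ∏ b ∈ s, x b - y a * ∏ b ∈ s, y b =
        (x a - y a) * ∏ b ∈ s, x b + y a * (∏ b ∈ s, x b - ∏ b ∈ s, y b) := by ring
    rw [e]
    refine (enorm_add_le _ _).trans (add_le_add ?_ ?_)
    · rw [enorm_mul, Finset.prod_insert ha, if_pos rfl]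
      refine mul_le_mul_right ?_ _
      rw [show ‖∏ b ∈ s, x b‖ₑ = ∏ b ∈ s, ‖x b‖ₑ from enorm_finsetProd _ _]
      refine Finset.prod_le_prod' fun b hb => ?_
      have hba : b ≠ a := fun h => ha (h ▸ hb)
      rw [if_neg hba]
      exact le_self_add
    · rw [enorm_mul]
      refine (mul_le_mul_right ih _).trans ?_
      rw [Finset.mul_sum]
      refine Finset.sum_le_sum fun c hc => ?_
      have hac : a ≠ c := fun h => ha (h ▸ hc)
      rw [Finset.prod_insert ha, if_neg hac]
      exact mul_le_mul_left le_add_self _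

/-- The modulus of the difference of two functions at the node `a`, the sum of the moduli at all
other nodes. -/
def diffLeaf (u v : M.L2) (a b : Node) (x : M.Freq) : ℝ≥0∞ :=
  if b = a then ‖hat M u x - hat M v x‖ₑ else ‖hat M u x‖ₑ + ‖hat M v x‖ₑ

theorem measurable_diffLeaf (u v : M.L2) (a b : Node) : Measurable (diffLeaf u v a b) := by
  unfold diffLeaf
  split_ifs
  · exact ((measurable_hat u).sub (measurable_hat v)).enorm
  · exact (measurable_hat u).enorm.add (measurable_hat v).enorm

theorem prod_sqNorm_diffLeaf_le {j : ℕ} (T : OrderedTree j) (u v : M.L2) {a : Node}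
    (ha : a ∈ T.terminal) : ∏ b ∈ T.terminal, sqNorm (diffLeaf u v a b) ≤
      ((freqNorm 2 (hat M u) + freqNorm 2 (hat M v)) ^ j * freqNorm 2 (hat M u - hat M v)) ^ 2 := by
  have h1 : sqNorm (diffLeaf u v a a) = freqNorm 2 (hat M u - hat M v) ^ 2 := by
    rw [← sqNorm_enorm]
    refine congrArg sqNorm (funext fun x => ?_)
    rw [diffLeaf, if_pos rfl, Pi.sub_apply]
  have h2 : ∀ b ∈ T.terminal.erase a, sqNorm (diffLeaf u v a b) ≤
      (freqNorm 2 (hat M u) + freqNorm 2 (hat M v)) ^ 2 := fun b hb => by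
    have e : diffLeaf u v a b = (fun x => ‖hat M u x‖ₑ) + fun x => ‖hat M v x‖ₑ := by
      funext x
      rw [diffLeaf, if_neg (Finset.ne_of_mem_erase hb), Pi.add_apply]
    rw [e, ← eLpNorm_eq_sqNorm]
    have h3 := eLpNorm_add_le (μ := (volume : Measure M.Freq)) (p := 2)
      (measurable_hat u).enorm.aestronglyMeasurable (measurable_hat v).enorm.aestronglyMeasurable
      (by norm_num)
    rw [eLpNorm_enorm, eLpNorm_enorm] at h3
    exact pow_le_pow_left' h3 2
  rw [← Finset.mul_prod_erase _ _ ha, h1, mul_pow, mul_comm, ← pow_mul, mul_comm j, pow_mul]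
  refine mul_le_mul_left ((Finset.prod_le_prod' h2).trans (le_of_eq ?_)) _
  rw [Finset.prod_const, Finset.card_erase_of_mem ha, T.card_terminal, Nat.add_sub_cancel]

/-- Passage from a multilinear L² bound for each tree, with arbitrary leaf functions, to a Lipschitz
bound for the operator: the cost is the number of trees times the j+2 leaves at which the difference
can sit. -/
theorem freqNorm_sum_sub_le {j : ℕ} {c : OrderedTree (j + 1) → M.Freq → (Fin (j + 1) → M.Freq) → ℂ}
    (hc : ∀ T, Measurable fun p : M.Freq × (Fin (j + 1) → M.Freq) => c T p.1 p.2) {A : ℝ≥0∞}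
    (hA : ∀ (T : OrderedTree (j + 1)) (f : Node → M.Freq → ℝ≥0∞), (∀ a, Measurable (f a)) →
      sqNorm (T.absForm (c T) f) ≤ A ^ 2 * ∏ a ∈ T.terminal, sqNorm (f a))
    (hint : ∀ (T : OrderedTree (j + 1)) (u : M.L2) ξ, Integrable fun η => c T ξ η * T.leafProd ξ η u)
    {s : ℂ} (hs : ‖s‖ₑ ≤ 1) (u v : M.L2) :
    freqNorm 2 ((fun ξ => s * ∑ T : OrderedTree (j + 1), ∫ η, c T ξ η * T.leafProd ξ η u) -
        fun ξ => s * ∑ T : OrderedTree (j + 1), ∫ η, c T ξ η * T.leafProd ξ η v) ≤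
      (Fintype.card (OrderedTree (j + 1)) * (j + 2 : ℕ) : ℝ≥0∞) * A *
        (freqNorm 2 (hat M u) + freqNorm 2 (hat M v)) ^ (j + 1) *
          freqNorm 2 (hat M u - hat M v) := by
  have hpt : ∀ ξ, ‖((fun ξ => s * ∑ T : OrderedTree (j + 1), ∫ η, c T ξ η * T.leafProd ξ η u) -
        fun ξ => s * ∑ T : OrderedTree (j + 1), ∫ η, c T ξ η * T.leafProd ξ η v) ξ‖ₑ ≤
      ‖∑ T : OrderedTree (j + 1), (∑ a ∈ T.terminal, T.absForm (c T) (diffLeaf u v a)) ξ‖ₑ := by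
    intro ξ
    rw [Pi.sub_apply, ← mul_sub, ← Finset.sum_sub_distrib, enorm_mul, enorm_eq_self]
    refine (mul_le_mul_left hs _).trans ?_
    rw [one_mul]
    refine (enorm_sum_le _ _).trans (Finset.sum_le_sum fun T _ => ?_)
    rw [← integral_sub (hint T u ξ) (hint T v ξ), Finset.sum_apply]
    refine (enorm_integral_le_lintegral_enorm _).trans ?_
    unfold OrderedTree.absForm
    rw [← lintegral_finsetSum]
    · refine lintegral_mono fun η => ?_
      rw [← mul_sub, enorm_mul, ← Finset.mul_sum, OrderedTree.leafProd, OrderedTree.leafProd,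
        ← OrderedTree.terminal_eq_leaves]
      exact mul_le_mul_right (enorm_prod_sub_prod_le _ _ _) _
    · intro a _
      exact ((hc T).comp measurable_prodMk_left).enorm.mul (Finset.measurable_prod _ fun b _ =>
        (measurable_diffLeaf u v a b).comp (T.measurable_freq_right ξ b))
  have hone : ∀ T : OrderedTree (j + 1), ∀ a ∈ T.terminal,
      eLpNorm (T.absForm (c T) (diffLeaf u v a)) 2 volume ≤
      A * ((freqNorm 2 (hat M u) + freqNorm 2 (hat M v)) ^ (j + 1) *
          freqNorm 2 (hat M u - hat M v)) := by
    intro T a ha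
    rw [← ENNReal.pow_le_pow_left_iff two_ne_zero, eLpNorm_eq_sqNorm, mul_pow]
    exact (hA T _ (measurable_diffLeaf u v a)).trans
      (mul_le_mul_right (prod_sqNorm_diffLeaf_le T u v ha) _)
  have hmeas : ∀ (T : OrderedTree (j + 1)) (a : Node),
      AEStronglyMeasurable (T.absForm (c T) (diffLeaf u v a)) volume := fun T a =>
    (T.measurable_absForm (hc T) (measurable_diffLeaf u v a)).aestronglyMeasurable
  refine (eLpNorm_mono_enorm (g := ∑ T : OrderedTree (j + 1), ∑ a ∈ T.terminal,
    T.absForm (c T) (diffLeaf u v a)) fun ξ => ?_).trans ?_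
  · rw [Finset.sum_apply]
    exact hpt ξ
  refine (eLpNorm_sum_le (fun T _ => Finset.aestronglyMeasurable_sum _ fun a _ => hmeas T a)
    (by norm_num)).trans ?_
  calc _ ≤ ∑ T : OrderedTree (j + 1), ((j + 2 : ℕ) : ℝ≥0∞) *
        (A * ((freqNorm 2 (hat M u) + freqNorm 2 (hat M v)) ^ (j + 1) *
          freqNorm 2 (hat M u - hat M v))) := by
        refine Finset.sum_le_sum fun T _ => ?_
        refine (eLpNorm_sum_le (fun a _ => hmeas T a) (by norm_num)).trans ?_
        refine (Finset.sum_le_card_nsmul _ _ _ (hone T)).trans (le_of_eq ?_)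
        rw [T.card_terminal, nsmul_eq_mul]
    _ = _ := by
        rw [Finset.sum_const, Finset.card_univ, nsmul_eq_mul]
        ring

/-! ### Convergence of the phases -/

/-- y coth y = 1 + y²/3 + O(y⁴), made quantitative by multiplying with sinh y and inserting the
Taylor polynomials of exp. -/
theorem abs_coth_expansion {y : ℝ} (h0 : y ≠ 0) (hy : |y| ≤ 1) :
    |3 * (y * (Real.cosh y / Real.sinh y) - 1) - y ^ 2| ≤ y ^ 4 := by
  have key : ∀ z : ℝ, 0 < z → z ≤ 1 →
      |3 * (z * (Real.cosh z / Real.sinh z) - 1) - z ^ 2| ≤ z ^ 4 := by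
    intro z hz hz1
    have hs : z ≤ Real.sinh z := Real.self_le_sinh_iff.2 hz.le
    have hspos : 0 < Real.sinh z := hz.trans_le hs
    have e1 := Real.exp_bound (x := z) (by rw [abs_of_pos hz]; exact hz1) (n := 5) (by norm_num)
    have e2 := Real.exp_bound (x := -z) (by rw [abs_neg, abs_of_pos hz]; exact hz1) (n := 5)
      (by norm_num)
    rw [abs_neg] at e2
    rw [abs_of_pos hz] at e1 e2
    simp only [Finset.sum_range_succ, Finset.sum_range_zero, Nat.factorial] at e1 e2
    norm_num at e1 e2
    rw [abs_le] at e1 e2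
    have hc := Real.cosh_eq z
    have hsn := Real.sinh_eq z
    have ec : |Real.cosh z - (1 + z ^ 2 / 2 + z ^ 4 / 24)| ≤ z ^ 5 / 100 := by
      rw [abs_le, hc]; constructor <;> nlinarith [e1.1, e1.2, e2.1, e2.2]
    have es : |Real.sinh z - (z + z ^ 3 / 6)| ≤ z ^ 5 / 100 := by
      rw [abs_le, hsn]; constructor <;> nlinarith [e1.1, e1.2, e2.1, e2.2]
    -- The Taylor polynomials of cosh and sinh cancel up to −z⁵/24; the rest are their remainders.
    -- In total 3/100 + 4/100 + 1/24 < 1, and sinh z ≥ z turns z⁵ into z⁴ sinh z.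
    have e : 3 * (z * (Real.cosh z / Real.sinh z) - 1) - z ^ 2 =
        (3 * z * (Real.cosh z - (1 + z ^ 2 / 2 + z ^ 4 / 24)) -
          (3 + z ^ 2) * (Real.sinh z - (z + z ^ 3 / 6)) - z ^ 5 / 24) / Real.sinh z := by
      field_simp
      ring
    rw [e, abs_div, abs_of_pos hspos, div_le_iff₀ hspos]
    have h5 : 0 < z ^ 5 := by positivity
    have a1 : |3 * z * (Real.cosh z - (1 + z ^ 2 / 2 + z ^ 4 / 24))| ≤ 3 * (z ^ 5 / 100) := by
      rw [abs_mul, abs_of_pos (by positivity : 0 < 3 * z)]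
      exact mul_le_mul (by linarith) ec (abs_nonneg _) (by norm_num)
    have a2 : |(3 + z ^ 2) * (Real.sinh z - (z + z ^ 3 / 6))| ≤ 4 * (z ^ 5 / 100) := by
      rw [abs_mul, abs_of_pos (by positivity : 0 < 3 + z ^ 2)]
      exact mul_le_mul (by nlinarith) es (abs_nonneg _) (by norm_num)
    have h6 : z ^ 4 * z ≤ z ^ 4 * Real.sinh z := mul_le_mul_of_nonneg_left hs (by positivity)
    have h7 : z ^ 5 ≤ z ^ 4 * Real.sinh z := by linarith [show z ^ 4 * z = z ^ 5 by ring]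
    rw [abs_le] at a1 a2 ⊢
    constructor <;> linarith [a1.1, a1.2, a2.1, a2.2]
  rcases lt_or_gt_of_ne h0 with h | h
  · have := key (-y) (by linarith) (by rw [abs_of_neg h] at hy; exact hy)
    rw [Real.cosh_neg, Real.sinh_neg, div_neg, neg_mul_neg, neg_sq, Even.neg_pow (by decide)] at this
    exact this
  · exact key y h (by rwa [abs_of_pos h] at hy)

theorem abs_symbolILW_sub_sq_le {δ x : ℝ} (hδ : 0 < δ) (h : |δ * x| ≤ 1) :
    |symbolILW δ x - x ^ 2| ≤ δ ^ 2 * x ^ 4 := by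
  unfold symbolILW
  split_ifs with h0
  · simp [h0]
  · have h1 := abs_coth_expansion (mul_ne_zero hδ.ne' h0) h
    set c := Real.cosh (δ * x) / Real.sinh (δ * x)
    have e : 3 / δ * (x * c - 1 / δ) - x ^ 2 = (3 * (δ * x * c - 1) - (δ * x) ^ 2) / δ ^ 2 := by
      field_simp
    rw [e, abs_div, abs_of_pos (by positivity : 0 < δ ^ 2), div_le_iff₀ (by positivity)]
    refine h1.trans (le_of_eq ?_)
    ring

/-- A common unimodular factor is pulled out and |e^{ia} − 1| ≤ |a| is applied to the difference of
the resonance functions, a sum of three terms of size δ²B⁵. -/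
theorem norm_phaseDiff_le {δ t B x y : ℝ} (hδ : 0 < δ) (hB : δ * B ≤ 1) (hx : |x| ≤ B)
    (hy : |y| ≤ B) (hxy : |x + y| ≤ B) :
    ‖phaseDiff δ t (x + y) x y‖ ≤ |t| * (3 * (δ ^ 2 * B ^ 5)) := by
  have hB0 : 0 ≤ B := (abs_nonneg x).trans hx
  have h1 : ∀ z : ℝ, |z| ≤ B → |z * symbolILW δ z - z ^ 3| ≤ δ ^ 2 * B ^ 5 := by
    intro z hz
    have h2 : |δ * z| ≤ 1 := by
      rw [abs_mul, abs_of_pos hδ]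
      exact (mul_le_mul_of_nonneg_left hz hδ.le).trans hB
    have h3 := abs_symbolILW_sub_sq_le hδ h2
    have h4 : z * symbolILW δ z - z ^ 3 = z * (symbolILW δ z - z ^ 2) := by ring
    have h5 : z ^ 4 ≤ B ^ 4 := by
      rw [← Even.pow_abs (by decide : Even 4) z]
      exact pow_le_pow_left₀ (abs_nonneg _) hz 4
    rw [h4, abs_mul]
    calc |z| * |symbolILW δ z - z ^ 2| ≤ B * (δ ^ 2 * B ^ 4) :=
          mul_le_mul hz (h3.trans (mul_le_mul_of_nonneg_left h5 (sq_nonneg _))) (abs_nonneg _) hB0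
      _ = _ := by ring
  have h2 : |resILW δ (x + y) x y - resKdV (x + y) x y| ≤ 3 * (δ ^ 2 * B ^ 5) := by
    have a0 := h1 _ hxy
    have a1 := h1 _ hx
    have a2 := h1 _ hy
    unfold resILW resKdV
    rw [abs_le] at a0 a1 a2 ⊢
    constructor <;> linarith [a0.1, a0.2, a1.1, a1.2, a2.1, a2.2]
  have h3 : phaseDiff δ t (x + y) x y =
      Complex.exp (Complex.I * ((t * resKdV (x + y) x y : ℝ) : ℂ)) *
        (Complex.exp (Complex.I *
          ((t * (resILW δ (x + y) x y - resKdV (x + y) x y) : ℝ) : ℂ)) - 1) := by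
    rw [phaseDiff, mul_sub, mul_one, ← Complex.exp_add]
    congr 2
    push_cast
    ring
  rw [h3, norm_mul, mul_comm Complex.I, Complex.norm_exp_ofReal_mul_I, one_mul]
  refine (Real.norm_exp_I_mul_ofReal_sub_one_le).trans ?_
  rw [Real.norm_eq_abs, abs_mul]
  exact mul_le_mul_of_nonneg_left h2 (abs_nonneg t)

/-! ### Counting trees and summing constants -/

namespace OrderedTree

theorem init_last_injective {j : ℕ} {T S : OrderedTree (j + 1)} (h : T.init = S.init)
    (hl : T.last = S.last) : T = S := by
  have hb : T.branch = S.branch := by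
    funext k
    refine Fin.lastCases hl (fun i => ?_) k
    exact congrFun (congrArg branch h) i
  cases T
  cases S
  simpa using hb

/-- A tree is determined by its truncation and by the leaf branched last, one of j+1. -/
theorem card_le_factorial (j : ℕ) : Fintype.card (OrderedTree j) ≤ j.factorial := by
  induction j with
  | zero =>
    refine Fintype.card_le_one_iff.2 fun T S => ?_
    have hb : T.branch = S.branch := Subsingleton.elim _ _
    cases T
    cases S
    simpa using hb
  | succ j ih =>
    have h := Fintype.card_le_of_injective
      (fun T : OrderedTree (j + 1) =>
        (⟨T.init, ⟨T.last, T.last_mem_terminal_init⟩⟩ : Σ S : OrderedTree j, S.terminal))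
      (fun T S hTS => by
        have h1 : T.init = S.init := congrArg Sigma.fst hTS
        refine init_last_injective h1 ?_
        exact congrArg (fun p : Σ S : OrderedTree j, S.terminal => (p.2 : Node)) hTS)
    refine h.trans ?_
    rw [Fintype.card_sigma]
    simp_rw [Fintype.card_coe, card_terminal]
    rw [Finset.sum_const, Finset.card_univ, smul_eq_mul, Nat.factorial_succ, mul_comm]
    exact Nat.mul_le_mul_left _ ih

end OrderedTree

/-- A rapidly decreasing sequence that dominates all the constants. -/
def decay (C : ℝ) (n : ℕ) : ℝ :=
  ((n + 4).factorial : ℝ) * ∏ k ∈ Finset.range n, C / ((k + 3).factorial : ℝ)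

theorem decay_pos {C : ℝ} (hC : 0 < C) (n : ℕ) : 0 < decay C n := by
  unfold decay
  refine mul_pos (by positivity) (Finset.prod_pos fun k _ => by positivity)

/-- Ratio test: consecutive terms have quotient C(n+5)/(n+3)!, so any constant per generation,
including powers of the radius R, is absorbed. -/
theorem summable_decay {C : ℝ} (hC : 0 < C) : Summable (decay C) := by
  refine summable_of_ratio_test_tendsto_lt_one (l := 0) one_pos
    (Eventually.of_forall fun n => (decay_pos hC n).ne') ?_
  have h1 : ∀ n : ℕ, ‖decay C (n + 1)‖ / ‖decay C n‖ = C * (n + 5) / ((n + 3).factorial : ℝ) := by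
    intro n
    rw [Real.norm_of_nonneg (decay_pos hC _).le, Real.norm_of_nonneg (decay_pos hC _).le,
      div_eq_iff (decay_pos hC n).ne']
    unfold decay
    rw [Finset.prod_range_succ, show n + 1 + 4 = (n + 4) + 1 by ring, Nat.factorial_succ]
    push_cast
    ring
  simp_rw [h1]
  have h2 : ∀ n : ℕ, C * ((n : ℝ) + 5) / ((n + 3).factorial : ℝ) ≤ 5 * C / ((n + 1 : ℕ) : ℝ) := by
    intro n
    have h3 : ((n : ℝ) + 5) * (n + 1) ≤ 5 * ((n + 3).factorial : ℝ) := by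
      have : ((n + 3).factorial : ℝ) = (n + 3) * ((n + 2) * ((n + 1) * (n.factorial : ℝ))) := by
        rw [Nat.factorial_succ, Nat.factorial_succ, Nat.factorial_succ]
        push_cast; ring
      have h4 : (1 : ℝ) ≤ n.factorial := by exact_mod_cast Nat.factorial_pos n
      have h5 : (0 : ℝ) ≤ n := Nat.cast_nonneg n
      rw [this]
      have h6 : ((n : ℝ) + 3) * ((n + 2) * (n + 1)) ≤
          (n + 3) * ((n + 2) * ((n + 1) * (n.factorial : ℝ))) := by
        gcongr
        exact le_mul_of_one_le_right (by positivity) h4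
      nlinarith [mul_nonneg h5 h5, mul_nonneg (mul_nonneg h5 h5) h5]
    rw [div_le_div_iff₀ (by positivity) (by positivity)]
    push_cast
    nlinarith
  refine squeeze_zero (fun n => by positivity) h2 ?_
  exact (tendsto_const_div_atTop_nhds_zero_nat (5 * C)).comp (tendsto_add_atTop_nat 1)

theorem exists_decay_le {C : ℝ} (hC : 0 < C) : ∃ B : ℝ, 0 < B ∧ ∀ n, decay C n ≤ B := by
  obtain ⟨B, hB⟩ := (summable_decay hC).tendsto_atTop_zero.bddAbove_range
  exact ⟨B, (decay_pos hC 0).trans_le (hB ⟨0, rfl⟩), fun n => hB ⟨n, rfl⟩⟩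

/-! ### Convergence and measurability -/

theorem opN0_eq (K : ℝ) (j : ℕ) (t : ℝ) (u : M.L2) : opN0 K j t u = fun ξ =>
    (-1) ^ (j - 1) * ∑ T : OrderedTree j, ∫ η, T.coefN0 K t ξ η * T.leafProd ξ η u := by
  funext ξ
  simp only [opN0, OrderedTree.integrandN0_eq]

theorem opN1_eq (K : ℝ) (j : ℕ) (t : ℝ) (u : M.L2) : opN1 K j t u = fun ξ =>
    (-1) ^ (j - 1) * ∑ T : OrderedTree j, ∫ η, T.coefN1 K t ξ η * T.leafProd ξ η u := by
  funext ξ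
  simp only [opN1, OrderedTree.integrandN1_eq]

theorem opN2_eq (K : ℝ) (j : ℕ) (t : ℝ) (u : M.L2) : opN2 K j t u = fun ξ =>
    (-1) ^ (j - 1) * ∑ T : OrderedTree j, ∫ η, T.coefN2 K t ξ η * T.leafProd ξ η u := by
  funext ξ
  simp only [opN2, OrderedTree.integrandN2_eq]

theorem opE_eq (K δ : ℝ) (j : ℕ) (t : ℝ) (u : M.L2) : opE K δ j t u = fun ξ =>
    (-1) ^ (j - 1) * ∑ T : OrderedTree j, ∫ η, T.coefE K t δ ξ η * T.leafProd ξ η u := by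
  funext ξ
  simp only [opE, OrderedTree.integrandE_eq]

theorem enorm_neg_one_pow (n : ℕ) : ‖((-1) ^ n : ℂ)‖ₑ = 1 := by
  rw [enorm_pow, enorm_neg, enorm_one, one_pow]

theorem integrable_coefN0 {j : ℕ} (T : OrderedTree (j + 1)) {K : ℝ} (hK : 1 ≤ K) (t : ℝ)
    (u : M.L2) (ξ : M.Freq) :
    Integrable fun η => T.coefN0 K t ξ η * T.leafProd ξ η u :=
  integrable_mul_leafProd T hK (T.measurable_coefN0 K t) ENNReal.one_ne_top
    (fun ξ η => by rw [one_mul]; exact T.enorm_coefN0_le_freeKernel hK t ξ η) u ξ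

theorem integrable_coefN1 {j : ℕ} (T : OrderedTree (j + 1)) {K : ℝ} (hK : 1 ≤ K) (t : ℝ)
    (u : M.L2) (ξ : M.Freq) :
    Integrable fun η => T.coefN1 K t ξ η * T.leafProd ξ η u :=
  integrable_mul_leafProd T hK (T.measurable_coefN1 K t) ENNReal.one_ne_top
    (fun ξ η => by rw [one_mul]; exact T.enorm_coefN1_le_freeKernel hK t ξ η) u ξ

theorem integrable_coefN2 {j : ℕ} (T : OrderedTree (j + 1)) {K : ℝ} (hK : 1 ≤ K) (t : ℝ)
    (u : M.L2) (ξ : M.Freq) :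
    Integrable fun η => T.coefN2 K t ξ η * T.leafProd ξ η u :=
  integrable_mul_leafProd T hK (T.measurable_coefN2 K t) ENNReal.one_ne_top
    (fun ξ η => by rw [one_mul]; exact T.enorm_coefN2_le_freeKernel hK t ξ η) u ξ

theorem integrable_coefE {j : ℕ} (T : OrderedTree (j + 1)) {K : ℝ} (hK : 1 ≤ K) (t : ℝ)
    (u : M.L2) (ξ : M.Freq) (δ : ℝ) :
    Integrable fun η => T.coefE K t δ ξ η * T.leafProd ξ η u :=
  integrable_mul_leafProd T hK (T.measurable_coefE K t δ) ENNReal.ofNat_ne_top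
    (fun ξ η => (T.enorm_coefE_le_freeKernel hK t δ ξ η).trans
      (mul_le_mul_left (enorm_phaseDiff_le_two _ _ _ _ _) _)) u ξ

/-! ### Lipschitz bounds -/

theorem inv_sq_pow_le_rpow {K : ℝ} (hK : 1 ≤ K) (m : ℕ) {e : ℝ} (he : -(2 * (m : ℝ)) ≤ e) :
    ((K ^ 2)⁻¹) ^ m ≤ K ^ e := by
  have hK0 : 0 < K := zero_lt_one.trans_le hK
  have h : ((K ^ 2)⁻¹) ^ m = K ^ (-(2 * (m : ℝ))) := by
    rw [Real.rpow_neg hK0.le, show 2 * (m : ℝ) = ((2 * m : ℕ) : ℝ) by push_cast; ring,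
      Real.rpow_natCast, pow_mul, inv_pow]
  rw [h]
  exact Real.rpow_le_rpow_of_exponent_le hK he

/-- 80 · 96 = 7680 ≤ 88². After the square root each generation offers K^(−2) and an inverse squared
factorial, of which one power is enough against the number of trees. -/
theorem prod_threshold_le {K : ℝ} (hK : 1 ≤ K) (n : ℕ) :
    ∏ k ∈ Finset.range n, ENNReal.ofReal (80 / threshold K k) ≤
      ENNReal.ofReal (((K ^ 2)⁻¹) ^ n * ∏ k ∈ Finset.range n, 88 / ((k + 3).factorial : ℝ)) ^ 2 := by
  have hK0 : 0 < K := zero_lt_one.trans_le hK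
  have e : ((K ^ 2)⁻¹) ^ n * ∏ k ∈ Finset.range n, 88 / ((k + 3).factorial : ℝ) =
      ∏ k ∈ Finset.range n, (K ^ 2)⁻¹ * (88 / ((k + 3).factorial : ℝ)) := by
    rw [Finset.prod_mul_distrib, Finset.prod_const, Finset.card_range]
  rw [e, ENNReal.ofReal_prod_of_nonneg (fun _ _ => by positivity), ← Finset.prod_pow]
  refine Finset.prod_le_prod' fun k _ => ?_
  rw [← ENNReal.ofReal_pow (by positivity)]
  apply ENNReal.ofReal_le_ofReal
  have hF : (1 : ℝ) ≤ ((k + 3).factorial : ℝ) := by exact_mod_cast Nat.factorial_pos _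
  unfold threshold
  set F := ((k + 3).factorial : ℝ)
  have e2 : ((K ^ 2)⁻¹ * (88 / F)) ^ 2 = 7744 / (K ^ 4 * F ^ 2) := by
    field_simp
    norm_num
  rw [e2, div_div_eq_mul_div, div_le_div_iff₀ (by positivity) (by positivity)]
  have h1 : F ^ 2 ≤ F ^ 4 := pow_le_pow_right₀ hF (by norm_num)
  have h2 : K ^ 4 * F ^ 2 ≤ K ^ 4 * F ^ 4 := mul_le_mul_of_nonneg_left h1 (by positivity)
  have h3 : 0 ≤ K ^ 4 * F ^ 4 := by positivity
  linarith

theorem card_mul_le (n : ℕ) (a : ℝ) :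
    (Fintype.card (OrderedTree (n + 1)) * (n + 2 : ℕ) : ℝ≥0∞) * ENNReal.ofReal a ≤
      ENNReal.ofReal (((n + 2).factorial : ℝ) * a) := by
  rw [ENNReal.ofReal_mul (by positivity), ENNReal.ofReal_natCast]
  refine mul_le_mul_left ?_ _
  have h := Nat.mul_le_mul_right (n + 2) (OrderedTree.card_le_factorial (n + 1))
  rw [mul_comm (n + 1).factorial, ← Nat.factorial_succ] at h
  exact_mod_cast h

theorem exists_freqNorm_opN0_sub_le {θ : ℝ} (hθ : θ < 1 / 2) :
    ∃ C : ℝ, 0 < C ∧ ∀ K : ℝ, 1 ≤ K → ∀ (n : ℕ) (t : ℝ) (u v : M.L2),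
      freqNorm 2 (opN0 K (n + 1) t u - opN0 K (n + 1) t v) ≤
        ENNReal.ofReal (C * K ^ (-(4 * ((n + 1 : ℕ) : ℝ) * θ))) *
          (freqNorm 2 (hat M u) + freqNorm 2 (hat M v)) ^ (n + 1) *
            freqNorm 2 (hat M u - hat M v) := by
  obtain ⟨B, hB0, hB⟩ := exists_decay_le (C := 88) (by norm_num)
  refine ⟨B, hB0, fun K hK n t u v => ?_⟩
  have hK0 : 0 < K := zero_lt_one.trans_le hK
  rw [opN0_eq, opN0_eq]
  set P := ∏ k ∈ Finset.range (n + 1), 88 / ((k + 3).factorial : ℝ) with hP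
  have hP0 : 0 ≤ P := Finset.prod_nonneg fun _ _ => by positivity
  have hmain := freqNorm_sum_sub_le (fun T => T.measurable_coefN0 (M := M) K t)
    (A := ENNReal.ofReal (((K ^ 2)⁻¹) ^ (n + 1) * P))
    (fun T f hf => (T.sqNorm_absForm_coefN0_le hK t hf).trans
      (mul_le_mul_left (prod_threshold_le hK (n + 1)) _))
    (fun T u ξ => integrable_coefN0 T hK t u ξ) (enorm_neg_one_pow (n + 1 - 1)).le u v
  refine hmain.trans (mul_le_mul_left (mul_le_mul_left ((card_mul_le n _).trans
    (ENNReal.ofReal_le_ofReal ?_)) _) _)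
  have h1 : ((n + 2).factorial : ℝ) ≤ ((n + 1 + 4).factorial : ℝ) := by
    exact_mod_cast Nat.factorial_le (by omega)
  have h2 : ((n + 2).factorial : ℝ) * P ≤ B :=
    (mul_le_mul_of_nonneg_right h1 hP0).trans (hB (n + 1))
  have h3 : ((K ^ 2)⁻¹) ^ (n + 1) ≤ K ^ (-(4 * ((n + 1 : ℕ) : ℝ) * θ)) := by
    refine inv_sq_pow_le_rpow hK (n + 1) ?_
    have : (0 : ℝ) ≤ ((n + 1 : ℕ) : ℝ) := Nat.cast_nonneg _
    nlinarith
  calc ((n + 2).factorial : ℝ) * (((K ^ 2)⁻¹) ^ (n + 1) * P)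
      = ((n + 2).factorial : ℝ) * P * ((K ^ 2)⁻¹) ^ (n + 1) := by ring
    _ ≤ _ := mul_le_mul h2 h3 (by positivity) hB0.le

theorem freqNorm_opN1_one_sub_le {θ : ℝ} (hθ : θ < 1 / 2) {K : ℝ} (hK : 1 ≤ K) (t : ℝ)
    (u v : M.L2) : freqNorm 2 (opN1 K 1 t u - opN1 K 1 t v) ≤
        ENNReal.ofReal (30 * K ^ (6 - 4 * ((1 : ℕ) : ℝ) * θ)) *
          (freqNorm 2 (hat M u) + freqNorm 2 (hat M v)) ^ 1 *
            freqNorm 2 (hat M u - hat M v) := by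
  have hK0 : 0 < K := zero_lt_one.trans_le hK
  rw [opN1_eq, opN1_eq]
  have hmain := freqNorm_sum_sub_le (fun T : OrderedTree (0 + 1) => T.measurable_coefN1 (M := M) K t)
    -- 15² = 225 ≥ 216, the constant of the one-generation estimate.
    (A := ENNReal.ofReal (15 * K ^ 2))
    (fun T f hf => (T.sqNorm_absForm_coefN1_one_le K t hf).trans (mul_le_mul_left (by
      rw [← ENNReal.ofReal_pow (by positivity)]
      apply ENNReal.ofReal_le_ofReal
      have : 0 ≤ K ^ 4 := by positivity
      nlinarith) _))
    (fun T u ξ => integrable_coefN1 T hK t u ξ) (enorm_neg_one_pow (1 - 1)).le u v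
  refine hmain.trans (mul_le_mul_left (mul_le_mul_left ((card_mul_le 0 _).trans
    (ENNReal.ofReal_le_ofReal ?_)) _) _)
  have h3 : K ^ 2 ≤ K ^ (6 - 4 * ((1 : ℕ) : ℝ) * θ) := by
    rw [← Real.rpow_two]
    refine Real.rpow_le_rpow_of_exponent_le hK ?_
    push_cast
    linarith
  norm_num at h3 ⊢
  linarith

/-- Only n of the n+2 generations gain K^(−2). This is enough: 4(n+2)θ ≤ 2(n+2) < 2n + 6. -/
theorem exists_freqNorm_opN1_sub_le {θ : ℝ} (hθ : θ < 1 / 2) :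
    ∃ C : ℝ, 0 < C ∧ ∀ K : ℝ, 1 ≤ K → ∀ (n : ℕ) (t : ℝ) (u v : M.L2),
      freqNorm 2 (opN1 K (n + 2) t u - opN1 K (n + 2) t v) ≤
        ENNReal.ofReal (C * K ^ (6 - 4 * ((n + 2 : ℕ) : ℝ) * θ)) *
          (freqNorm 2 (hat M u) + freqNorm 2 (hat M v)) ^ (n + 2) *
            freqNorm 2 (hat M u - hat M v) := by
  obtain ⟨B, hB0, hB⟩ := exists_decay_le (C := 176) (by norm_num)
  refine ⟨360 * B, by positivity, fun K hK n t u v => ?_⟩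
  have hK0 : 0 < K := zero_lt_one.trans_le hK
  rw [opN1_eq, opN1_eq]
  set P := ∏ k ∈ Finset.range n, 88 / ((k + 3).factorial : ℝ) with hP
  have hP0 : 0 ≤ P := Finset.prod_nonneg fun _ _ => by positivity
  have hmain := freqNorm_sum_sub_le (fun T => T.measurable_coefN1 (M := M) K t)
    -- 90² = 8100 dominates 4000 · 2, since (n+4)⁴ + 1 ≤ 2(n+4)⁴.
    (A := ENNReal.ofReal (90 * ((n : ℝ) + 4) ^ 2) * ENNReal.ofReal (((K ^ 2)⁻¹) ^ n * P))
    (fun T f hf => (T.sqNorm_absForm_coefN1_le hK t hf).trans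
      (mul_le_mul_left (by
        rw [mul_pow]
        refine mul_le_mul' ?_ (prod_threshold_le hK n)
        rw [← ENNReal.ofReal_pow (by positivity)]
        apply ENNReal.ofReal_le_ofReal
        have : 1 ≤ ((n : ℝ) + 4) ^ 4 := one_le_pow₀ (by linarith [Nat.cast_nonneg (α := ℝ) n])
        nlinarith) _))
    (fun T u ξ => integrable_coefN1 T hK t u ξ) (enorm_neg_one_pow (n + 2 - 1)).le u v
  refine hmain.trans (mul_le_mul_left (mul_le_mul_left ?_ _) _)
  rw [← ENNReal.ofReal_mul (by positivity)]
  refine (card_mul_le (n + 1) _).trans (ENNReal.ofReal_le_ofReal ?_)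
  have h1 : ((n + 1 + 2).factorial : ℝ) * ((n : ℝ) + 4) = ((n + 4).factorial : ℝ) := by
    have h : (n + 3).factorial * (n + 4) = (n + 4).factorial := by
      rw [mul_comm]; exact (Nat.factorial_succ (n + 3)).symm
    exact_mod_cast h
  -- Of the factor (n+4)² one power completes the factorial to (n+4)!; the other is paid for by
  -- doubling the constant of every generation, 176 = 2 · 88.
  have h2 : (n : ℝ) + 4 ≤ 4 * 2 ^ n := by
    have : ((n + 1 : ℕ) : ℝ) ≤ ((2 ^ n : ℕ) : ℝ) := by exact_mod_cast Nat.lt_two_pow_self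
    push_cast at this
    have := Nat.cast_nonneg (α := ℝ) n
    linarith
  have h3 : 2 ^ n * P = ∏ k ∈ Finset.range n, 176 / ((k + 3).factorial : ℝ) := by
    rw [hP, ← Finset.card_range n, ← Finset.prod_const, Finset.card_range, ← Finset.prod_mul_distrib]
    exact Finset.prod_congr rfl fun _ _ => by ring
  have h4 : ((n + 4).factorial : ℝ) * (2 ^ n * P) ≤ B := by
    rw [h3]; exact hB n
  have h5 : ((K ^ 2)⁻¹) ^ n ≤ K ^ (6 - 4 * ((n + 2 : ℕ) : ℝ) * θ) := by
    refine inv_sq_pow_le_rpow hK n ?_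
    have : (0 : ℝ) ≤ n := Nat.cast_nonneg _
    push_cast
    nlinarith
  calc ((n + 1 + 2).factorial : ℝ) * (90 * ((n : ℝ) + 4) ^ 2 * (((K ^ 2)⁻¹) ^ n * P))
      = 90 * (((n + 1 + 2).factorial : ℝ) * ((n : ℝ) + 4)) * ((n : ℝ) + 4) * P *
          ((K ^ 2)⁻¹) ^ n := by ring
    _ = 90 * ((n + 4).factorial : ℝ) * ((n : ℝ) + 4) * P * ((K ^ 2)⁻¹) ^ n := by rw [h1]
    _ ≤ 90 * ((n + 4).factorial : ℝ) * (4 * 2 ^ n) * P * ((K ^ 2)⁻¹) ^ n := by gcongr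
    _ = 360 * (((n + 4).factorial : ℝ) * (2 ^ n * P)) * ((K ^ 2)⁻¹) ^ n := by ring
    _ ≤ _ := mul_le_mul (by linarith) h5 (by positivity) (by positivity)

/-! ### Pointwise bounds for the operators -/

/-- 96 ≤ 100 gives √m ≥ (k+3)!²/10, and 1000 ≤ 32². Dropping K makes the pointwise bounds uniform in
K ≥ 1. -/
theorem div_sqrt_threshold_le {K : ℝ} (hK : 1 ≤ K) (k : ℕ) :
    100 / √(threshold K k) ≤ (32 / ((k + 3).factorial : ℝ)) ^ 2 := by
  have hF : (0 : ℝ) < ((k + 3).factorial : ℝ) := by exact_mod_cast Nat.factorial_pos _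
  have hK4 : (1 : ℝ) ≤ K ^ 4 := one_le_pow₀ hK
  have ht : ((k + 3).factorial : ℝ) ^ 2 / 10 ≤ √(threshold K k) := by
    refine Real.le_sqrt_of_sq_le ?_
    unfold threshold
    set F := ((k + 3).factorial : ℝ)
    have h1 : 0 < F ^ 4 := by positivity
    have h2 : F ^ 4 ≤ K ^ 4 * F ^ 4 := le_mul_of_one_le_left h1.le hK4
    calc (F ^ 2 / 10) ^ 2 = F ^ 4 / 100 := by ring
      _ ≤ _ := by linarith
  rw [div_le_iff₀ (lt_of_lt_of_le (by positivity) ht), div_pow]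
  calc (100 : ℝ) ≤ 32 ^ 2 / ((k + 3).factorial : ℝ) ^ 2 * (((k + 3).factorial : ℝ) ^ 2 / 10) := by
        field_simp; norm_num
    _ ≤ _ := by gcongr

theorem freeForm_le {n : ℕ} (T : OrderedTree (n + 1)) {K : ℝ} (hK : 1 ≤ K)
    {f : Node → M.Freq → ℝ≥0∞} (hf : ∀ a, Measurable (f a)) {G : ℝ≥0∞}
    (hG : ∏ a ∈ T.terminal, sqNorm (f a) ≤ G ^ 2) (ξ : M.Freq) :
    T.freeForm (threshold K) f ξ ≤
      ENNReal.ofReal (∏ k ∈ Finset.range n, 32 / ((k + 3).factorial : ℝ)) * G *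
        ENNReal.ofReal (bracket ξ) := by
  rw [← ENNReal.pow_le_pow_left_iff two_ne_zero, mul_pow, mul_pow,
    ENNReal.ofReal_prod_of_nonneg (fun _ _ => by positivity), ← Finset.prod_pow,
    ← ENNReal.ofReal_pow (zero_le_one.trans (one_le_bracket ξ))]
  refine (T.sq_freeForm_le (fun k => one_le_threshold hK k) hf ξ).trans ?_
  gcongr with k _
  rw [← ENNReal.ofReal_pow (by positivity)]
  exact ENNReal.ofReal_le_ofReal (div_sqrt_threshold_le hK k)

theorem prod_sqNorm_hat_le {j : ℕ} (T : OrderedTree j) {u : M.L2} {R : ℝ≥0∞} (hu : ‖u‖ₑ ≤ R) :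
    ∏ _a ∈ T.terminal, sqNorm (fun x => ‖hat M u x‖ₑ) ≤ (R ^ (j + 1)) ^ 2 := by
  rw [Finset.prod_const, T.card_terminal, sqNorm_enorm, freqNorm_hat, ← pow_mul, ← pow_mul,
    mul_comm]
  exact pow_le_pow_left' hu _

theorem enorm_sum_integral_le {j : ℕ} (c : OrderedTree j → (Fin j → M.Freq) → ℂ) {s : ℂ}
    (hs : ‖s‖ₑ = 1) {B : ℝ≥0∞} (hB : ∀ T, ∫⁻ η, ‖c T η‖ₑ ≤ B) :
    ‖s * ∑ T : OrderedTree j, ∫ η, c T η‖ₑ ≤ (j.factorial : ℝ≥0∞) * B := by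
  rw [enorm_mul, hs, one_mul]
  refine (enorm_sum_le _ _).trans ((Finset.sum_le_card_nsmul _ _ B fun T _ =>
    (enorm_integral_le_lintegral_enorm _).trans (hB T)).trans ?_)
  rw [Finset.card_univ, nsmul_eq_mul]
  exact mul_le_mul_left (by exact_mod_cast OrderedTree.card_le_factorial j) _

/-- The prefactor shared by the pointwise bounds, dominated by a summable sequence. -/
theorem factorial_mul_prod_le {R : ℝ} (hR : 1 ≤ R) (n : ℕ) :
    ((n + 2).factorial : ℝ) * (∏ k ∈ Finset.range n, 32 / ((k + 3).factorial : ℝ)) * R ^ (n + 2) ≤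
      R ^ 2 * decay (32 * R) n := by
  have hR0 : 0 < R := zero_lt_one.trans_le hR
  have e : (∏ k ∈ Finset.range n, 32 * R / ((k + 3).factorial : ℝ)) =
      (∏ k ∈ Finset.range n, 32 / ((k + 3).factorial : ℝ)) * R ^ n := by
    conv_rhs => rw [← Finset.card_range n, ← Finset.prod_const, Finset.card_range,
      ← Finset.prod_mul_distrib]
    exact Finset.prod_congr rfl fun _ _ => by ring
  have hP : 0 ≤ ∏ k ∈ Finset.range n, 32 / ((k + 3).factorial : ℝ) :=
    Finset.prod_nonneg fun _ _ => by positivity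
  have h1 : ((n + 2).factorial : ℝ) ≤ ((n + 4).factorial : ℝ) := by
    exact_mod_cast Nat.factorial_le (by omega)
  unfold decay
  rw [e]
  calc _ ≤ ((n + 4).factorial : ℝ) * (∏ k ∈ Finset.range n, 32 / ((k + 3).factorial : ℝ)) *
        R ^ (n + 2) := by gcongr
    _ = _ := by ring

theorem enorm_opN2_le {n : ℕ} {K : ℝ} (hK : 1 ≤ K) (t : ℝ) {u : M.L2} {R : ℝ} (hR : 1 ≤ R)
    (hu : ‖u‖ ≤ R) (ξ : M.Freq) :
    ‖opN2 K (n + 1) t u ξ‖ₑ ≤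
      ENNReal.ofReal (R ^ 2 * decay (32 * R) n) * ENNReal.ofReal (bracket ξ) := by
  have hR0 : 0 < R := zero_lt_one.trans_le hR
  have hu' : ‖u‖ₑ ≤ ENNReal.ofReal R := by
    rw [← ofReal_norm]; exact ENNReal.ofReal_le_ofReal hu
  rw [opN2_eq]
  refine (enorm_sum_integral_le _ (enorm_neg_one_pow _) (B := ENNReal.ofReal
    ((∏ k ∈ Finset.range n, 32 / ((k + 3).factorial : ℝ)) * R ^ (n + 2)) *
      ENNReal.ofReal (bracket ξ)) fun T => ?_).trans ?_
  · calc ∫⁻ η, ‖T.coefN2 K t ξ η * T.leafProd ξ η u‖ₑ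
        ≤ ∫⁻ η, T.freeKernel K ξ η * ∏ a ∈ T.terminal, ‖hat M u (T.freq ξ η a)‖ₑ := by
          refine lintegral_mono fun η => ?_
          rw [enorm_mul, enorm_leafProd]
          exact mul_le_mul_left (T.enorm_coefN2_le_freeKernel hK t ξ η) _
      _ = T.freeForm (threshold K) (fun _ x => ‖hat M u x‖ₑ) ξ :=
          T.lintegral_freeKernel K (fun _ x => ‖hat M u x‖ₑ) ξ
      _ ≤ _ := freeForm_le T hK (fun _ => (measurable_hat u).enorm) (prod_sqNorm_hat_le T hu') ξ
      _ = _ := by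
          rw [ENNReal.ofReal_mul (Finset.prod_nonneg fun _ _ => by positivity),
            ENNReal.ofReal_pow hR0.le]
  · rw [← mul_assoc, ← ENNReal.ofReal_natCast, ← ENNReal.ofReal_mul (by positivity)]
    refine mul_le_mul_left (ENNReal.ofReal_le_ofReal ?_) _
    refine le_trans ?_ (factorial_mul_prod_le hR n)
    rw [← mul_assoc]
    have h1 : ((n + 1).factorial : ℝ) ≤ ((n + 2).factorial : ℝ) := by
      exact_mod_cast Nat.factorial_le (by omega)
    have hP : 0 ≤ ∏ k ∈ Finset.range n, 32 / ((k + 3).factorial : ℝ) :=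
      Finset.prod_nonneg fun _ _ => by positivity
    gcongr

theorem enorm_opN2Tilde_le {n : ℕ} {K : ℝ} (hK : 1 ≤ K) (t : ℝ) {u : M.L2} {R : ℝ} (hR : 1 ≤ R)
    (hu : ‖u‖ ≤ R) (ξ : M.Freq) :
    ‖opN2Tilde K (n + 1) t u ξ‖ₑ ≤ ENNReal.ofReal (2 * (R ^ 2 * decay (32 * R) n)) := by
  have h := enorm_opN2_le (n := n) hK t hR hu ξ
  -- The multiplier is made to absorb the growth: max(1,|ξ|)/|ξ| ≤ 2 for |ξ| ≥ 1/2, and max(1,|ξ|) =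
  -- 1 below.
  have hp : ‖(if 1 / 2 ≤ |M.toReal ξ| then ((M.toReal ξ : ℂ))⁻¹ else 1)‖ₑ *
      ENNReal.ofReal (bracket ξ) ≤ ENNReal.ofReal 2 := by
    rw [← ofReal_norm, ← ENNReal.ofReal_mul (norm_nonneg _)]
    apply ENNReal.ofReal_le_ofReal
    unfold bracket mag
    split_ifs with h0
    · have hpos : 0 < |M.toReal ξ| := by linarith
      rw [norm_inv, Complex.norm_real, Real.norm_eq_abs, inv_mul_le_iff₀ hpos, max_le_iff]
      constructor <;> linarith
    · rw [norm_one, one_mul, max_le_iff]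
      constructor <;> linarith
  rw [opN2Tilde, enorm_mul, ENNReal.ofReal_mul (by norm_num)]
  calc _ ≤ ‖(if 1 / 2 ≤ |M.toReal ξ| then ((M.toReal ξ : ℂ))⁻¹ else 1)‖ₑ *
        (ENNReal.ofReal (R ^ 2 * decay (32 * R) n) * ENNReal.ofReal (bracket ξ)) := by gcongr
    _ = ‖(if 1 / 2 ≤ |M.toReal ξ| then ((M.toReal ξ : ℂ))⁻¹ else 1)‖ₑ *
        ENNReal.ofReal (bracket ξ) * ENNReal.ofReal (R ^ 2 * decay (32 * R) n) := by ring
    _ ≤ _ := by gcongr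

theorem tendsto_opN2Tilde {K : ℝ} (hK : 1 ≤ K) {B : Set M.L2} (hB : Bornology.IsBounded B) :
    Tendsto (fun j : ℕ => ⨆ u ∈ B, ⨆ t : ℝ, freqNorm ∞ (opN2Tilde K j t u)) atTop (𝓝 0) := by
  obtain ⟨R₀, hR₀⟩ := hB.exists_norm_le
  set R := max R₀ 1
  have hR : 1 ≤ R := le_max_right _ _
  rw [← tendsto_add_atTop_iff_nat 1]
  have hlim : Tendsto (fun n => ENNReal.ofReal (2 * (R ^ 2 * decay (32 * R) n))) atTop (𝓝 0) := by
    have h := (((summable_decay (C := 32 * R) (by positivity)).tendsto_atTop_zero.const_mul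
      (R ^ 2)).const_mul 2)
    rw [mul_zero, mul_zero] at h
    simpa using ENNReal.tendsto_ofReal h
  refine tendsto_of_tendsto_of_tendsto_of_le_of_le tendsto_const_nhds hlim (fun _ => zero_le)
    fun n => ?_
  refine iSup₂_le fun u hu => iSup_le fun t => ?_
  rw [freqNorm, eLpNorm_exponent_top]
  exact eLpNormEssSup_le_of_ae_enorm_bound (Eventually.of_forall fun ξ =>
    enorm_opN2Tilde_le hK t hR ((hR₀ u hu).trans (le_max_left _ _)) ξ)

/-! ### The error terms -/

/-- The Fourier transform restricted to frequencies above `N` at the node `a`, unrestricted at all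
other nodes. -/
def tailLeaf (N : ℕ) (u : M.L2) (a b : Node) (x : M.Freq) : ℝ≥0∞ :=
  if b = a then ‖{ξ | (N : ℝ) < M.mag ξ}.indicator (hat M u) x‖ₑ else ‖hat M u x‖ₑ

theorem measurable_tailLeaf (N : ℕ) (u : M.L2) (a b : Node) : Measurable (tailLeaf N u a b) := by
  unfold tailLeaf
  split_ifs
  · exact ((measurable_hat u).indicator (measurableSet_lt measurable_const measurable_mag)).enorm
  · exact (measurable_hat u).enorm

theorem prod_sqNorm_tailLeaf_le {j : ℕ} (T : OrderedTree j) {N : ℕ} {u : M.L2} {a : Node}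
    (ha : a ∈ T.terminal) {R e : ℝ≥0∞} (hu : ‖u‖ₑ ≤ R) (he : ‖highPass M N u‖ₑ ≤ e) :
    ∏ b ∈ T.terminal, sqNorm (tailLeaf N u a b) ≤ (R ^ j * e) ^ 2 := by
  have h1 : sqNorm (tailLeaf N u a a) ≤ e ^ 2 := by
    have h : tailLeaf N u a a = fun x => ‖{ξ | (N : ℝ) < M.mag ξ}.indicator (hat M u) x‖ₑ :=
      funext fun x => if_pos rfl
    rw [h, sqNorm_enorm, freqNorm_hat_tail]
    exact pow_le_pow_left' he 2
  have h2 : ∀ b ∈ T.terminal.erase a, sqNorm (tailLeaf N u a b) ≤ R ^ 2 := fun b hb => by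
    have h : tailLeaf N u a b = fun x => ‖hat M u x‖ₑ :=
      funext fun x => if_neg (Finset.ne_of_mem_erase hb)
    rw [h, sqNorm_enorm, freqNorm_hat]
    exact pow_le_pow_left' hu 2
  rw [← Finset.mul_prod_erase _ _ ha, mul_pow, mul_comm, ← pow_mul, mul_comm j, pow_mul]
  refine mul_le_mul' ((Finset.prod_le_prod' h2).trans (le_of_eq ?_)) h1
  rw [Finset.prod_const, Finset.card_erase_of_mem ha, T.card_terminal, Nat.add_sub_cancel]

theorem measurable_freeKernel {j : ℕ} (T : OrderedTree (j + 1)) (K : ℝ) (ξ : M.Freq) :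
    Measurable (T.freeKernel K ξ) := by
  have hi : Measurable fun η : Fin (j + 1) → M.Freq => fun k : Fin j => η k.castSucc := by fun_prop
  exact ((T.init.measurable_kernelProd _ ξ).comp hi).mul
    (measurable_mag.comp ((T.init.measurable_freq_right ξ _).comp hi)).ennreal_ofReal

/-- If every leaf is below N, so are the two children of the last root, and the phase difference is
small. Otherwise some leaf lies in the tail: the phase difference is bounded by 2 and the function
at that leaf may be truncated to high frequencies. -/
theorem enorm_integrandE_le {n : ℕ} (T : OrderedTree (n + 1)) {K : ℝ} (hK : 1 ≤ K) {δ t : ℝ}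
    {N : ℕ} {e : ℝ≥0∞}
    (hphase : ∀ x y : M.Freq, M.mag x ≤ N → M.mag y ≤ N →
      ‖phaseDiff δ t (M.toReal x + M.toReal y) (M.toReal x) (M.toReal y)‖ₑ ≤ e)
    (u : M.L2) (ξ : M.Freq) (η : Fin (n + 1) → M.Freq) :
    ‖T.coefE K t δ ξ η * T.leafProd ξ η u‖ₑ ≤
      e * (T.freeKernel K ξ η * ∏ a ∈ T.terminal, ‖hat M u (T.freq ξ η a)‖ₑ) +
        ∑ a ∈ T.terminal, 2 * (T.freeKernel K ξ η *
          ∏ b ∈ T.terminal, tailLeaf N u a b (T.freq ξ η b)) := by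
  rw [enorm_mul, enorm_leafProd]
  refine (mul_le_mul_left (T.enorm_coefE_le_freeKernel hK t δ ξ η) _).trans ?_
  rw [mul_assoc]
  by_cases h : ∀ a ∈ T.terminal, M.mag (T.freq ξ η a) ≤ N
  · refine le_add_right (mul_le_mul_left ?_ _)
    have hmem : ∀ b : Bool, b :: T.last ∈ T.terminal := fun b =>
      OrderedTree.mem_terminal_cons.2 ⟨T.branch_mem_internal _, T.child_notMem_internal b⟩
    have hr : T.r (n + 1) = T.last := T.r_succ (Fin.last n)
    have h1 := hphase _ _ (h _ (hmem false)) (h _ (hmem true))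
    have h2 : T.freq ξ η T.last = T.freq ξ η (false :: T.last) + T.freq ξ η (true :: T.last) :=
      T.freq_eq_add ξ η (Fin.last n)
    rw [← toReal_add, ← h2] at h1
    unfold OrderedTree.gen OrderedTree.gen₁ OrderedTree.gen₂
    rw [hr]
    exact h1
  · push Not at h
    obtain ⟨a, ha, hN⟩ := h
    refine le_add_left (le_trans ?_ (Finset.single_le_sum
      (f := fun a => 2 * (T.freeKernel K ξ η * ∏ b ∈ T.terminal, tailLeaf N u a b (T.freq ξ η b)))
      (fun _ _ => zero_le) ha))
    refine mul_le_mul' (enorm_phaseDiff_le_two _ _ _ _ _) (mul_le_mul_right (le_of_eq ?_) _)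
    refine Finset.prod_congr rfl fun b _ => ?_
    unfold tailLeaf
    split_ifs with hb
    · subst hb
      rw [Set.indicator_of_mem (show T.freq ξ η b ∈ {ξ | (N : ℝ) < M.mag ξ} from hN)]
    · rfl

/-- One small-phase term and n+2 tail terms with factor 2 add up to at most 3e(n+2); the factor n+2
then completes (n+1)! to (n+2)!. -/
theorem enorm_opE_le {n : ℕ} {K : ℝ} (hK : 1 ≤ K) {δ t : ℝ} {N : ℕ} {e : ℝ} (he : 0 ≤ e)
    (hphase : ∀ x y : M.Freq, M.mag x ≤ N → M.mag y ≤ N →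
      ‖phaseDiff δ t (M.toReal x + M.toReal y) (M.toReal x) (M.toReal y)‖ₑ ≤ ENNReal.ofReal e)
    {u : M.L2} {R : ℝ} (hR : 1 ≤ R) (hu : ‖u‖ ≤ R) (htail : ‖highPass M N u‖ₑ ≤ ENNReal.ofReal e)
    (ξ : M.Freq) :
    ‖opE K δ (n + 1) t u ξ‖ₑ ≤
      ENNReal.ofReal (3 * e * (R ^ 2 * decay (32 * R) n)) * ENNReal.ofReal (bracket ξ) := by
  have hR0 : 0 < R := zero_lt_one.trans_le hR
  have hu' : ‖u‖ₑ ≤ ENNReal.ofReal R := by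
    rw [← ofReal_norm]; exact ENNReal.ofReal_le_ofReal hu
  set P := ∏ k ∈ Finset.range n, 32 / ((k + 3).factorial : ℝ) with hP
  have hP0 : 0 ≤ P := Finset.prod_nonneg fun _ _ => by positivity
  rw [opE_eq]
  refine (enorm_sum_integral_le _ (enorm_neg_one_pow _) (B := ENNReal.ofReal
    (3 * e * ((n + 2 : ℕ) * (P * R ^ (n + 2)))) * ENNReal.ofReal (bracket ξ)) fun T => ?_).trans ?_
  · have hm : ∀ f : Node → M.Freq → ℝ≥0∞, (∀ a, Measurable (f a)) → Measurable fun η =>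
        T.freeKernel K ξ η * ∏ a ∈ T.terminal, f a (T.freq ξ η a) := fun f hf =>
      (measurable_freeKernel T K ξ).mul (Finset.measurable_prod _ fun a _ =>
        (hf a).comp (T.measurable_freq_right ξ a))
    have hmain : T.freeForm (threshold K) (fun _ x => ‖hat M u x‖ₑ) ξ ≤
        ENNReal.ofReal (P * R ^ (n + 2)) * ENNReal.ofReal (bracket ξ) := by
      refine (freeForm_le T hK (fun _ => (measurable_hat u).enorm)
        (prod_sqNorm_hat_le T hu') ξ).trans (le_of_eq ?_)
      rw [ENNReal.ofReal_mul hP0, ENNReal.ofReal_pow hR0.le]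
    have htl : ∀ a ∈ T.terminal, T.freeForm (threshold K) (tailLeaf N u a) ξ ≤
        ENNReal.ofReal (e * (P * R ^ (n + 2))) * ENNReal.ofReal (bracket ξ) := by
      intro a ha
      refine (freeForm_le T hK (measurable_tailLeaf N u a)
        (prod_sqNorm_tailLeaf_le T ha hu' htail) ξ).trans (mul_le_mul_left ?_ _)
      rw [← ENNReal.ofReal_pow hR0.le, ← ENNReal.ofReal_mul (by positivity),
        ← ENNReal.ofReal_mul hP0]
      apply ENNReal.ofReal_le_ofReal
      have : R ^ (n + 1) ≤ R ^ (n + 2) := pow_le_pow_right₀ hR (by omega)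
      calc P * (R ^ (n + 1) * e) ≤ P * (R ^ (n + 2) * e) := by gcongr
        _ = _ := by ring
    calc ∫⁻ η, ‖T.coefE K t δ ξ η * T.leafProd ξ η u‖ₑ
        ≤ ∫⁻ η, (ENNReal.ofReal e * (T.freeKernel K ξ η *
            ∏ a ∈ T.terminal, ‖hat M u (T.freq ξ η a)‖ₑ) +
          ∑ a ∈ T.terminal, 2 * (T.freeKernel K ξ η *
            ∏ b ∈ T.terminal, tailLeaf N u a b (T.freq ξ η b))) :=
          lintegral_mono fun η => enorm_integrandE_le T hK hphase u ξ η
      _ = ENNReal.ofReal e * T.freeForm (threshold K) (fun _ x => ‖hat M u x‖ₑ) ξ +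
          ∑ a ∈ T.terminal, 2 * T.freeForm (threshold K) (tailLeaf N u a) ξ := by
          rw [lintegral_add_left ((hm (fun _ x => ‖hat M u x‖ₑ)
            fun _ => (measurable_hat u).enorm).const_mul _),
            lintegral_const_mul' _ _ ENNReal.ofReal_ne_top, lintegral_finsetSum _ fun a _ =>
              (hm _ (measurable_tailLeaf N u a)).const_mul 2]
          congr 1
          · exact congrArg _ (T.lintegral_freeKernel K (fun _ x => ‖hat M u x‖ₑ) ξ)
          · refine Finset.sum_congr rfl fun a _ => ?_
            rw [lintegral_const_mul' _ _ ENNReal.ofNat_ne_top, T.lintegral_freeKernel]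
      _ ≤ ENNReal.ofReal e * (ENNReal.ofReal (P * R ^ (n + 2)) * ENNReal.ofReal (bracket ξ)) +
          ((n + 2 : ℕ) : ℝ≥0∞) * (2 * (ENNReal.ofReal (e * (P * R ^ (n + 2))) *
            ENNReal.ofReal (bracket ξ))) := by
          refine add_le_add (mul_le_mul_right hmain _) ?_
          refine (Finset.sum_le_card_nsmul _ _ _ fun a ha =>
            mul_le_mul_right (htl a ha) 2).trans (le_of_eq ?_)
          rw [T.card_terminal, nsmul_eq_mul]
      _ = ENNReal.ofReal (e * (P * R ^ (n + 2)) + (n + 2 : ℕ) * (2 * (e * (P * R ^ (n + 2))))) *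
            ENNReal.ofReal (bracket ξ) := by
          rw [ENNReal.ofReal_add (by positivity) (by positivity), ENNReal.ofReal_mul he,
            ENNReal.ofReal_mul (by positivity : (0 : ℝ) ≤ ((n + 2 : ℕ) : ℝ)),
            ENNReal.ofReal_mul (by norm_num : (0 : ℝ) ≤ 2), ENNReal.ofReal_mul he,
            ENNReal.ofReal_natCast, ENNReal.ofReal_ofNat]
          ring
      _ ≤ _ := by
          refine mul_le_mul_left (ENNReal.ofReal_le_ofReal ?_) _
          have h0 : 0 ≤ e * (P * R ^ (n + 2)) := by positivity
          have h1 : (1 : ℝ) ≤ ((n + 2 : ℕ) : ℝ) := by exact_mod_cast Nat.succ_le_succ (Nat.zero_le _)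
          nlinarith
  · rw [← mul_assoc, ← ENNReal.ofReal_natCast, ← ENNReal.ofReal_mul (by positivity)]
    refine mul_le_mul_left (ENNReal.ofReal_le_ofReal ?_) _
    have hf : ((n + 1).factorial : ℝ) * ((n + 2 : ℕ) : ℝ) = ((n + 2).factorial : ℝ) := by
      have h : (n + 1).factorial * (n + 2) = (n + 2).factorial := by
        rw [mul_comm]; exact (Nat.factorial_succ (n + 1)).symm
      exact_mod_cast h
    calc _ = 3 * e * (((n + 1).factorial : ℝ) * ((n + 2 : ℕ) : ℝ) * P * R ^ (n + 2)) := by ring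
      _ = 3 * e * (((n + 2).factorial : ℝ) * P * R ^ (n + 2)) := by rw [hf]
      _ ≤ _ := mul_le_mul_of_nonneg_left (factorial_mul_prod_le hR n) (by positivity)

theorem freqNorm_lowFreq_le (N : ℕ) {g : M.Freq → ℂ} {c : ℝ} (hc : 0 ≤ c)
    (hg : ∀ ξ, ‖g ξ‖ₑ ≤ ENNReal.ofReal c * ENNReal.ofReal (bracket ξ)) :
    freqNorm 2 (lowFreq N g) ≤ ENNReal.ofReal (((N : ℝ) + 1) * (2 * N + 1) * c) := by
  rw [← ENNReal.pow_le_pow_left_iff two_ne_zero, freqNorm, sq_eLpNorm_two]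
  have hS : MeasurableSet {ξ : M.Freq | M.mag ξ ≤ N} :=
    measurableSet_le measurable_mag measurable_const
  have hN : (0 : ℝ) ≤ N := Nat.cast_nonneg N
  have hl : lowFreq N g = {ξ : M.Freq | M.mag ξ ≤ N}.indicator g := rfl
  calc ∫⁻ ξ, ‖lowFreq N g ξ‖ₑ ^ 2
      ≤ ∫⁻ ξ, {ξ : M.Freq | M.mag ξ ≤ N}.indicator
          (fun _ => ENNReal.ofReal (((N : ℝ) + 1) * c) ^ 2) ξ := by
        refine lintegral_mono fun ξ => ?_
        by_cases h : ξ ∈ {ξ : M.Freq | M.mag ξ ≤ N}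
        · rw [Set.indicator_of_mem h, hl, Set.indicator_of_mem h]
          refine pow_le_pow_left' ((hg ξ).trans ?_) 2
          rw [mul_comm, ENNReal.ofReal_mul (by positivity)]
          refine mul_le_mul_left (ENNReal.ofReal_le_ofReal ?_) _
          have h' : M.mag ξ ≤ N := h
          exact max_le (by linarith) (by linarith)
        · rw [Set.indicator_of_notMem h, hl, Set.indicator_of_notMem h]
          simp
    _ = ENNReal.ofReal (((N : ℝ) + 1) * c) ^ 2 * volume {ξ : M.Freq | M.mag ξ ≤ N} := by
        rw [lintegral_indicator hS, setLIntegral_const]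
    _ ≤ ENNReal.ofReal (((N : ℝ) + 1) * c) ^ 2 * ENNReal.ofReal (2 * N + 1) :=
        mul_le_mul_right (volume_low_le N) _
    _ ≤ _ := by
        rw [← ENNReal.ofReal_pow (by positivity), ← ENNReal.ofReal_mul (by positivity),
          ← ENNReal.ofReal_pow (by positivity)]
        apply ENNReal.ofReal_le_ofReal
        have h1 : (2 * (N : ℝ) + 1) ≤ (2 * N + 1) ^ 2 := by nlinarith
        calc (((N : ℝ) + 1) * c) ^ 2 * (2 * N + 1) ≤ (((N : ℝ) + 1) * c) ^ 2 * (2 * N + 1) ^ 2 := by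
              gcongr
          _ = _ := by ring

theorem tsum_freqNorm_opE_le {K : ℝ} (hK : 1 ≤ K) {δ Tmax : ℝ} {N N' : ℕ} {e : ℝ} (he : 0 ≤ e)
    (hphase : ∀ t ∈ Set.Icc (-Tmax) Tmax, ∀ x y : M.Freq, M.mag x ≤ N' → M.mag y ≤ N' →
      ‖phaseDiff δ t (M.toReal x + M.toReal y) (M.toReal x) (M.toReal y)‖ₑ ≤ ENNReal.ofReal e)
    {u : M.L2} {R : ℝ} (hR : 1 ≤ R) (hu : ‖u‖ ≤ R)
    (htail : ‖highPass M N' u‖ₑ ≤ ENNReal.ofReal e) :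
    ∑' j : ℕ, ⨆ t ∈ Set.Icc (-Tmax) Tmax, freqNorm 2 (lowFreq N (opE K δ (j + 1) t u)) ≤
      ENNReal.ofReal (e * (((N : ℝ) + 1) * (2 * N + 1) * (3 * R ^ 2 * ∑' n, decay (32 * R) n))) := by
  have hd : ∀ n, 0 ≤ decay (32 * R) n := fun n => (decay_pos (by linarith) n).le
  have hs := summable_decay (C := 32 * R) (by linarith)
  calc _ ≤ ∑' n : ℕ, ENNReal.ofReal
        (((N : ℝ) + 1) * (2 * N + 1) * (3 * e * (R ^ 2 * decay (32 * R) n))) := by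
        refine ENNReal.tsum_le_tsum fun n => iSup₂_le fun t ht => ?_
        refine freqNorm_lowFreq_le N ?_ fun ξ => enorm_opE_le hK he (hphase t ht) hR hu htail ξ
        have := hd n
        positivity
    _ = ENNReal.ofReal (∑' n : ℕ,
        (((N : ℝ) + 1) * (2 * N + 1) * (3 * e * (R ^ 2 * decay (32 * R) n)))) := by
        refine (ENNReal.ofReal_tsum_of_nonneg (fun n => ?_) ?_).symm
        · have := hd n
          positivity
        · exact ((hs.mul_left _).mul_left _).mul_left _
    _ = _ := by
        rw [tsum_mul_left, tsum_mul_left, tsum_mul_left]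
        congr 1
        ring

/-- Applied with B = 2N+1, which bounds the sum of the two frequencies too and is at least 1, so
that δ ≤ 1. Then δ² ≤ δ, and smallness is a linear condition on δ. -/
theorem enorm_phaseDiff_le {δ Tmax e : ℝ} (hδ : 0 < δ) (hT : 0 < Tmax) {N : ℕ}
    (h1 : δ * (2 * N + 1) ≤ 1) (h2 : Tmax * (3 * (δ * (2 * N + 1) ^ 5)) ≤ e) {t : ℝ}
    (ht : t ∈ Set.Icc (-Tmax) Tmax) {x y : M.Freq} (hx : M.mag x ≤ N) (hy : M.mag y ≤ N) :
    ‖phaseDiff δ t (M.toReal x + M.toReal y) (M.toReal x) (M.toReal y)‖ₑ ≤ ENNReal.ofReal e := by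
  have hN : (0 : ℝ) ≤ N := Nat.cast_nonneg N
  have hx' : |M.toReal x| ≤ N := hx
  have hy' : |M.toReal y| ≤ N := hy
  have h := norm_phaseDiff_le (t := t) hδ h1 (x := M.toReal x) (y := M.toReal y) (by linarith)
    (by linarith) ((abs_add_le _ _).trans (by linarith))
  rw [← ofReal_norm]
  refine ENNReal.ofReal_le_ofReal (h.trans (le_trans ?_ h2))
  have hδ1 : δ ≤ 1 := by nlinarith
  have h3 : δ ^ 2 ≤ δ := by nlinarith
  have h4 : |t| ≤ Tmax := abs_le.2 ht
  gcongr

end NormalForm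

end

/-! ### Assembly of the theorem -/

open NormalForm in
theorem mainTheorem4 (M : Geometry) (θ : ℝ)
    (hcircle : M = Geometry.circle → 0 < θ ∧ θ < 1 / 3)
    (hline : M = Geometry.line → 1 / 14 < θ ∧ θ < 1 / 2) :
    -- all the multiple integrals converge absolutely and define measurable functions of `ξ`
    (∀ K : ℝ, 1 ≤ K → ∀ j : ℕ, 1 ≤ j → ∀ u : M.L2, MeanZero M u →
      (∀ᵐ ξ : M.Freq, ∀ (t : ℝ) (T : OrderedTree j),
        Integrable (integrandN0 K t u T ξ) ∧
        Integrable (integrandN1 K t u T ξ) ∧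
        Integrable (integrandN2 K t u T ξ) ∧
        ∀ δ : ℝ, 0 < δ → Integrable (integrandE K δ t u T ξ)) ∧
      (∀ t : ℝ,
        AEStronglyMeasurable (opN0 K j t u) ∧
        AEStronglyMeasurable (opN1 K j t u) ∧
        AEStronglyMeasurable (opN2 K j t u) ∧
        ∀ δ : ℝ, 0 < δ → AEStronglyMeasurable (opE K δ j t u))) ∧
    -- (i)
    (∃ C : ℝ, 0 < C ∧ ∀ K : ℝ, 1 ≤ K → ∀ j : ℕ, 1 ≤ j →
      ∀ u₁ u₂ : M.L2, MeanZero M u₁ → MeanZero M u₂ →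
        (⨆ t : ℝ, freqNorm 2 (opN0 K j t u₁ - opN0 K j t u₂)) ≤
          ENNReal.ofReal (C * K ^ (-(4 * (j : ℝ) * θ))) *
            (freqNorm 2 (hat M u₁) + freqNorm 2 (hat M u₂)) ^ j *
            freqNorm 2 (hat M u₁ - hat M u₂) ∧
        (⨆ t : ℝ, freqNorm 2 (opN1 K j t u₁ - opN1 K j t u₂)) ≤
          ENNReal.ofReal (C * K ^ (6 - 4 * (j : ℝ) * θ)) *
            (freqNorm 2 (hat M u₁) + freqNorm 2 (hat M u₂)) ^ j *
            freqNorm 2 (hat M u₁ - hat M u₂)) ∧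
    -- (ii)
    (∀ K : ℝ, 1 ≤ K → ∀ B : Set M.L2, Bornology.IsBounded B → (∀ u ∈ B, MeanZero M u) →
      Tendsto (fun j : ℕ => ⨆ u ∈ B, ⨆ t : ℝ, freqNorm ∞ (opN2Tilde K j t u)) atTop (𝓝 0)) ∧
    -- (iii)
    (∀ R : ℝ, 0 < R → ∃ τstar : ℝ, 0 < τstar ∧
      ∀ (N₃ : ℝ → ℕ) (δ₃ : ℝ → ℝ), (∀ ε : ℝ, 0 < ε → 0 < δ₃ ε ∧ δ₃ ε ≤ 1) →
      ∀ (N : ℕ) (Tmax ε : ℝ), 0 < Tmax → 0 < ε →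
      ∃ δ₄ : ℝ, 0 < δ₄ ∧ δ₄ ≤ 1 ∧
        ∀ K : ℝ, 1 ≤ K → R < K ^ (4 * θ) →
        ∀ u : ℝ → M.L2,
          (∀ δ ∈ Set.Ioc (0 : ℝ) 1, MeanZero M (u δ)) →
          (∀ δ ∈ Set.Ioc (0 : ℝ) 1, ‖u δ‖ ≤ R) →
          (∀ ε' : ℝ, 0 < ε' → ∀ N' : ℕ, N₃ ε' ≤ N' →
            (⨆ δ ∈ Set.Ioc (0 : ℝ) (δ₃ ε'), ‖highPass M N' (u δ)‖ₑ) < ENNReal.ofReal ε') →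
          ∀ τ ∈ Set.Ioo (0 : ℝ) τstar, ∀ δ ∈ Set.Ioo (0 : ℝ) δ₄,
            ENNReal.ofReal τ *
              ∑' j : ℕ, ⨆ t ∈ Set.Icc (-Tmax) Tmax,
                freqNorm 2 (lowFreq N (opE K δ (j + 1) t (u δ))) <
              ENNReal.ofReal ε) := by
  have hθ : θ < 1 / 2 := by
    cases M
    · linarith [(hcircle rfl).2]
    · exact (hline rfl).2
  refine ⟨fun K hK j hj u _ => ?_, ?_, fun K hK B hB _ => tendsto_opN2Tilde hK hB, ?_⟩
  · obtain ⟨n, rfl⟩ : ∃ n, j = n + 1 := ⟨j - 1, by omega⟩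
    refine ⟨Eventually.of_forall fun ξ t T => ⟨?_, ?_, ?_, fun δ _ => ?_⟩,
      fun t => ⟨?_, ?_, ?_, fun δ _ => ?_⟩⟩
    · rw [OrderedTree.integrandN0_eq]
      exact integrable_coefN0 T hK t u ξ
    · rw [OrderedTree.integrandN1_eq]
      exact integrable_coefN1 T hK t u ξ
    · rw [OrderedTree.integrandN2_eq]
      exact integrable_coefN2 T hK t u ξ
    · rw [OrderedTree.integrandE_eq]
      exact integrable_coefE T hK t u ξ δ
    · rw [opN0_eq]
      exact aestronglyMeasurable_sum_integral (fun T => T.measurable_coefN0 K t) u _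
    · rw [opN1_eq]
      exact aestronglyMeasurable_sum_integral (fun T => T.measurable_coefN1 K t) u _
    · rw [opN2_eq]
      exact aestronglyMeasurable_sum_integral (fun T => T.measurable_coefN2 K t) u _
    · rw [opE_eq]
      exact aestronglyMeasurable_sum_integral (fun T => T.measurable_coefE K t δ) u _
  · obtain ⟨C₀, hC₀, h₀⟩ := exists_freqNorm_opN0_sub_le (M := M) hθ
    obtain ⟨C₁, hC₁, h₁⟩ := exists_freqNorm_opN1_sub_le (M := M) hθ
    refine ⟨C₀ + C₁ + 30, by positivity, fun K hK j hj u v _ _ => ?_⟩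
    have hK0 : 0 < K := zero_lt_one.trans_le hK
    have hmono : ∀ {C : ℝ} (x : ℝ), C ≤ C₀ + C₁ + 30 →
        ENNReal.ofReal (C * K ^ x) ≤ ENNReal.ofReal ((C₀ + C₁ + 30) * K ^ x) := fun x h =>
      ENNReal.ofReal_le_ofReal (mul_le_mul_of_nonneg_right h (Real.rpow_nonneg hK0.le x))
    obtain ⟨n, rfl⟩ : ∃ n, j = n + 1 := ⟨j - 1, by omega⟩
    refine ⟨iSup_le fun t => (h₀ K hK n t u v).trans ?_, iSup_le fun t => ?_⟩
    · exact mul_le_mul_left (mul_le_mul_left (hmono _ (by linarith)) _) _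
    · rcases n with _ | n
      · refine (freqNorm_opN1_one_sub_le hθ hK t u v).trans ?_
        exact mul_le_mul_left (mul_le_mul_left (hmono _ (by linarith)) _) _
      · refine (h₁ K hK n t u v).trans ?_
        exact mul_le_mul_left (mul_le_mul_left (hmono _ (by linarith)) _) _
  · intro R hR
    -- The sum over j converges whatever the size of R, by factorial decay, so smallness comes
    -- entirely from δ and τ < 1 is enough.
    refine ⟨1, one_pos, fun N₃ δ₃ hδ₃ N Tmax ε hT hε => ?_⟩
    set R₁ := max R 1
    have hR₁ : 1 ≤ R₁ := le_max_right _ _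
    set X := ((N : ℝ) + 1) * (2 * N + 1) * (3 * R₁ ^ 2 * ∑' n, decay (32 * R₁) n) with hX
    have hX0 : 0 ≤ X := by
      have : 0 ≤ ∑' n, decay (32 * R₁) n := tsum_nonneg fun n => (decay_pos (by linarith) n).le
      positivity
    -- The whole sum is at most eX; the summand 1 keeps e finite and the final inequality strict.
    set e := ε / (X + 1) with he
    have he0 : 0 < e := by positivity
    have heX : e * X < ε := by
      rw [he, div_mul_eq_mul_div, div_lt_iff₀ (by linarith)]
      nlinarith
    -- The tail threshold is chosen first; δ₄ then meets the tail hypothesis at level e, the range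
    -- δ(2N'+1) ≤ 1 of the expansion of coth, and the smallness of the phase difference for |t| ≤ T.
    -- None of these involves K or the family.
    set N' := N₃ e
    have hB : (0 : ℝ) < 2 * N' + 1 := by positivity
    refine ⟨min (δ₃ e) (min (1 / (2 * N' + 1)) (e / (Tmax * (3 * (2 * N' + 1) ^ 5)))),
      lt_min (hδ₃ e he0).1 (lt_min (by positivity) (by positivity)),
      (min_le_left _ _).trans (hδ₃ e he0).2, ?_⟩
    intro K hK _ u _ huR htail τ hτ δ hδ
    have hδ1 : δ < δ₃ e := hδ.2.trans_le (min_le_left _ _)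
    have hδ2 : δ < 1 / (2 * N' + 1) :=
      hδ.2.trans_le ((min_le_right _ _).trans (min_le_left _ _))
    have hδ3 : δ < e / (Tmax * (3 * (2 * N' + 1) ^ 5)) :=
      hδ.2.trans_le ((min_le_right _ _).trans (min_le_right _ _))
    have htl : ‖highPass M N' (u δ)‖ₑ ≤ ENNReal.ofReal e := by
      refine le_trans ?_ (htail e he0 N' le_rfl).le
      exact le_iSup₂ (f := fun δ (_ : δ ∈ Set.Ioc (0 : ℝ) (δ₃ e)) => ‖highPass M N' (u δ)‖ₑ) δ
        ⟨hδ.1, hδ1.le⟩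
    have hu : ‖u δ‖ ≤ R₁ :=
      (huR δ ⟨hδ.1, hδ1.le.trans (hδ₃ e he0).2⟩).trans (le_max_left _ _)
    rw [lt_div_iff₀ hB] at hδ2
    rw [lt_div_iff₀ (by positivity)] at hδ3
    have h := tsum_freqNorm_opE_le (N := N) hK he0.le
      (fun t ht x y hx hy => enorm_phaseDiff_le hδ.1 hT hδ2.le (by linarith) ht hx hy) hR₁ hu htl
    calc _ ≤ 1 * ENNReal.ofReal (e * X) := by
          refine mul_le_mul' ?_ h
          exact ENNReal.ofReal_le_one.2 hτ.2.le
      _ < ENNReal.ofReal ε := by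
          rw [one_mul]
          exact (ENNReal.ofReal_lt_ofReal_iff hε).2 heX
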